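/- **Model.** A hidden state switches from $L$ to $H$ at rate $\rho_L>0$ and from $H$ to $L$ at rate $\rho_H>0$; $\pi_0=\rho_L/(\rho_H+\rho_L)$. Crime opportunities arrive at rate $\lambda>0$ in state $H$ and never in state $L$; each is taken with probability $x\in[0,1]$ (the crime level). A policymaker (PM) with belief $p$ that the state is $H$ enforces at level $y(p)\in[0,1]$, at cost $c>0$ per unit. While no crime is detected, her belief follows $$\dot p=f(p,y(p)),\qquad f(p,y)=\rho_L(1-p)-\rho_Hp-p(1-p)\lambda x y ;$$ crimes are detected at rate $p\lambda x\,y(p)$, and each detection moves the belief to $1$. A policy $y(\cdot)$ is admissible if from each belief this evolution without detection exists and is unique. With discount rate $r>0$, the expected loss from prior $p_0$ is $\mathbb E\big[\int_0^\infty (p_t\lambda x(1-y(p_t))+c\,y(p_t))e^{-rt}dt\big]$. For crime rate $\kappa=\lambda x>0$, let $\pi_1(\kappa)\in(0,\pi_0)$ solve $f(\pi_1,1)=0$. The policy with cutoff $\hat p$ has $y(p)=1$ for $p>\hat p$ and $y(p)=0$ for $p<\hat p$; if $\hat p\in(\pi_1(\kappa),\pi_0)$, then $y(\hat p)=z(\hat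 p)$ with $f(\hat p,z(\hat p))=0$. Its long-run priors are $p_0=\pi_0$ if $\hat p\ge\pi_0$, $p_0\in[\hat p,1]$ if $\pi_1(\kappa)<\hat p<\pi_0$, and $p_0\in[\pi_1(\kappa),1]$ if $\hat p\le\pi_1(\kappa)$. **Criminals.** Let $\Phi$ be the unique stationary distribution of the belief process and $d\Psi=(p/\pi_0)\,d\Phi$ the distribution conditional on state $H$. Given a deterring level $\bar y\in(0,1)$, criminals choose $x=0$ if $\mathbb E_{p\sim\Psi}[y(p)]>\bar y$, $x=1$ if it is $<\bar y$, and any $x\in[0,1]$ if it equals $\bar y$. **Equilibria.** An equilibrium under greedy predictive enforcement (GP) is a pair $(x,y(\cdot))$ such that $y(\cdot)$ is admissible and at each $p\in[0,1]$ the level $y(p)$ minimizes the flow loss $p\lambda x(1-v)+cv$ over $v\in[0,1]$, and $x$ is the criminals' response to $\mathbb E_{p\sim\Psi}[y(p)]$. An equilibrium under non-predictive enforcement (NP) is a pair $(x,y)$ such that the constant $y\in[0,1]$ minimizes $\pi_0\lambda x(1-v)+cv$ over $v\in[0,1]$ and $x$ is the criminals' response to the enforcement level $y$. **Statement.** Fix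 $\rho_L,\rho_H,c>0$ and $\bar y\in(0,1)$. There is a smallest $\ell>0$, called $\lambda^M$, such that $\pi_1(\ell)<c/\ell<\pi_0$ and, at crime rate $\ell$, the policy with cutoff $c/\ell$ has $\mathbb E_{p\sim\Psi}[y(p)]=\bar y$. For each $\lambda>0$, GP admits an equilibrium in which: * if $\lambda\le\lambda^M$, then $x_{GP}=1\ge\min\{1,\frac{c}{\pi_0\lambda}\}=x_{NP}$, where $x_{NP}$ is the crime level in every NP equilibrium (and one exists), and $y_{GP}(\cdot)$ is a policy with cutoff $\hat p=c/\lambda$; * if $\lambda>\lambda^M$, then $x_{GP}=\lambda^M/\lambda\in(0,1)$ and $y_{GP}(\cdot)$ is a policy with cutoff $\hat p=c/\lambda^M$. In this equilibrium, for every $r>0$, the PM's expected loss is $\min\{\pi_0\lambda,c\}/r$ from every long-run prior; in particular it does not depend on $\bar y$. -/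

import Mathlib

open MeasureTheory ProbabilityTheory Set
open scoped ENNReal

namespace Enforcement

noncomputable section

/-- The hidden two-state Markov chain: it switches from low to high at rate `ρL` and from high to
low at rate `ρH`. -/
structure Chain where
  ρL : ℝ
  ρH : ℝ
  ρL_pos : 0 < ρL
  ρH_pos : 0 < ρH

namespace Chain

variable (C : Chain)

/-- The stationary probability of the high state. -/
def π₀ : ℝ := C.ρL / (C.ρH + C.ρL)

/-- The drift `f (p, y)` of the belief `p` while no crime is detected, under enforcement `y`.
Here and below `κ` is the crime rate `λ * x` in the high state. -/
def drift (κ p y : ℝ) : ℝ :=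
  C.ρL * (1 - p) - C.ρH * p - p * (1 - p) * κ * y

/-- The belief at which the drift under full enforcement vanishes (see `mem_Ioo_π₁`,
`drift_one_neg_iff` and `drift_π₁`). -/
def π₁ (κ : ℝ) : ℝ :=
  (C.ρL + C.ρH + κ - √((C.ρL + C.ρH + κ) ^ 2 - 4 * κ * C.ρL)) / (2 * κ)

/-- The enforcement level `z p`, which solves `f (p, z p) = 0` and so keeps a belief
`p ∈ (0, 1)` where it is as long as no crime is detected. -/
def stayLevel (κ p : ℝ) : ℝ :=
  (C.ρL * (1 - p) - C.ρH * p) / (p * (1 - p) * κ)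

theorem drift_stayLevel {κ p : ℝ} (hκ : 0 < κ) (hp : p ∈ Ioo (0 : ℝ) 1) :
    C.drift κ p (C.stayLevel κ p) = 0 := by
  have h1 : p * (1 - p) * κ ≠ 0 :=
    (mul_pos (mul_pos hp.1 (sub_pos.2 hp.2)) hκ).ne'
  rw [drift, stayLevel, mul_div_cancel₀ _ h1, sub_self]

theorem discr_pos {κ : ℝ} (hκ : 0 < κ) :
    0 < (C.ρL + C.ρH + κ) ^ 2 - 4 * κ * C.ρL := by
  have h1 := C.ρL_pos
  have h2 := C.ρH_pos
  nlinarith [sq_nonneg (C.ρL - κ + C.ρH), mul_pos h2 hκ]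

theorem drift_π₁ {κ : ℝ} (hκ : 0 < κ) : C.drift κ (C.π₁ κ) 1 = 0 := by
  have h := Real.sq_sqrt (C.discr_pos hκ).le
  set s := √((C.ρL + C.ρH + κ) ^ 2 - 4 * κ * C.ρL) with hs
  have h3 : 2 * κ * C.π₁ κ = C.ρL + C.ρH + κ - s := by
    rw [π₁, ← hs]; field_simp
  have h4 : 4 * κ * C.drift κ (C.π₁ κ) 1 = 0 := by
    have : 4 * κ * C.drift κ (C.π₁ κ) 1 =
        (2 * κ * C.π₁ κ) ^ 2 - 2 * (C.ρL + C.ρH + κ) * (2 * κ * C.π₁ κ) + 4 * κ * C.ρL := by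
      rw [drift]; ring
    rw [this, h3]
    linear_combination h
  rcases mul_eq_zero.1 h4 with h5 | h5
  · linarith
  · exact h5

theorem mem_Ioo_π₁ {κ : ℝ} (hκ : 0 < κ) : C.π₁ κ ∈ Ioo (0 : ℝ) 1 := by
  have h1 := C.ρL_pos
  have h2 := C.ρH_pos
  constructor
  · refine div_pos (sub_pos.2 ?_) (by linarith)
    rw [Real.sqrt_lt' (by linarith)]
    nlinarith [mul_pos hκ h1]
  · rw [π₁, div_lt_one (by linarith), sub_lt_comm]
    rcases lt_or_ge (C.ρL + C.ρH + κ - 2 * κ) 0 with h3 | h3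
    · exact h3.trans_le (Real.sqrt_nonneg _)
    · rw [Real.lt_sqrt h3]
      nlinarith [mul_pos hκ h2]

/-- On `(0, 1)`, the belief drifts down under full enforcement exactly above `π₁`. -/
theorem drift_one_neg_iff {κ p : ℝ} (hκ : 0 < κ) (hp : p ∈ Ioo (0 : ℝ) 1) :
    C.drift κ p 1 < 0 ↔ C.π₁ κ < p := by
  have h0 := C.drift_π₁ hκ
  have hm := C.mem_Ioo_π₁ hκ
  have h1 := C.ρL_pos
  set q := C.π₁ κ
  have key : q * C.drift κ p 1 = (q - p) * (C.ρL - κ * p * q) := by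
    rw [drift] at h0 ⊢
    linear_combination p * h0
  have hq : 0 < C.ρL - κ * p * q := by
    have e1 : (1 - q) * (C.ρL - κ * q) = C.ρH * q := by
      rw [drift] at h0
      linear_combination h0
    have e2 : 0 < C.ρL - κ * q := by
      by_contra hcon
      have := mul_pos C.ρH_pos hm.1
      nlinarith [hm.2]
    nlinarith [mul_pos hκ hm.1, hp.2]
  constructor
  · intro h
    have : (q - p) * (C.ρL - κ * p * q) < 0 := key ▸ mul_neg_of_pos_of_neg hm.1 h
    by_contra hcon
    exact absurd this (not_lt.2 (mul_nonneg (by linarith) hq.le))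
  · intro h
    have : q * C.drift κ p 1 < 0 := key ▸ mul_neg_of_neg_of_pos (by linarith) hq
    by_contra hcon
    exact absurd this (not_lt.2 (mul_nonneg hm.1.le (by linarith)))

/-! ### Policies and the belief process -/

/-- A Markov policy: an enforcement level in `[0, 1]` for each belief in `[0, 1]`. -/
def IsPolicy (y : ℝ → ℝ) : Prop :=
  Measurable y ∧ ∀ p ∈ Icc (0 : ℝ) 1, y p ∈ Icc (0 : ℝ) 1

/-- `φ` is an evolution, from belief `q`, of the belief under policy `y` while no crime is
detected: it solves `φ' = f (φ, y φ)` in integrated form. -/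
def IsPath (κ : ℝ) (y : ℝ → ℝ) (q : ℝ) (φ : ℝ → ℝ) : Prop :=
  ContinuousOn φ (Ici 0) ∧ (∀ t, 0 ≤ t → φ t ∈ Icc (0 : ℝ) 1) ∧
    ∀ t, 0 ≤ t → φ t = q + ∫ s in (0 : ℝ)..t, C.drift κ (φ s) (y (φ s))

/-- A policy is admissible if it makes the belief dynamics well defined: from each belief there is
exactly one evolution without detection. -/
def Admissible (κ : ℝ) (y : ℝ → ℝ) : Prop :=
  ∀ q ∈ Icc (0 : ℝ) 1, (∃ φ, C.IsPath κ y q φ) ∧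
    ∀ φ ψ, C.IsPath κ y q φ → C.IsPath κ y q ψ → EqOn φ ψ (Ici 0)

open Classical in
/-- The evolution from belief `q` without detection, under an admissible policy. -/
def path (κ : ℝ) (y : ℝ → ℝ) (q : ℝ) : ℝ → ℝ :=
  if h : ∃ φ, C.IsPath κ y q φ then h.choose else fun _ => q

/-- The cumulative detection rate along the evolution from `q`; at belief `p`, crimes are
detected at rate `p * κ * y p`. -/
def hazard (κ : ℝ) (y : ℝ → ℝ) (q t : ℝ) : ℝ :=
  ∫ s in (0 : ℝ)..t, C.path κ y q s * κ * y (C.path κ y q s)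

/-- The waiting time until the next detection, from belief `q`, as a function of a standard
exponential clock `e`; it is `∞` if the cumulative detection rate never reaches `e`. -/
def waitingTime (κ : ℝ) (y : ℝ → ℝ) (q e : ℝ) : ℝ≥0∞ :=
  ⨅ (t : ℝ) (_ : 0 ≤ t ∧ e ≤ C.hazard κ y q t), ENNReal.ofReal t

/-- The time of the `n`-th detection (counted from zero), from initial belief `q`, as a function of
a sequence `e` of exponential clocks. Each detection resets the belief to one. -/
def detectionTime (κ : ℝ) (y : ℝ → ℝ) (q : ℝ) (e : ℕ → ℝ) : ℕ → ℝ≥0∞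
  | 0 => C.waitingTime κ y q (e 0)
  | n + 1 => detectionTime κ y q e n + C.waitingTime κ y 1 (e (n + 1))

/-- The number of detections up to time `t` (almost surely finite). -/
def detections (κ : ℝ) (y : ℝ → ℝ) (q : ℝ) (e : ℕ → ℝ) (t : ℝ) : ℕ :=
  {k : ℕ | C.detectionTime κ y q e k ≤ ENNReal.ofReal t}.ncard

/-- The belief at time `t`, from initial belief `q`: it moves along the evolution without detection
and jumps to one at each detection. -/
def belief (κ : ℝ) (y : ℝ → ℝ) (q : ℝ) (e : ℕ → ℝ) (t : ℝ) : ℝ :=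
  match C.detections κ y q e t with
  | 0 => C.path κ y q t
  | n + 1 => C.path κ y 1 (t - (C.detectionTime κ y q e n).toReal)

/-- The law of a sequence of independent standard exponential clocks. -/
def clockLaw : Measure (ℕ → ℝ) :=
  haveI : ∀ _ : ℕ, IsProbabilityMeasure (expMeasure 1) :=
    fun _ => isProbabilityMeasure_expMeasure one_pos
  Measure.infinitePi fun _ : ℕ => expMeasure 1

/-! ### Long-run beliefs -/

/-- `Φ` is a stationary distribution of the belief process under policy `y`. -/
def IsStationary (κ : ℝ) (y : ℝ → ℝ) (Φ : Measure ℝ) : Prop :=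
  IsProbabilityMeasure Φ ∧ Φ (Icc 0 1)ᶜ = 0 ∧
    ∀ t, 0 ≤ t → ∀ B, MeasurableSet B →
      ∫⁻ q, clockLaw {e | C.belief κ y q e t ∈ B} ∂Φ = Φ B

/-- `Φ` is the unique stationary distribution of the belief process. -/
def IsLongRunLaw (κ : ℝ) (y : ℝ → ℝ) (Φ : Measure ℝ) : Prop :=
  C.IsStationary κ y Φ ∧ ∀ Φ', C.IsStationary κ y Φ' → Φ' = Φ

/-- The long-run distribution `Ψ` of the belief conditional on the high state, when `Φ` is the
unconditional one: `dΨ = (p / π₀) dΦ`. -/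
def lawGivenHigh (Φ : Measure ℝ) : Measure ℝ :=
  Φ.withDensity fun p => ENNReal.ofReal (p / C.π₀)

/-- The expected enforcement level conditional on the high state. -/
def enforcementGivenHigh (y : ℝ → ℝ) (Φ : Measure ℝ) : ℝ :=
  ∫ p, y p ∂C.lawGivenHigh Φ

/-- `y` is the policy with cutoff `phat`: full enforcement above it and none below. At a cutoff
that attracts the belief from both sides, enforcement keeps the belief there. -/
def IsCutoffPolicy (κ phat : ℝ) (y : ℝ → ℝ) : Prop :=
  (∀ p ∈ Icc (0 : ℝ) 1, (phat < p → y p = 1) ∧ (p < phat → y p = 0)) ∧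
    (phat ∈ Ioo (C.π₁ κ) C.π₀ → y phat = C.stayLevel κ phat)

/-- `phat` is the deterring cutoff at crime rate `κ`: it lies strictly between `π₁` and `π₀`, and
the policy with that cutoff yields the expected enforcement `ybar` conditional on the high state. -/
def IsDeterringCutoff (ybar κ phat : ℝ) : Prop :=
  phat ∈ Ioo (C.π₁ κ) C.π₀ ∧
    ∃ y Φ, IsPolicy y ∧ C.IsCutoffPolicy κ phat y ∧ C.Admissible κ y ∧
      C.IsLongRunLaw κ y Φ ∧ C.enforcementGivenHigh y Φ = ybar

open Classical in
/-- The long-run priors under the policy with cutoff `phat`. -/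
def longRunPriors (κ phat : ℝ) : Set ℝ :=
  if C.π₀ ≤ phat then {C.π₀}
  else if C.π₁ κ < phat then Icc phat 1
  else Icc (C.π₁ κ) 1

end Chain

/-! ### Payoffs and equilibria -/

/-- The policymaker's flow loss at belief `p` and enforcement `v`. -/
def flowLoss (c κ p v : ℝ) : ℝ := p * κ * (1 - v) + c * v

/-- The expected discounted loss from initial belief `q`. -/
def expectedLoss (C : Chain) (c r κ : ℝ) (y : ℝ → ℝ) (q : ℝ) : ℝ≥0∞ :=
  ∫⁻ e, (∫⁻ t in Ioi (0 : ℝ), ENNReal.ofReal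
    (flowLoss c κ (C.belief κ y q e t) (y (C.belief κ y q e t)) * Real.exp (-r * t)))
      ∂Chain.clockLaw

/-- The crime probability `x` is a best response to the expected enforcement level `E`. -/
def IsCriminalResponse (ybar E x : ℝ) : Prop :=
  x ∈ Icc (0 : ℝ) 1 ∧ (ybar < E → x = 0) ∧ (E < ybar → x = 1)

/-- `y` is a greedy policy: at each belief it minimizes the flow loss. -/
def IsGreedy (c κ : ℝ) (y : ℝ → ℝ) : Prop :=
  ∀ p ∈ Icc (0 : ℝ) 1, ∀ v ∈ Icc (0 : ℝ) 1, flowLoss c κ p (y p) ≤ flowLoss c κ p v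

/-- `(x, y)` is an equilibrium under greedy predictive enforcement: `y` is an admissible greedy
policy against `x`, and `x` is a best response to the long-run expected enforcement conditional
on the high state. -/
def IsGPEquilibrium (C : Chain) (c ybar lam x : ℝ) (y : ℝ → ℝ) : Prop :=
  Chain.IsPolicy y ∧ C.Admissible (lam * x) y ∧ IsGreedy c (lam * x) y ∧
    ∃ Φ, C.IsLongRunLaw (lam * x) y Φ ∧
      IsCriminalResponse ybar (C.enforcementGivenHigh y Φ) x

/-- `(x, v)` is an equilibrium under non-predictive enforcement: the constant level `v` minimizes
the flow loss at the belief `π₀`, and `x` is a best response to `v`. -/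
def IsNPEquilibrium (C : Chain) (c ybar lam x v : ℝ) : Prop :=
  v ∈ Icc (0 : ℝ) 1 ∧
    (∀ w ∈ Icc (0 : ℝ) 1, flowLoss c (lam * x) C.π₀ v ≤ flowLoss c (lam * x) C.π₀ w) ∧
    IsCriminalResponse ybar v x

end

end Enforcement

namespace Enforcement

/-! ### Exponential clocks -/

section Clocks

/-! Payoffs. Against an effective crime rate `κ` the flow loss is affine in enforcement with slope
`c - p * κ`, so the policy with cutoff `c / κ` is greedy. If that cutoff lies strictly between `π₁`
and `π₀`, beliefs starting in `[c / κ, 1]` stay there, and the flow loss is constantly `c`: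
enforcement is full above the cutoff, and at the cutoff every level costs `c`. If the cutoff is at
least `π₀`, the belief starting at `π₀` rests there without enforcement, and the flow loss is `π₀ *
κ`. Neither value involves `ybar`.

Well-posedness. A cutoff policy is monotone, and higher enforcement only pushes the belief down, so
the drift is one-sided Lipschitz (`drift_sub_le`). Evolutions are therefore unique and ordered, and
existence comes from explicit solutions glued at the cutoff.

Long-run law. Every detection restarts the process from belief one, so the occupation law of one
cycle is stationary (`isStationary_cycleLaw`). It is the only stationary law if the mean wait for a
detection is bounded uniformly in the initial belief (`isLongRunLaw_cycleLaw`). With a cutoff at or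
above `π₀` detections die out and this argument fails; there the law is shown directly to be the
point mass at `π₀` (`isLongRunLaw_dirac`).

Enforcement. For an attracting cutoff the belief slides from one to the cutoff, arriving undetected
with probability `σ`, and then rests there under the level `z`. A cycle contains exactly one
detection, and detections have rate `p * κ * y p`, so enforcement given the high state is the
inverse of `κ * π₀` times the mean cycle, which works out to `z / (z + (1 - z) * σ)`
(`IsCutoffPolicy.enforcementGivenHigh_eq`).

Deterring rate. With cutoff `c / ℓ`, the level `z` vanishes at `ℓ = c / π₀`, while enforcement is at
least `ybar` at some larger `ℓ`. Continuity gives a least crossing `lamM`, with enforcement at most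
`ybar` up to it (`exists_deterringRate`). So `x = 1` is a response for `lam ≤ lamM`; beyond, `x =
lamM / lam` holds the effective rate at `lamM`, where criminals are indifferent. -/

instance isProbabilityMeasure_expMeasure_one : IsProbabilityMeasure (expMeasure 1) :=
  isProbabilityMeasure_expMeasure one_pos

instance isProbabilityMeasure_clockLaw : IsProbabilityMeasure Chain.clockLaw := by
  unfold Chain.clockLaw; infer_instance

theorem expMeasure_one_Iic {a : ℝ} (ha : 0 ≤ a) :
    expMeasure 1 (Iic a) = ENNReal.ofReal (1 - Real.exp (-a)) := by
  have h := cdf_expMeasure_eq one_pos a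
  rw [if_pos ha, one_mul] at h
  rw [← h, cdf_eq_real, ofReal_measureReal]

theorem expMeasure_one_Ioi {a : ℝ} (ha : 0 ≤ a) :
    expMeasure 1 (Ioi a) = ENNReal.ofReal (Real.exp (-a)) := by
  rw [← compl_Iic, prob_compl_eq_one_sub measurableSet_Iic, expMeasure_one_Iic ha,
    ← ENNReal.ofReal_one, ← ENNReal.ofReal_sub _ (by simp [ha])]
  simp

theorem expMeasure_one_eq :
    expMeasure 1 = volume.withDensity (exponentialPDF 1) := rfl

theorem measurable_exponentialPDF_one : Measurable (exponentialPDF 1) :=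
  (measurable_exponentialPDFReal 1).ennreal_ofReal

/-- The exponential distribution is memoryless. -/
theorem expMeasure_one_memoryless {a : ℝ} (ha : 0 ≤ a) :
    ((expMeasure 1).restrict (Ioi a)).map (fun x => x - a) =
      ENNReal.ofReal (Real.exp (-a)) • expMeasure 1 := by
  ext B hB
  rw [Measure.map_apply (by fun_prop) hB, Measure.restrict_apply (hB.preimage (by fun_prop)),
    Measure.smul_apply, smul_eq_mul]
  -- The half-line up to zero is null; without it, translating by `a` multiplies the density by
  -- exactly `exp (-a)`.
  have h0 : expMeasure 1 B = expMeasure 1 (B ∩ Ioi 0) := by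
    have : expMeasure 1 (Iic 0) = 0 := by rw [expMeasure_one_Iic le_rfl]; simp
    refine measure_congr ?_
    have h1 : ∀ᵐ x ∂expMeasure 1, x ∈ Ioi (0 : ℝ) := by
      rw [ae_iff]; simpa [← Iic_def] using this
    filter_upwards [h1] with x hx
    exact propext ⟨fun h => ⟨h, hx⟩, fun h => h.1⟩
  rw [h0, expMeasure_one_eq, withDensity_apply _ (hB.inter measurableSet_Ioi),
    withDensity_apply _ ((hB.preimage (by fun_prop)).inter measurableSet_Ioi),
    ← lintegral_const_mul _ measurable_exponentialPDF_one,
    ← lintegral_indicator (hB.inter measurableSet_Ioi),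
    ← lintegral_indicator ((hB.preimage (by fun_prop)).inter measurableSet_Ioi),
    ← lintegral_sub_right_eq_self ((B ∩ Ioi 0).indicator _) a]
  refine lintegral_congr fun x => ?_
  by_cases hx : x - a ∈ B ∧ a < x
  · rw [indicator_of_mem (by exact hx), indicator_of_mem (by exact ⟨hx.1, sub_pos.2 hx.2⟩),
      exponentialPDF_of_nonneg (by linarith [hx.2]),
      exponentialPDF_of_nonneg (by linarith [hx.2]), ← ENNReal.ofReal_mul (Real.exp_pos _).le]
    congr 1
    rw [one_mul, one_mul, one_mul, one_mul, ← Real.exp_add]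
    ring_nf
  · rw [indicator_of_notMem (by exact hx), indicator_of_notMem]
    rintro ⟨h1, h2⟩
    exact hx ⟨h1, sub_pos.1 h2⟩

/-- Prepend a clock to a sequence of clocks. -/
def consClock (x : ℝ) (e : ℕ → ℝ) : ℕ → ℝ
  | 0 => x
  | n + 1 => e n

/-- Drop the first clock. -/
def shiftClock (e : ℕ → ℝ) : ℕ → ℝ := fun n => e (n + 1)

@[simp] theorem consClock_zero (x : ℝ) (e : ℕ → ℝ) : consClock x e 0 = x := rfl

@[simp] theorem consClock_succ (x : ℝ) (e : ℕ → ℝ) (n : ℕ) : consClock x e (n + 1) = e n := rfl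

@[simp] theorem shiftClock_consClock (x : ℝ) (e : ℕ → ℝ) : shiftClock (consClock x e) = e := rfl

theorem measurable_consClock : Measurable fun p : ℝ × (ℕ → ℝ) => consClock p.1 p.2 := by
  refine measurable_pi_lambda _ fun n => ?_
  cases n with
  | zero => exact measurable_fst
  | succ n => exact (measurable_pi_apply n).comp measurable_snd

theorem measurable_shiftClock : Measurable shiftClock :=
  measurable_pi_lambda _ fun n => measurable_pi_apply (n + 1)

theorem clockLaw_pi (s : Finset ℕ) (t : ℕ → Set ℝ) (ht : ∀ i, MeasurableSet (t i)) :
    Chain.clockLaw (Set.pi s t) = ∏ i ∈ s, expMeasure 1 (t i) := by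
  unfold Chain.clockLaw
  exact Measure.infinitePi_pi _ fun i _ => ht i

/-- An infinite product is determined by its cylinders, and a cylinder splits into its coordinate
zero and a cylinder in the other coordinates. This is what allows conditioning on the first clock.
-/
theorem map_consClock :
    ((expMeasure 1).prod Chain.clockLaw).map (fun p => consClock p.1 p.2) = Chain.clockLaw := by
  conv_rhs => unfold Chain.clockLaw
  refine Measure.eq_infinitePi _ fun s t ht => ?_
  classical
  -- The index set is enlarged to an initial segment containing zero; the added coordinates carry
  -- the factor `univ`, of mass one.
  obtain ⟨N, hN⟩ := s.exists_nat_subset_range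
  have hN' : s ⊆ Finset.range (N + 1) :=
    hN.trans (Finset.range_subset_range.2 (Nat.le_succ N))
  set t' : ℕ → Set ℝ := fun i => if i ∈ s then t i else univ with ht'
  have hm : ∀ i, MeasurableSet (t' i) := fun i => by
    by_cases h : i ∈ s <;> simp [t', h, ht]
  have hpre : (fun p : ℝ × (ℕ → ℝ) => consClock p.1 p.2) ⁻¹' (Set.pi s t) =
      t' 0 ×ˢ Set.pi (Finset.range N) (fun i => t' (i + 1)) := by
    ext ⟨x, e⟩
    simp only [mem_preimage, Set.mem_pi, Finset.mem_coe, mem_prod, Finset.mem_range]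
    constructor
    · intro h
      refine ⟨?_, fun i _ => ?_⟩
      · by_cases h0 : 0 ∈ s
        · simpa [t', h0] using h 0 h0
        · simp [t', h0]
      · by_cases h0 : i + 1 ∈ s
        · simpa [t', h0] using h (i + 1) h0
        · simp [t', h0]
    · rintro ⟨h0, h1⟩ i hi
      cases i with
      | zero => simpa [t', hi] using h0
      | succ i =>
        have := h1 i (by have := Finset.mem_range.1 (hN' hi); omega)
        simpa [t', hi] using this
  rw [Measure.map_apply measurable_consClock (.pi s.countable_toSet fun i _ => ht i), hpre,
    Measure.prod_prod, clockLaw_pi _ _ fun i => hm (i + 1), mul_comm,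
    ← Finset.prod_range_succ' (fun i => expMeasure 1 (t' i))]
  rw [← Finset.prod_subset hN' (f := fun i => expMeasure 1 (t' i))]
  · exact Finset.prod_congr rfl fun i hi => by simp [t', hi]
  · intro i _ hi
    simp [t', hi]

theorem lintegral_clockLaw {f : (ℕ → ℝ) → ℝ≥0∞} (hf : Measurable f) :
    ∫⁻ e, f e ∂Chain.clockLaw =
      ∫⁻ x, ∫⁻ e, f (consClock x e) ∂Chain.clockLaw ∂expMeasure 1 := by
  conv_lhs => rw [← map_consClock]
  rw [lintegral_map hf measurable_consClock,
    lintegral_prod (fun p : ℝ × (ℕ → ℝ) => f (consClock p.1 p.2))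
      (hf.comp measurable_consClock).aemeasurable]

theorem lintegral_shiftClock {f : (ℕ → ℝ) → ℝ≥0∞} (hf : Measurable f) :
    ∫⁻ e, f (shiftClock e) ∂Chain.clockLaw = ∫⁻ e, f e ∂Chain.clockLaw := by
  rw [lintegral_clockLaw (f := fun e => f (shiftClock e)) (hf.comp measurable_shiftClock)]
  simp

theorem measurePreserving_shiftClock :
    MeasurePreserving shiftClock Chain.clockLaw Chain.clockLaw := by
  refine ⟨measurable_shiftClock, Measure.ext fun B hB => ?_⟩
  rw [Measure.map_apply measurable_shiftClock hB, ← lintegral_indicator_one hB,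
    ← lintegral_shiftClock (measurable_one.indicator hB),
    ← lintegral_indicator_one (measurable_shiftClock hB)]
  rfl

theorem lintegral_clock_zero {f : ℝ → ℝ≥0∞} (hf : Measurable f) :
    ∫⁻ e, f (e 0) ∂Chain.clockLaw = ∫⁻ x, f x ∂expMeasure 1 := by
  rw [lintegral_clockLaw (f := fun e => f (e 0)) (hf.comp (measurable_pi_apply 0))]
  simp

/-- Given that the first clock exceeds `a`, its excess over `a` is again exponential and
independent of the other clocks. -/
theorem clockLaw_memoryless {a : ℝ} (ha : 0 ≤ a) {B : Set (ℕ → ℝ)} (hB : MeasurableSet B) :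
    Chain.clockLaw {e | a < e 0 ∧ consClock (e 0 - a) (shiftClock e) ∈ B} =
      ENNReal.ofReal (Real.exp (-a)) * Chain.clockLaw B := by
  have hm1 : Measurable fun e : ℕ → ℝ => consClock (e 0 - a) (shiftClock e) :=
    measurable_consClock.comp (f := fun e : ℕ → ℝ => (e 0 - a, shiftClock e))
      (((measurable_pi_apply (0 : ℕ)).sub_const a).prodMk measurable_shiftClock)
  have hmS : MeasurableSet {e : ℕ → ℝ | a < e 0 ∧ consClock (e 0 - a) (shiftClock e) ∈ B} :=
    (measurableSet_lt measurable_const (measurable_pi_apply 0)).inter (hm1 hB)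
  have hg : Measurable fun x => ∫⁻ e, B.indicator 1 (consClock x e) ∂Chain.clockLaw :=
    Measurable.lintegral_prod_right'
      (f := fun p : ℝ × (ℕ → ℝ) => B.indicator (1 : (ℕ → ℝ) → ℝ≥0∞) (consClock p.1 p.2))
      ((measurable_one.indicator hB).comp measurable_consClock)
  rw [← lintegral_indicator_one hmS, ← lintegral_indicator_one hB,
    lintegral_clockLaw (measurable_one.indicator hmS),
    lintegral_clockLaw (measurable_one.indicator hB), ← smul_eq_mul,
    ← lintegral_smul_measure, ← expMeasure_one_memoryless ha, lintegral_map hg (by fun_prop),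
    ← lintegral_indicator measurableSet_Ioi]
  refine lintegral_congr fun x => ?_
  by_cases hx : a < x
  · rw [indicator_of_mem (by exact hx)]
    refine lintegral_congr fun e => ?_
    by_cases h : consClock (x - a) e ∈ B <;> simp [indicator, hx, h]
  · rw [indicator_of_notMem (by exact hx)]
    simp [indicator, hx]

/-- A nonpositive clock would ring at time zero even with zero cumulative rate, so such clocks must
be discarded. -/
theorem ae_clock_pos : ∀ᵐ e ∂Chain.clockLaw, 0 < e 0 := by
  have h := clockLaw_pi {0} (fun _ => Iic 0) fun _ => measurableSet_Iic
  rw [Finset.prod_singleton, expMeasure_one_Iic le_rfl] at h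
  rw [ae_iff]
  refine measure_mono_null (fun e he => ?_) (h.trans (by simp))
  simpa [Set.mem_pi] using he

theorem clockLaw_forall_le {M : ℝ} (hM : 0 ≤ M) (a n : ℕ) :
    Chain.clockLaw {e | ∀ k, k < n → e (a + k) ≤ M} =
      ENNReal.ofReal (1 - Real.exp (-M)) ^ n := by
  classical
  have h := clockLaw_pi ((Finset.range n).image (a + ·)) (fun _ => Iic M)
    fun _ => measurableSet_Iic
  rw [Finset.prod_const, Finset.card_image_of_injective _ (add_right_injective a),
    Finset.card_range, expMeasure_one_Iic hM] at h
  rw [← h]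
  congr 1
  ext e
  simp [Set.mem_pi]

theorem tendsto_clockLaw_forall_le (M : ℝ) :
    Filter.Tendsto (fun n : ℕ => ENNReal.ofReal (1 - Real.exp (-M)) ^ n) Filter.atTop
      (nhds 0) := by
  refine ENNReal.tendsto_pow_atTop_nhds_zero_of_lt_one ?_
  rw [← ENNReal.ofReal_one, ENNReal.ofReal_lt_ofReal_iff one_pos]
  linarith [Real.exp_pos (-M)]

/-- Used to exclude explosion: cumulative rates grow at speed at most `κ`, so each clock above one
costs a time of at least `1 / κ`. -/
theorem ae_frequently_clock_gt : ∀ᵐ e ∂Chain.clockLaw, ∀ N : ℕ, ∃ k, N ≤ k ∧ 1 < e k := by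
  rw [ae_all_iff]
  intro N
  rw [ae_iff]
  have hle : ∀ n : ℕ, Chain.clockLaw {e | ¬∃ k, N ≤ k ∧ 1 < e k} ≤
      ENNReal.ofReal (1 - Real.exp (-1)) ^ n := fun n => by
    rw [← clockLaw_forall_le zero_le_one N n]
    refine measure_mono fun e he k _ => ?_
    by_contra hcon
    exact he ⟨N + k, by omega, by simpa using hcon⟩
  exact le_antisymm (ge_of_tendsto' (tendsto_clockLaw_forall_le 1) hle) bot_le

end Clocks

namespace Chain

/-! ### Evolution without detection -/

section Path

variable {C : Chain} {κ : ℝ} {y : ℝ → ℝ} {q : ℝ} {φ : ℝ → ℝ}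

theorem intervalIntegrable_comp {G : ℝ → ℝ} {M : ℝ} (hG : Measurable G)
    (hM : ∀ p ∈ Icc (0 : ℝ) 1, |G p| ≤ M) (hφ : ContinuousOn φ (Ici 0))
    (hφm : ∀ t, 0 ≤ t → φ t ∈ Icc (0 : ℝ) 1) {a b : ℝ} (ha : 0 ≤ a) (hb : 0 ≤ b) :
    IntervalIntegrable (fun s => G (φ s)) volume a b := by
  have hsub : uIoc a b ⊆ Ici 0 := fun x hx => (le_min ha hb).trans hx.1.le
  rw [intervalIntegrable_iff]
  have : IsFiniteMeasure (volume.restrict (uIoc a b)) :=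
    ⟨by rw [Measure.restrict_apply_univ]; exact measure_Ioc_lt_top⟩
  refine Integrable.of_bound ?_ M ?_
  · have h : AEMeasurable (fun s => G (φ s)) (volume.restrict (uIoc a b)) :=
      hG.comp_aemeasurable ((hφ.mono hsub).aemeasurable measurableSet_uIoc)
    exact h.aestronglyMeasurable
  · filter_upwards [ae_restrict_mem measurableSet_uIoc] with s hs
    exact hM _ (hφm s (hsub hs))

theorem measurable_drift_policy (hy : Measurable y) :
    Measurable fun p => C.drift κ p (y p) := by
  unfold drift; fun_prop

theorem abs_drift_le {p v : ℝ} (hκ : 0 ≤ κ) (hp : p ∈ Icc (0 : ℝ) 1) (hv : v ∈ Icc (0 : ℝ) 1) :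
    |C.drift κ p v| ≤ C.ρL + C.ρH + κ := by
  have h1 := C.ρL_pos
  have h2 := C.ρH_pos
  have h3 : 0 ≤ p * (1 - p) * κ * v :=
    mul_nonneg (mul_nonneg (mul_nonneg hp.1 (by linarith [hp.2])) hκ) hv.1
  have h4 : p * (1 - p) * κ * v ≤ κ := by
    have h5 : p * (1 - p) ≤ 1 := by nlinarith [hp.1, hp.2]
    have h6 : p * (1 - p) * κ ≤ κ := mul_le_of_le_one_left hκ h5
    have h7 : 0 ≤ p * (1 - p) * κ := mul_nonneg (mul_nonneg hp.1 (by linarith [hp.2])) hκ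
    exact (mul_le_of_le_one_right h7 hv.2).trans h6
  have h5 : 0 ≤ C.ρL * (1 - p) := mul_nonneg h1.le (by linarith [hp.2])
  have h6 : 0 ≤ C.ρH * p := mul_nonneg h2.le hp.1
  have h7 : C.ρL * (1 - p) ≤ C.ρL := by nlinarith [hp.1]
  have h8 : C.ρH * p ≤ C.ρH := by nlinarith [hp.2]
  rw [drift, abs_le]
  constructor <;> linarith

theorem IsPath.intervalIntegrable_drift (hκ : 0 ≤ κ) (hy : IsPolicy y) (hφ : C.IsPath κ y q φ)
    {a b : ℝ} (ha : 0 ≤ a) (hb : 0 ≤ b) :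
    IntervalIntegrable (fun s => C.drift κ (φ s) (y (φ s))) volume a b :=
  intervalIntegrable_comp (G := fun p => C.drift κ p (y p)) (measurable_drift_policy hy.1)
    (fun p hp => abs_drift_le hκ hp (hy.2 p hp)) hφ.1 hφ.2.1 ha hb

theorem IsPath.intervalIntegrable_rate (hκ : 0 ≤ κ) (hy : IsPolicy y) (hφ : C.IsPath κ y q φ)
    {a b : ℝ} (ha : 0 ≤ a) (hb : 0 ≤ b) :
    IntervalIntegrable (fun s => φ s * κ * y (φ s)) volume a b := by
  refine intervalIntegrable_comp (G := fun p => p * κ * y p) (M := κ)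
    (by have := hy.1; fun_prop) (fun p hp => ?_) hφ.1 hφ.2.1 ha hb
  have hv := hy.2 p hp
  rw [abs_of_nonneg (mul_nonneg (mul_nonneg hp.1 hκ) hv.1)]
  exact (mul_le_of_le_one_right (mul_nonneg hp.1 hκ) hv.2).trans
    (mul_le_of_le_one_left hκ hp.2)

theorem isPath_path (hadm : C.Admissible κ y) (hq : q ∈ Icc (0 : ℝ) 1) :
    C.IsPath κ y q (C.path κ y q) := by
  have h := (hadm q hq).1
  rw [path, dif_pos h]
  exact h.choose_spec

theorem path_eq (hadm : C.Admissible κ y) (hq : q ∈ Icc (0 : ℝ) 1) (hφ : C.IsPath κ y q φ)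
    {t : ℝ} (ht : 0 ≤ t) : C.path κ y q t = φ t :=
  (hadm q hq).2 _ _ (isPath_path hadm hq) hφ ht

theorem path_mem (hadm : C.Admissible κ y) (hq : q ∈ Icc (0 : ℝ) 1) {t : ℝ} (ht : 0 ≤ t) :
    C.path κ y q t ∈ Icc (0 : ℝ) 1 :=
  (isPath_path hadm hq).2.1 t ht

theorem IsPath.apply_zero (hφ : C.IsPath κ y q φ) : φ 0 = q := by
  simpa using hφ.2.2 0 le_rfl

theorem IsPath.shift (hκ : 0 ≤ κ) (hy : IsPolicy y) (hφ : C.IsPath κ y q φ) {s : ℝ}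
    (hs : 0 ≤ s) : C.IsPath κ y (φ s) fun t => φ (s + t) := by
  refine ⟨hφ.1.comp (by fun_prop) fun t ht => add_nonneg hs ht,
    fun t ht => hφ.2.1 _ (add_nonneg hs ht), fun t ht => ?_⟩
  have h1 := hφ.2.2 s hs
  have h2 := hφ.2.2 (s + t) (add_nonneg hs ht)
  have h3 := intervalIntegral.integral_add_adjacent_intervals
    (hφ.intervalIntegrable_drift hκ hy le_rfl hs)
    (hφ.intervalIntegrable_drift hκ hy hs (add_nonneg hs ht))
  have h4 := intervalIntegral.integral_comp_add_left (a := 0) (b := t)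
    (fun s => C.drift κ (φ s) (y (φ s))) s
  rw [add_zero] at h4
  rw [h4]
  linarith

/-- Restarting an evolution midway gives an evolution from the point reached, and uniqueness
identifies the two. -/
theorem path_add (hκ : 0 ≤ κ) (hy : IsPolicy y) (hadm : C.Admissible κ y)
    (hq : q ∈ Icc (0 : ℝ) 1) {s t : ℝ} (hs : 0 ≤ s) (ht : 0 ≤ t) :
    C.path κ y q (s + t) = C.path κ y (C.path κ y q s) t :=
  (path_eq hadm (path_mem hadm hq hs) ((isPath_path hadm hq).shift hκ hy hs) ht).symm

theorem hazard_eq (hadm : C.Admissible κ y) (hq : q ∈ Icc (0 : ℝ) 1) (hφ : C.IsPath κ y q φ)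
    {t : ℝ} (ht : 0 ≤ t) : C.hazard κ y q t = ∫ s in (0 : ℝ)..t, φ s * κ * y (φ s) := by
  refine intervalIntegral.integral_congr fun s hs => ?_
  rw [uIcc_of_le ht] at hs
  rw [path_eq hadm hq hφ hs.1]

theorem hazard_add (hκ : 0 ≤ κ) (hy : IsPolicy y) (hadm : C.Admissible κ y)
    (hq : q ∈ Icc (0 : ℝ) 1) {s t : ℝ} (hs : 0 ≤ s) (ht : 0 ≤ t) :
    C.hazard κ y q (s + t) = C.hazard κ y q s + C.hazard κ y (C.path κ y q s) t := by
  have hφ := isPath_path hadm hq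
  rw [hazard_eq hadm (path_mem hadm hq hs) (hφ.shift hκ hy hs) ht, hazard, hazard,
    intervalIntegral.integral_comp_add_left
      (fun u => C.path κ y q u * κ * y (C.path κ y q u)) s, add_zero,
    intervalIntegral.integral_add_adjacent_intervals
      (hφ.intervalIntegrable_rate hκ hy le_rfl hs)
      (hφ.intervalIntegrable_rate hκ hy hs (add_nonneg hs ht))]

theorem rate_mem (hκ : 0 ≤ κ) (hy : IsPolicy y) {p : ℝ} (hp : p ∈ Icc (0 : ℝ) 1) :
    p * κ * y p ∈ Icc 0 κ :=
  ⟨mul_nonneg (mul_nonneg hp.1 hκ) (hy.2 p hp).1,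
    (mul_le_of_le_one_right (mul_nonneg hp.1 hκ) (hy.2 p hp).2).trans
      (mul_le_of_le_one_left hκ hp.2)⟩

theorem hazard_nonneg (hκ : 0 ≤ κ) (hy : IsPolicy y) (hadm : C.Admissible κ y)
    (hq : q ∈ Icc (0 : ℝ) 1) {t : ℝ} (ht : 0 ≤ t) : 0 ≤ C.hazard κ y q t :=
  intervalIntegral.integral_nonneg ht fun _ hs =>
    (rate_mem hκ hy (path_mem hadm hq hs.1)).1

theorem hazard_le (hκ : 0 ≤ κ) (hy : IsPolicy y) (hadm : C.Admissible κ y)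
    (hq : q ∈ Icc (0 : ℝ) 1) {t : ℝ} (ht : 0 ≤ t) : C.hazard κ y q t ≤ κ * t := by
  have h := intervalIntegral.integral_mono_on ht
    ((isPath_path hadm hq).intervalIntegrable_rate hκ hy le_rfl ht)
    (intervalIntegrable_const (c := κ)) fun s hs => (rate_mem hκ hy (path_mem hadm hq hs.1)).2
  simpa [hazard, mul_comm] using h

theorem hazard_mono (hκ : 0 ≤ κ) (hy : IsPolicy y) (hadm : C.Admissible κ y)
    (hq : q ∈ Icc (0 : ℝ) 1) {s t : ℝ} (hs : 0 ≤ s) (hst : s ≤ t) :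
    C.hazard κ y q s ≤ C.hazard κ y q t := by
  have h := hazard_add hκ hy hadm hq hs (sub_nonneg.2 hst)
  rw [add_sub_cancel] at h
  linarith [hazard_nonneg hκ hy hadm (path_mem hadm hq hs) (sub_nonneg.2 hst)]

theorem hazard_add_le (hκ : 0 ≤ κ) (hy : IsPolicy y) (hadm : C.Admissible κ y)
    (hq : q ∈ Icc (0 : ℝ) 1) {s t : ℝ} (hs : 0 ≤ s) (ht : 0 ≤ t) :
    C.hazard κ y q (s + t) ≤ C.hazard κ y q s + κ * t := by
  rw [hazard_add hκ hy hadm hq hs ht]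
  linarith [hazard_le hκ hy hadm (path_mem hadm hq hs) ht]

end Path

/-! ### Detection times -/

section Detection

variable {C : Chain} {κ : ℝ} {y : ℝ → ℝ} {q : ℝ}

/-- No detection has occurred by time `s` exactly if the cumulative detection rate at `s` has not
reached the clock. -/
theorem lt_waitingTime_iff (hκ : 0 < κ) (hy : IsPolicy y) (hadm : C.Admissible κ y)
    (hq : q ∈ Icc (0 : ℝ) 1) {s e : ℝ} (hs : 0 ≤ s) :
    ENNReal.ofReal s < C.waitingTime κ y q e ↔ C.hazard κ y q s < e := by
  constructor
  · intro h
    by_contra! hcon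
    exact absurd h (not_lt.2 (iInf₂_le s ⟨hs, hcon⟩))
  · intro h
    -- The cumulative rate needs at least the extra time `d` to climb to `e`; this margin makes the
    -- inequality for the infimum strict.
    set d := (e - C.hazard κ y q s) / κ with hd
    have hd0 : 0 < d := div_pos (sub_pos.2 h) hκ
    have hκd : κ * d = e - C.hazard κ y q s := mul_div_cancel₀ _ hκ.ne'
    refine ((ENNReal.ofReal_lt_ofReal_iff (by linarith)).2 (lt_add_of_pos_right s hd0)).trans_le ?_
    refine le_iInf₂ fun t ht => ENNReal.ofReal_le_ofReal ?_
    by_contra! hcon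
    rcases le_total s t with h1 | h1
    · have h2 := hazard_add_le hκ.le hy hadm hq hs (sub_nonneg.2 h1)
      rw [add_sub_cancel] at h2
      have h3 : κ * (t - s) < κ * d := mul_lt_mul_of_pos_left (by linarith) hκ
      linarith [ht.2]
    · linarith [ht.2, hazard_mono hκ.le hy hadm hq ht.1 h1]

theorem waitingTime_le_iff (hκ : 0 < κ) (hy : IsPolicy y) (hadm : C.Admissible κ y)
    (hq : q ∈ Icc (0 : ℝ) 1) {s e : ℝ} (hs : 0 ≤ s) :
    C.waitingTime κ y q e ≤ ENNReal.ofReal s ↔ e ≤ C.hazard κ y q s := by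
  rw [← not_lt, lt_waitingTime_iff hκ hy hadm hq hs, not_lt]

/-- An extended nonnegative number is determined by the reals below it. -/
theorem eq_of_forall_ofReal_lt_iff {a b : ℝ≥0∞}
    (h : ∀ s : ℝ, 0 ≤ s → (ENNReal.ofReal s < a ↔ ENNReal.ofReal s < b)) : a = b := by
  have key : ∀ a b : ℝ≥0∞,
      (∀ s : ℝ, 0 ≤ s → ENNReal.ofReal s < a → ENNReal.ofReal s < b) → a ≤ b := fun a b h => by
    by_contra! hba
    have h1 := h b.toReal ENNReal.toReal_nonneg
    rw [ENNReal.ofReal_toReal (ne_top_of_lt hba)] at h1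
    exact lt_irrefl _ (h1 hba)
  exact le_antisymm (key a b fun s hs => (h s hs).1) (key b a fun s hs => (h s hs).2)

/-- As long as no detection has occurred, the remaining waiting time is the waiting time from the
current belief with the remaining clock. -/
theorem waitingTime_path (hκ : 0 < κ) (hy : IsPolicy y) (hadm : C.Admissible κ y)
    (hq : q ∈ Icc (0 : ℝ) 1) {s e : ℝ} (hs : 0 ≤ s) (he : C.hazard κ y q s < e) :
    C.waitingTime κ y q e = ENNReal.ofReal s +
      C.waitingTime κ y (C.path κ y q s) (e - C.hazard κ y q s) := by
  refine eq_of_forall_ofReal_lt_iff fun u hu => ?_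
  rw [lt_waitingTime_iff hκ hy hadm hq hu]
  rcases lt_or_ge u s with h | h
  · refine iff_of_true ((hazard_mono hκ.le hy hadm hq hu h.le).trans_lt he) ?_
    exact ((ENNReal.ofReal_lt_ofReal_iff (hu.trans_lt h)).2 h).trans_le le_self_add
  · have h1 : u = s + (u - s) := by ring
    have h0 := sub_nonneg.2 h
    rw [h1, hazard_add hκ.le hy hadm hq hs h0, ENNReal.ofReal_add hs h0,
      ENNReal.add_lt_add_iff_left ENNReal.ofReal_ne_top,
      lt_waitingTime_iff hκ hy hadm (path_mem hadm hq hs) h0, lt_sub_iff_add_lt']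

theorem detectionTime_mono (e : ℕ → ℝ) : Monotone (C.detectionTime κ y q e) :=
  monotone_nat_of_le_succ fun n => by rw [detectionTime]; exact le_self_add

theorem detectionTime_succ (e : ℕ → ℝ) (n : ℕ) :
    C.detectionTime κ y q e (n + 1) =
      C.waitingTime κ y q (e 0) + C.detectionTime κ y 1 (shiftClock e) n := by
  induction n with
  | zero => rfl
  | succ n ih =>
    rw [detectionTime, ih, detectionTime, add_assoc]
    rfl

/-- Only successor values are characterized: `ncard` is zero both for the empty set and for infinite
sets. -/
theorem ncard_eq_succ_iff {S : Set ℕ} (hS : ∀ i j, i ≤ j → j ∈ S → i ∈ S) (n : ℕ) :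
    S.ncard = n + 1 ↔ n ∈ S ∧ n + 1 ∉ S := by
  constructor
  · intro h
    have hfin : S.Finite := finite_of_ncard_pos (by omega)
    constructor
    · by_contra hn
      have hsub : S ⊆ (Finset.range n : Set ℕ) := fun k hk => by
        rw [Finset.mem_coe, Finset.mem_range]
        by_contra hkn
        exact hn (hS n k (not_lt.1 hkn) hk)
      have := ncard_le_ncard hsub (Finset.finite_toSet _)
      rw [ncard_coe_finset, Finset.card_range] at this
      omega
    · intro hn
      have hsub : (Finset.range (n + 2) : Set ℕ) ⊆ S := fun k hk => by
        rw [Finset.mem_coe, Finset.mem_range] at hk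
        exact hS k (n + 1) (by omega) hn
      have := ncard_le_ncard hsub hfin
      rw [ncard_coe_finset, Finset.card_range] at this
      omega
  · rintro ⟨h1, h2⟩
    have : S = (Finset.range (n + 1) : Set ℕ) := by
      ext k
      rw [Finset.mem_coe, Finset.mem_range]
      refine ⟨fun hk => ?_, fun hk => hS k n (by omega) h1⟩
      by_contra hkn
      exact h2 (hS (n + 1) k (not_lt.1 hkn) hk)
    rw [this, ncard_coe_finset, Finset.card_range]

theorem detections_eq_succ_iff (e : ℕ → ℝ) (t : ℝ) (n : ℕ) :
    C.detections κ y q e t = n + 1 ↔ C.detectionTime κ y q e n ≤ ENNReal.ofReal t ∧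
      ENNReal.ofReal t < C.detectionTime κ y q e (n + 1) := by
  rw [detections, ncard_eq_succ_iff (S := {k | C.detectionTime κ y q e k ≤ ENNReal.ofReal t})
    fun i j hij hj => (detectionTime_mono e hij).trans hj]
  simp only [mem_ofPred_eq, not_le]

theorem belief_of_mem_Ico {e : ℕ → ℝ} {t : ℝ} {n : ℕ}
    (h1 : C.detectionTime κ y q e n ≤ ENNReal.ofReal t)
    (h2 : ENNReal.ofReal t < C.detectionTime κ y q e (n + 1)) :
    C.belief κ y q e t = C.path κ y 1 (t - (C.detectionTime κ y q e n).toReal) := by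
  rw [belief, (detections_eq_succ_iff e t n).2 ⟨h1, h2⟩]

/-- This covers the absence of detections and also infinitely many of them before `t`, because
`detections` is then zero as well. -/
theorem belief_of_forall_not {e : ℕ → ℝ} {t : ℝ}
    (h : ∀ n, ¬ (C.detectionTime κ y q e n ≤ ENNReal.ofReal t ∧
      ENNReal.ofReal t < C.detectionTime κ y q e (n + 1))) :
    C.belief κ y q e t = C.path κ y q t := by
  have h0 : C.detections κ y q e t = 0 := by
    rcases Nat.eq_zero_or_eq_succ_pred (C.detections κ y q e t) with h0 | h0
    · exact h0
    · exact absurd ((detections_eq_succ_iff e t _).1 h0) (h _)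
  rw [belief, h0]

theorem belief_of_lt_waitingTime {e : ℕ → ℝ} {t : ℝ}
    (h : ENNReal.ofReal t < C.waitingTime κ y q (e 0)) :
    C.belief κ y q e t = C.path κ y q t :=
  belief_of_forall_not fun n hn =>
    absurd (h.trans_le ((detectionTime_mono e (Nat.zero_le n)).trans hn.1)) (lt_irrefl _)

/-- The belief is on the evolution from the initial belief, or on the evolution from one since the
last detection. -/
theorem belief_cases (e : ℕ → ℝ) {t : ℝ} (ht : 0 ≤ t) :
    C.belief κ y q e t = C.path κ y q t ∨
      ∃ n, C.detectionTime κ y q e n ≤ ENNReal.ofReal t ∧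
        (C.detectionTime κ y q e n).toReal ≤ t ∧
        C.belief κ y q e t = C.path κ y 1 (t - (C.detectionTime κ y q e n).toReal) := by
  by_cases h : ∃ n, C.detectionTime κ y q e n ≤ ENNReal.ofReal t ∧
      ENNReal.ofReal t < C.detectionTime κ y q e (n + 1)
  · obtain ⟨n, h1, h2⟩ := h
    exact .inr ⟨n, h1, ENNReal.toReal_le_of_le_ofReal ht h1, belief_of_mem_Ico h1 h2⟩
  · push Not at h
    exact .inl (belief_of_forall_not fun n hn => absurd hn.2 (not_lt.2 (h n hn.1)))

theorem belief_mem_of_forall_path_mem {I : Set ℝ} (hq : ∀ t, 0 ≤ t → C.path κ y q t ∈ I)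
    (h1 : ∀ t, 0 ≤ t → C.path κ y 1 t ∈ I) (e : ℕ → ℝ) {t : ℝ} (ht : 0 ≤ t) :
    C.belief κ y q e t ∈ I := by
  rcases belief_cases (C := C) (κ := κ) (y := y) (q := q) e ht with h | ⟨n, -, h2, h⟩
  · rw [h]; exact hq t ht
  · rw [h]; exact h1 _ (sub_nonneg.2 h2)

theorem one_mem_unit : (1 : ℝ) ∈ Icc (0 : ℝ) 1 := ⟨zero_le_one, le_rfl⟩

/-- After the first detection the belief process starts afresh from one. -/
theorem belief_restart {e : ℕ → ℝ} (hW : C.waitingTime κ y q (e 0) ≠ ∞) {u : ℝ} (hu : 0 ≤ u)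
    (hfin : ∃ n, ENNReal.ofReal u < C.detectionTime κ y 1 (shiftClock e) n) :
    C.belief κ y q e ((C.waitingTime κ y q (e 0)).toReal + u) =
      C.belief κ y 1 (shiftClock e) u := by
  set W := C.waitingTime κ y q (e 0) with hWdef
  have hadd : ENNReal.ofReal (W.toReal + u) = W + ENNReal.ofReal u := by
    rw [ENNReal.ofReal_add ENNReal.toReal_nonneg hu, ENNReal.ofReal_toReal hW]
  by_cases h0 : ENNReal.ofReal u < C.waitingTime κ y 1 (shiftClock e 0)
  · rw [belief_of_lt_waitingTime h0, belief_of_mem_Ico (n := 0)]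
    · rw [detectionTime, ← hWdef, add_sub_cancel_left]
    · rw [detectionTime, hadd]; exact le_self_add
    · rw [detectionTime_succ, hadd, ENNReal.add_lt_add_iff_left hW]; exact h0
  -- The first detection time beyond `u` is not the initial one here, so its predecessor is the last
  -- reset. Without `hfin` the count would default to zero. Indices on the two sides differ by one,
  -- the first detection being the restart itself.
  · classical
    obtain ⟨n, hn⟩ : ∃ n, C.detectionTime κ y 1 (shiftClock e) n ≤ ENNReal.ofReal u ∧
        ENNReal.ofReal u < C.detectionTime κ y 1 (shiftClock e) (n + 1) := by
      have hf0 : Nat.find hfin ≠ 0 := fun h => h0 (by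
        have := Nat.find_spec hfin
        rwa [h] at this)
      obtain ⟨m, hm⟩ := Nat.exists_eq_succ_of_ne_zero hf0
      refine ⟨m, not_lt.1 (Nat.find_min hfin (by omega)), ?_⟩
      have := Nat.find_spec hfin
      rwa [hm] at this
    have hne : C.detectionTime κ y 1 (shiftClock e) n ≠ ∞ :=
      ne_top_of_le_ne_top ENNReal.ofReal_ne_top hn.1
    rw [belief_of_mem_Ico hn.1 hn.2, belief_of_mem_Ico (n := n + 1)]
    · rw [detectionTime_succ, ← hWdef, ENNReal.toReal_add hW hne]
      congr 1
      ring
    · rw [detectionTime_succ, hadd, ← hWdef]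
      exact add_le_add_right hn.1 W
    · rw [detectionTime_succ, hadd, ← hWdef, ENNReal.add_lt_add_iff_left hW]
      exact hn.2

/-- The Markov property along the evolution without detection. -/
theorem belief_path (hκ : 0 < κ) (hy : IsPolicy y) (hadm : C.Admissible κ y)
    (hq : q ∈ Icc (0 : ℝ) 1) {s t : ℝ} (hs : 0 ≤ s) (ht : 0 ≤ t) {e : ℕ → ℝ}
    (he : C.hazard κ y q s < e 0) :
    C.belief κ y q e (s + t) = C.belief κ y (C.path κ y q s)
      (consClock (e 0 - C.hazard κ y q s) (shiftClock e)) t := by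
  set e' := consClock (e 0 - C.hazard κ y q s) (shiftClock e) with he'
  have hT : ∀ n, C.detectionTime κ y q e n =
      ENNReal.ofReal s + C.detectionTime κ y (C.path κ y q s) e' n := fun n => by
    cases n with
    | zero => exact waitingTime_path hκ hy hadm hq hs he
    | succ n =>
      rw [detectionTime_succ, detectionTime_succ, waitingTime_path hκ hy hadm hq hs he, add_assoc]
      rfl
  have hadd : ENNReal.ofReal (s + t) = ENNReal.ofReal s + ENNReal.ofReal t :=
    ENNReal.ofReal_add hs ht
  have hiff : ∀ n, (C.detectionTime κ y q e n ≤ ENNReal.ofReal (s + t) ∧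
      ENNReal.ofReal (s + t) < C.detectionTime κ y q e (n + 1)) ↔
      (C.detectionTime κ y (C.path κ y q s) e' n ≤ ENNReal.ofReal t ∧
      ENNReal.ofReal t < C.detectionTime κ y (C.path κ y q s) e' (n + 1)) := fun n => by
    rw [hT, hT, hadd, ENNReal.add_le_add_iff_left ENNReal.ofReal_ne_top,
      ENNReal.add_lt_add_iff_left ENNReal.ofReal_ne_top]
  by_cases h : ∃ n, C.detectionTime κ y (C.path κ y q s) e' n ≤ ENNReal.ofReal t ∧
      ENNReal.ofReal t < C.detectionTime κ y (C.path κ y q s) e' (n + 1)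
  · obtain ⟨n, hn⟩ := h
    have hn' := (hiff n).2 hn
    rw [belief_of_mem_Ico hn.1 hn.2, belief_of_mem_Ico hn'.1 hn'.2, hT,
      ENNReal.toReal_add ENNReal.ofReal_ne_top
        (ne_top_of_le_ne_top ENNReal.ofReal_ne_top hn.1), ENNReal.toReal_ofReal hs]
    congr 1
    ring
  -- No finiteness is needed: in this branch both beliefs are undetected evolutions, which agree by
  -- the flow property.
  · rw [belief_of_forall_not fun n hn => h ⟨n, hn⟩,
      belief_of_forall_not fun n hn => h ⟨n, (hiff n).1 hn⟩, path_add hκ.le hy hadm hq hs ht]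

theorem ofReal_div_le_waitingTime (hκ : 0 < κ) (hy : IsPolicy y) (hadm : C.Admissible κ y)
    (hq : q ∈ Icc (0 : ℝ) 1) (e : ℝ) : ENNReal.ofReal (e / κ) ≤ C.waitingTime κ y q e := by
  refine le_iInf₂ fun t ht => ENNReal.ofReal_le_ofReal ?_
  rw [div_le_iff₀ hκ, mul_comm]
  exact ht.2.trans (hazard_le hκ.le hy hadm hq ht.1)

/-- Almost surely, only finitely many detections occur in bounded time. -/
theorem ae_exists_lt_detectionTime (hκ : 0 < κ) (hy : IsPolicy y) (hadm : C.Admissible κ y) :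
    ∀ᵐ e ∂clockLaw, ∀ q t, ∃ n, ENNReal.ofReal t < C.detectionTime κ y q e n := by
  filter_upwards [ae_frequently_clock_gt] with e he q t
  -- Each clock exceeding one, other than the first, adds at least `1 / κ` to the detection times.
  have key : ∀ m : ℕ, ∃ n, m * ENNReal.ofReal (1 / κ) ≤ C.detectionTime κ y q e n := fun m => by
    induction m with
    | zero => exact ⟨0, by simp⟩
    | succ m ih =>
      obtain ⟨n, hn⟩ := ih
      obtain ⟨k, hk, hek⟩ := he (n + 1)
      obtain ⟨j, rfl⟩ : ∃ j, k = j + 1 := ⟨k - 1, by omega⟩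
      refine ⟨j + 1, ?_⟩
      rw [detectionTime, Nat.cast_succ, add_mul, one_mul]
      refine add_le_add (hn.trans (detectionTime_mono e (by omega))) ?_
      exact (ENNReal.ofReal_le_ofReal (div_le_div_of_nonneg_right hek.le hκ.le)).trans
        (ofReal_div_le_waitingTime hκ hy hadm one_mem_unit _)
  obtain ⟨m, hm⟩ := exists_nat_gt (t * κ)
  obtain ⟨n, hn⟩ := key (m + 1)
  refine ⟨n, lt_of_lt_of_le ?_ hn⟩
  rw [← ENNReal.ofReal_natCast, ← ENNReal.ofReal_mul (Nat.cast_nonneg _)]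
  have h : ((m + 1 : ℕ) : ℝ) * (1 / κ) = (m + 1) / κ := by push_cast; ring
  rw [h, ENNReal.ofReal_lt_ofReal_iff (by positivity), lt_div_iff₀ hκ]
  linarith

end Detection

end Chain

namespace Chain

/-! ### Measurability of the belief process -/

section Measurability

variable {C : Chain} {κ : ℝ} {y : ℝ → ℝ}

/-- The nearest point of `[0, 1]`. -/
def clamp (q : ℝ) : ℝ := max 0 (min q 1)

theorem clamp_mem (q : ℝ) : clamp q ∈ Icc (0 : ℝ) 1 :=
  ⟨le_max_left _ _, max_le zero_le_one (min_le_right _ _)⟩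

theorem clamp_of_mem {q : ℝ} (hq : q ∈ Icc (0 : ℝ) 1) : clamp q = q := by
  rw [clamp, min_eq_left hq.2, max_eq_right hq.1]

/-- The evolution without detection is jointly measurable in initial belief and time. -/
def MeasurablePath (C : Chain) (κ : ℝ) (y : ℝ → ℝ) : Prop :=
  Measurable fun p : ℝ × ℝ => C.path κ y (clamp p.1) (max p.2 0)

/-- `clamp` and `max _ 0` confine belief and time to the domain where `path` is characterized; they
are removed when the arguments already lie there. -/
theorem measurable_path_apply (hm : C.MeasurablePath κ y) {q : ℝ} (hq : q ∈ Icc (0 : ℝ) 1) :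
    Measurable fun t : ℝ => C.path κ y q (max t 0) := by
  have h := hm.comp (f := fun t : ℝ => (q, t)) (measurable_const.prodMk measurable_id)
  have e : (fun t : ℝ => C.path κ y q (max t 0)) =
      (fun p : ℝ × ℝ => C.path κ y (clamp p.1) (max p.2 0)) ∘ fun t => (q, t) := by
    ext t; simp [clamp_of_mem hq]
  rw [e]; exact h

theorem measurable_hazard (hy : IsPolicy y) (hm : C.MeasurablePath κ y) {t : ℝ} (ht : 0 ≤ t) :
    Measurable fun q => C.hazard κ y (clamp q) t := by
  have h1 : Measurable fun p : ℝ × ℝ =>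
      C.path κ y (clamp p.1) (max p.2 0) * κ * y (C.path κ y (clamp p.1) (max p.2 0)) :=
    (Measurable.mul_const hm κ).mul (hy.1.comp hm)
  have h2 := (h1.stronglyMeasurable.integral_prod_right'
    (ν := volume.restrict (Ioc 0 t))).measurable
  convert h2 using 2 with q
  rw [hazard, intervalIntegral.integral_of_le ht]
  refine setIntegral_congr_fun measurableSet_Ioc fun s hs => ?_
  simp only [max_eq_left hs.1.le]

theorem measurable_waitingTime (hκ : 0 < κ) (hy : IsPolicy y) (hadm : C.Admissible κ y)
    (hm : C.MeasurablePath κ y) :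
    Measurable fun p : ℝ × ℝ => C.waitingTime κ y (clamp p.1) p.2 := by
  refine measurable_of_Iic fun a => ?_
  by_cases ha : a = ∞
  · rw [ha]; simp
  · have h : (fun p : ℝ × ℝ => C.waitingTime κ y (clamp p.1) p.2) ⁻¹' Iic a =
        {p | p.2 ≤ C.hazard κ y (clamp p.1) a.toReal} := by
      ext p
      rw [mem_preimage, mem_Iic, ← ENNReal.ofReal_toReal ha,
        waitingTime_le_iff hκ hy hadm (clamp_mem _) ENNReal.toReal_nonneg,
        ENNReal.ofReal_toReal ha]
      rfl
    rw [h]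
    exact measurableSet_le measurable_snd
      ((measurable_hazard hy hm ENNReal.toReal_nonneg).comp measurable_fst)

theorem measurable_waitingTime_apply (hκ : 0 < κ) (hy : IsPolicy y) (hadm : C.Admissible κ y)
    (hm : C.MeasurablePath κ y) {q : ℝ} (hq : q ∈ Icc (0 : ℝ) 1) :
    Measurable fun e => C.waitingTime κ y q e := by
  have h := (measurable_waitingTime hκ hy hadm hm).comp (f := fun t : ℝ => (q, t))
    (measurable_const.prodMk measurable_id)
  have e : (fun e => C.waitingTime κ y q e) =
      (fun p : ℝ × ℝ => C.waitingTime κ y (clamp p.1) p.2) ∘ fun t => (q, t) := by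
    ext t; simp [clamp_of_mem hq]
  rw [e]; exact h

theorem measurable_detectionTime (hκ : 0 < κ) (hy : IsPolicy y) (hadm : C.Admissible κ y)
    (hm : C.MeasurablePath κ y) (n : ℕ) :
    Measurable fun p : ℝ × (ℕ → ℝ) => C.detectionTime κ y (clamp p.1) p.2 n := by
  induction n with
  | zero =>
    exact (measurable_waitingTime hκ hy hadm hm).comp
      (f := fun p : ℝ × (ℕ → ℝ) => (p.1, p.2 0))
      (measurable_fst.prodMk ((measurable_pi_apply 0).comp measurable_snd))
  | succ n ih =>
    exact ih.add ((measurable_waitingTime_apply hκ hy hadm hm one_mem_unit).comp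
      ((measurable_pi_apply (n + 1)).comp measurable_snd))

theorem measurable_belief (hκ : 0 < κ) (hy : IsPolicy y) (hadm : C.Admissible κ y)
    (hm : C.MeasurablePath κ y) :
    Measurable fun p : ℝ × (ℕ → ℝ) × ℝ => C.belief κ y (clamp p.1) p.2.1 (max p.2.2 0) := by
  intro B hB
  set T : ℕ → ℝ × (ℕ → ℝ) × ℝ → ℝ≥0∞ :=
    fun n p => C.detectionTime κ y (clamp p.1) p.2.1 n with hT
  have hTm : ∀ n, Measurable (T n) := fun n =>
    (measurable_detectionTime hκ hy hadm hm n).comp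
      (f := fun p : ℝ × (ℕ → ℝ) × ℝ => (p.1, p.2.1)) (by fun_prop)
  have htm : Measurable fun p : ℝ × (ℕ → ℝ) × ℝ => ENNReal.ofReal (max p.2.2 0) := by fun_prop
  set A : ℕ → Set (ℝ × (ℕ → ℝ) × ℝ) := fun n =>
    {p | T n p ≤ ENNReal.ofReal (max p.2.2 0) ∧ ENNReal.ofReal (max p.2.2 0) < T (n + 1) p}
    with hA
  have hAm : ∀ n, MeasurableSet (A n) := fun n =>
    (measurableSet_le (hTm n) htm).inter (measurableSet_lt htm (hTm (n + 1)))
  have h1 : Measurable fun p : ℝ × (ℕ → ℝ) × ℝ => C.path κ y (clamp p.1) (max p.2.2 0) :=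
    Measurable.comp (f := fun p : ℝ × (ℕ → ℝ) × ℝ => (p.1, p.2.2)) hm (by fun_prop)
  have h2 : ∀ n, Measurable fun p : ℝ × (ℕ → ℝ) × ℝ =>
      C.path κ y 1 (max (max p.2.2 0 - (T n p).toReal) 0) := fun n =>
    (measurable_path_apply hm one_mem_unit).comp
      (f := fun p : ℝ × (ℕ → ℝ) × ℝ => max p.2.2 0 - (T n p).toReal)
      ((by fun_prop : Measurable fun p : ℝ × (ℕ → ℝ) × ℝ => max p.2.2 0).sub
        (hTm n).ennreal_toReal)
  -- On `A n` the last reset is detection `n`; off all the `A n` the belief follows the initial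
  -- evolution.
  have key : (fun p : ℝ × (ℕ → ℝ) × ℝ => C.belief κ y (clamp p.1) p.2.1 (max p.2.2 0)) ⁻¹' B =
      (⋃ n, A n ∩ (fun p => C.path κ y 1 (max (max p.2.2 0 - (T n p).toReal) 0)) ⁻¹' B) ∪
        ((⋃ n, A n)ᶜ ∩ (fun p => C.path κ y (clamp p.1) (max p.2.2 0)) ⁻¹' B) := by
    have hb : ∀ n, ∀ p ∈ A n, C.belief κ y (clamp p.1) p.2.1 (max p.2.2 0) =
        C.path κ y 1 (max (max p.2.2 0 - (T n p).toReal) 0) := fun n p hp => by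
      rw [belief_of_mem_Ico hp.1 hp.2, max_eq_left (sub_nonneg.2
        (ENNReal.toReal_le_of_le_ofReal (le_max_right _ _) hp.1))]
    have hb' : ∀ p, p ∉ ⋃ n, A n → C.belief κ y (clamp p.1) p.2.1 (max p.2.2 0) =
        C.path κ y (clamp p.1) (max p.2.2 0) := fun p hp =>
      belief_of_forall_not fun n hn => hp (mem_iUnion.2 ⟨n, hn⟩)
    ext p
    by_cases hp : p ∈ ⋃ n, A n
    · simp only [mem_preimage, mem_union, mem_iUnion, mem_inter_iff, mem_compl_iff]
      constructor
      · intro h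
        obtain ⟨n, hn⟩ := mem_iUnion.1 hp
        exact .inl ⟨n, hn, hb n p hn ▸ h⟩
      · rintro (⟨n, hn, h⟩ | ⟨h, -⟩)
        · rw [hb n p hn]; exact h
        · exact absurd (mem_iUnion.1 hp) h
    · simp only [mem_preimage, mem_union, mem_iUnion, mem_inter_iff, mem_compl_iff]
      rw [hb' p hp]
      constructor
      · exact fun h => .inr ⟨fun h' => hp (mem_iUnion.2 h'), h⟩
      · rintro (⟨n, hn, -⟩ | ⟨-, h⟩)
        · exact absurd (mem_iUnion.2 ⟨n, hn⟩) hp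
        · exact h
  rw [key]
  exact (MeasurableSet.iUnion fun n => (hAm n).inter (h2 n hB)).union
    ((MeasurableSet.iUnion hAm).compl.inter (h1 hB))

theorem measurable_belief_apply (hκ : 0 < κ) (hy : IsPolicy y) (hadm : C.Admissible κ y)
    (hm : C.MeasurablePath κ y) {q : ℝ} (hq : q ∈ Icc (0 : ℝ) 1) :
    Measurable fun p : (ℕ → ℝ) × ℝ => C.belief κ y q p.1 (max p.2 0) := by
  have h := (measurable_belief hκ hy hadm hm).comp (f := fun p : (ℕ → ℝ) × ℝ => (q, p))
    (measurable_const.prodMk measurable_id)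
  have e : (fun p : (ℕ → ℝ) × ℝ => C.belief κ y q p.1 (max p.2 0)) =
      (fun p : ℝ × (ℕ → ℝ) × ℝ => C.belief κ y (clamp p.1) p.2.1 (max p.2.2 0)) ∘
        fun p => (q, p) := by
    ext t; simp [clamp_of_mem hq]
  rw [e]; exact h

theorem measurable_belief_time (hκ : 0 < κ) (hy : IsPolicy y) (hadm : C.Admissible κ y)
    (hm : C.MeasurablePath κ y) {q t : ℝ} (hq : q ∈ Icc (0 : ℝ) 1) (ht : 0 ≤ t) :
    Measurable fun e : ℕ → ℝ => C.belief κ y q e t := by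
  have h := (measurable_belief_apply hκ hy hadm hm hq).comp (f := fun e : ℕ → ℝ => (e, t))
    (measurable_id.prodMk measurable_const)
  have e : (fun e : ℕ → ℝ => C.belief κ y q e t) =
      (fun p : (ℕ → ℝ) × ℝ => C.belief κ y q p.1 (max p.2 0)) ∘ fun e => (e, t) := by
    ext e; simp [max_eq_left ht]
  rw [e]; exact h

end Measurability

end Chain

namespace Chain

/-! ### The long-run law of a regenerating belief process -/

section LongRun

variable {C : Chain} {κ : ℝ} {y : ℝ → ℝ}

theorem setLIntegral_Ico_add (w T : ℝ) (f : ℝ → ℝ≥0∞) :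
    ∫⁻ u in Ico 0 T, f (w + u) = ∫⁻ t in Ico w (w + T), f t := by
  rw [← (measurePreserving_add_left volume w).setLIntegral_comp_preimage_emb
    (measurableEmbedding_addLeft w) f]
  simp

theorem setOf_ofReal_lt {a : ℝ≥0∞} (ha : a ≠ ∞) :
    Ici 0 ∩ {s : ℝ | ENNReal.ofReal s < a} = Ico 0 a.toReal := by
  ext s
  refine and_congr_right fun hs => ?_
  exact ENNReal.ofReal_lt_iff_lt_toReal hs ha

theorem lintegral_indicator_ofReal_lt (a : ℝ≥0∞) :
    ∫⁻ s in Ici 0, {s : ℝ | ENNReal.ofReal s < a}.indicator 1 s = a := by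
  have hm : MeasurableSet {s : ℝ | ENNReal.ofReal s < a} :=
    measurableSet_lt ENNReal.measurable_ofReal measurable_const
  rw [lintegral_indicator_one hm, Measure.restrict_apply hm, inter_comm]
  by_cases ha : a = ∞
  · subst ha
    simp [Real.volume_Ici]
  · rw [setOf_ofReal_lt ha, Real.volume_Ico, sub_zero, ENNReal.ofReal_toReal ha]

/-- The probability of no detection by time `t`, from belief `q`. -/
noncomputable def survival (C : Chain) (κ : ℝ) (y : ℝ → ℝ) (q t : ℝ) : ℝ≥0∞ :=
  ENNReal.ofReal (Real.exp (-C.hazard κ y q t))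

theorem survival_eq (hκ : 0 < κ) (hy : IsPolicy y) (hadm : C.Admissible κ y) {q t : ℝ}
    (hq : q ∈ Icc (0 : ℝ) 1) (ht : 0 ≤ t) :
    C.survival κ y q t = expMeasure 1 {e | ENNReal.ofReal t < C.waitingTime κ y q e} := by
  rw [survival, ← expMeasure_one_Ioi (hazard_nonneg hκ.le hy hadm hq ht)]
  congr 1
  ext e
  exact (lt_waitingTime_iff hκ hy hadm hq ht).symm

/-- Layer-cake formula: a mean is the integral of the tail probabilities. -/
theorem lintegral_waitingTime (hκ : 0 < κ) (hy : IsPolicy y) (hadm : C.Admissible κ y)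
    (hm : C.MeasurablePath κ y) {q : ℝ} (hq : q ∈ Icc (0 : ℝ) 1) :
    ∫⁻ e, C.waitingTime κ y q e ∂expMeasure 1 = ∫⁻ t in Ici 0, C.survival κ y q t := by
  have hW := measurable_waitingTime_apply hκ hy hadm hm hq
  have hS : MeasurableSet {p : ℝ × ℝ | ENNReal.ofReal p.2 < C.waitingTime κ y q p.1} :=
    measurableSet_lt (by fun_prop) (hW.comp measurable_fst)
  calc ∫⁻ e, C.waitingTime κ y q e ∂expMeasure 1
      = ∫⁻ e, (∫⁻ s in Ici 0, {p : ℝ × ℝ | ENNReal.ofReal p.2 <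
          C.waitingTime κ y q p.1}.indicator 1 (e, s)) ∂expMeasure 1 :=
        lintegral_congr fun e => (lintegral_indicator_ofReal_lt _).symm
    _ = ∫⁻ s in Ici 0, ∫⁻ e, {p : ℝ × ℝ | ENNReal.ofReal p.2 <
          C.waitingTime κ y q p.1}.indicator 1 (e, s) ∂expMeasure 1 := by
        rw [lintegral_lintegral_swap]
        exact (measurable_one.indicator hS).aemeasurable
    _ = ∫⁻ t in Ici 0, C.survival κ y q t := by
        refine setLIntegral_congr_fun measurableSet_Ici fun s hs => ?_
        rw [survival_eq hκ hy hadm hq hs, ← lintegral_indicator_one]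
        · rfl
        · exact measurableSet_lt measurable_const hW

theorem measurable_survival (hκ : 0 < κ) (hy : IsPolicy y) (hadm : C.Admissible κ y) {q : ℝ}
    (hq : q ∈ Icc (0 : ℝ) 1) : Measurable fun t => C.survival κ y q (max t 0) := by
  have h : Monotone fun t => C.hazard κ y q (max t 0) := fun s t hst =>
    hazard_mono hκ.le hy hadm hq (le_max_right _ _) (max_le_max_right _ hst)
  exact (Real.measurable_exp.comp h.measurable.neg).ennreal_ofReal

/-- The expected time between two detections. -/
noncomputable def meanCycle (C : Chain) (κ : ℝ) (y : ℝ → ℝ) : ℝ≥0∞ :=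
  ∫⁻ t in Ici 0, C.survival κ y 1 t

/-- The share of time that the belief spends in a set, between two detections. -/
noncomputable def cycleLaw (C : Chain) (κ : ℝ) (y : ℝ → ℝ) : Measure ℝ :=
  (C.meanCycle κ y)⁻¹ • ((volume.restrict (Ici 0)).withDensity
    fun t => C.survival κ y 1 (max t 0)).map fun t => C.path κ y 1 (max t 0)

theorem lintegral_cycleLaw (hκ : 0 < κ) (hy : IsPolicy y) (hadm : C.Admissible κ y)
    (hm : C.MeasurablePath κ y) {f : ℝ → ℝ≥0∞} (hf : Measurable f) :
    ∫⁻ q, f q ∂C.cycleLaw κ y =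
      (C.meanCycle κ y)⁻¹ * ∫⁻ t in Ici 0, C.survival κ y 1 t * f (C.path κ y 1 t) := by
  have hφ := measurable_path_apply hm one_mem_unit
  have hS := measurable_survival hκ hy hadm one_mem_unit
  rw [cycleLaw, lintegral_smul_measure, lintegral_map hf hφ,
    lintegral_withDensity_eq_lintegral_mul _ hS
      (g := fun t => f (C.path κ y 1 (max t 0))) (hf.comp hφ), smul_eq_mul]
  congr 1
  refine setLIntegral_congr_fun measurableSet_Ici fun t ht => ?_
  simp [max_eq_left (show (0 : ℝ) ≤ t from ht)]

theorem cycleLaw_apply (hκ : 0 < κ) (hy : IsPolicy y) (hadm : C.Admissible κ y)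
    (hm : C.MeasurablePath κ y) {B : Set ℝ} (hB : MeasurableSet B) :
    C.cycleLaw κ y B = (C.meanCycle κ y)⁻¹ *
      ∫⁻ t in Ici 0, C.survival κ y 1 t * B.indicator 1 (C.path κ y 1 t) := by
  rw [← lintegral_indicator_one hB,
    lintegral_cycleLaw hκ hy hadm hm (measurable_one.indicator hB)]

theorem meanCycle_ne_zero (hκ : 0 < κ) (hy : IsPolicy y) (hadm : C.Admissible κ y) :
    C.meanCycle κ y ≠ 0 := by
  have h : (∫⁻ t in Ico (0 : ℝ) 1, ENNReal.ofReal (Real.exp (-κ))) ≤ C.meanCycle κ y := by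
    refine (setLIntegral_mono' measurableSet_Ico fun t ht => ?_).trans
      (lintegral_mono_set Ico_subset_Ici_self)
    refine ENNReal.ofReal_le_ofReal (Real.exp_le_exp.2 (neg_le_neg ?_))
    exact (hazard_le hκ.le hy hadm one_mem_unit ht.1).trans
      (mul_le_of_le_one_right hκ.le ht.2.le)
  intro h0
  rw [h0, setLIntegral_const, Real.volume_Ico] at h
  simp only [sub_zero, ENNReal.ofReal_one, mul_one, nonpos_iff_eq_zero,
    ENNReal.ofReal_eq_zero] at h
  exact absurd h (not_le.2 (Real.exp_pos _))

/-- The law of a cycle is stationary. -/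
theorem isStationary_cycleLaw (hκ : 0 < κ) (hy : IsPolicy y) (hadm : C.Admissible κ y)
    (hm : C.MeasurablePath κ y) (hfin : C.meanCycle κ y ≠ ∞) :
    C.IsStationary κ y (C.cycleLaw κ y) := by
  have hne := meanCycle_ne_zero hκ hy hadm
  have h1 := one_mem_unit
  have hsupp : C.cycleLaw κ y (Icc 0 1)ᶜ = 0 := by
    rw [cycleLaw_apply hκ hy hadm hm measurableSet_Icc.compl]
    convert mul_zero _
    refine (setLIntegral_congr_fun measurableSet_Ici fun t ht => ?_).trans lintegral_zero
    rw [indicator_of_notMem (by simpa using path_mem hadm h1 ht), mul_zero]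
  refine ⟨⟨?_⟩, hsupp, fun t ht B hB => ?_⟩
  · rw [cycleLaw_apply hκ hy hadm hm .univ]
    simp only [indicator_univ, Pi.one_apply, mul_one]
    exact ENNReal.inv_mul_cancel hne hfin
  set b : (ℕ → ℝ) → ℝ → ℝ≥0∞ := fun e s => B.indicator 1 (C.belief κ y 1 e (max s 0)) with hb
  have hbm : Measurable fun p : (ℕ → ℝ) × ℝ => b p.1 p.2 :=
    (measurable_one.indicator hB).comp (measurable_belief_apply hκ hy hadm hm h1)
  have hb1 : ∀ e s, b e s ≤ 1 := fun e s => indicator_le_self' (by simp) _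
  set W : (ℕ → ℝ) → ℝ≥0∞ := fun e => C.waitingTime κ y 1 (e 0) with hWdef
  have hWm : Measurable W :=
    (measurable_waitingTime_apply hκ hy hadm hm h1).comp (measurable_pi_apply 0)
  set A : Set ((ℕ → ℝ) × ℝ) := {p | ENNReal.ofReal p.2 < W p.1} with hAdef
  have hAm : MeasurableSet A := measurableSet_lt (by fun_prop) (hWm.comp measurable_fst)
  have hWae : ∀ᵐ e ∂clockLaw, W e ≠ ∞ := by
    have : ∫⁻ e, W e ∂clockLaw ≠ ∞ := by
      rw [lintegral_clock_zero (measurable_waitingTime_apply hκ hy hadm hm h1),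
        lintegral_waitingTime hκ hy hadm hm h1]
      exact hfin
    filter_upwards [ae_lt_top hWm this] with e he using he.ne
  -- the time spent in `B` between `t` and `t` after the first detection
  have hleft : ∫⁻ q, clockLaw {e | C.belief κ y q e t ∈ B} ∂C.cycleLaw κ y =
      (C.meanCycle κ y)⁻¹ * ∫⁻ e, (∫⁻ s in Ici 0, A.indicator 1 (e, s) * b e (t + s)) ∂clockLaw := by
    have hae : ∀ᵐ q ∂C.cycleLaw κ y, q ∈ Icc (0 : ℝ) 1 := by
      rw [ae_iff]; exact hsupp
    have hPm : Measurable fun q => clockLaw {e | C.belief κ y (clamp q) e t ∈ B} := by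
      have := (measurable_belief hκ hy hadm hm).comp
        (f := fun p : ℝ × (ℕ → ℝ) => (p.1, p.2, t)) (by fun_prop)
      have h2 := measurable_measure_prodMk_left (ν := clockLaw) (this hB)
      convert h2 using 4 with q
      ext e; simp [max_eq_left ht]
    rw [lintegral_congr_ae (g := fun q => clockLaw {e | C.belief κ y (clamp q) e t ∈ B})
      (by filter_upwards [hae] with q hq; rw [clamp_of_mem hq]),
      lintegral_cycleLaw hκ hy hadm hm hPm]
    congr 1
    rw [lintegral_lintegral_swap]
    · refine setLIntegral_congr_fun measurableSet_Ici fun s hs => ?_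
      have hs0 : (0 : ℝ) ≤ s := hs
      have hφs := path_mem hadm h1 hs0
      -- Memorylessness: being undetected at `s` and then running a fresh process from the current
      -- belief has the same law as continuing the original process past `s`.
      rw [clamp_of_mem hφs, survival, ← clockLaw_memoryless
        (hazard_nonneg hκ.le hy hadm h1 hs0)
        (B := {e | C.belief κ y (C.path κ y 1 s) e t ∈ B})
        (measurable_belief_time hκ hy hadm hm hφs ht hB)]
      have hset : {e : ℕ → ℝ | C.hazard κ y 1 s < e 0 ∧
          consClock (e 0 - C.hazard κ y 1 s) (shiftClock e) ∈
            {e | C.belief κ y (C.path κ y 1 s) e t ∈ B}} =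
          {e | ENNReal.ofReal s < W e ∧ C.belief κ y 1 e (s + t) ∈ B} := by
        ext e
        refine (and_congr_left' (lt_waitingTime_iff hκ hy hadm h1 hs0).symm).trans
          (and_congr_right fun he => ?_)
        rw [belief_path hκ hy hadm h1 hs0 ht ((lt_waitingTime_iff hκ hy hadm h1 hs0).1 he)]
        rfl
      rw [hset, ← lintegral_indicator_one]
      · refine lintegral_congr fun e => ?_
        simp only [hb, max_eq_left (add_nonneg ht hs0)]
        rw [add_comm t s]
        by_cases h3 : ENNReal.ofReal s < W e <;>
          by_cases h4 : C.belief κ y 1 e (s + t) ∈ B <;> simp [indicator, A, h3, h4]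
      · exact (measurableSet_lt measurable_const hWm).inter
          (measurable_belief_time hκ hy hadm hm h1 (add_nonneg hs0 ht) hB)
    · exact ((measurable_one.indicator hAm).mul (hbm.comp
        (f := fun p : (ℕ → ℝ) × ℝ => (p.1, t + p.2)) (by fun_prop))).aemeasurable
  have hright : ∫⁻ e, (∫⁻ s in Ici 0, A.indicator 1 (e, s) * b e s) ∂clockLaw =
      ∫⁻ s in Ici 0, C.survival κ y 1 s * B.indicator 1 (C.path κ y 1 s) := by
    rw [lintegral_lintegral_swap
      ((measurable_one.indicator hAm).mul hbm).aemeasurable]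
    refine setLIntegral_congr_fun measurableSet_Ici fun s hs => ?_
    have hs0 : (0 : ℝ) ≤ s := hs
    have hm' : MeasurableSet {e : ℕ → ℝ | ENNReal.ofReal s < W e} :=
      measurableSet_lt measurable_const hWm
    have hS : C.survival κ y 1 s = clockLaw {e | ENNReal.ofReal s < W e} := by
      rw [survival_eq hκ hy hadm h1 hs0, ← lintegral_indicator_one hm',
        ← lintegral_indicator_one (measurableSet_lt measurable_const
          (measurable_waitingTime_apply hκ hy hadm hm h1)),
        ← lintegral_clock_zero (measurable_one.indicator (measurableSet_lt measurable_const
          (measurable_waitingTime_apply hκ hy hadm hm h1)))]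
      rfl
    rw [hS, ← lintegral_indicator_one hm', ← lintegral_mul_const _ (measurable_one.indicator hm')]
    refine lintegral_congr fun e => ?_
    by_cases h3 : ENNReal.ofReal s < W e
    · simp only [hb, max_eq_left hs0]
      rw [belief_of_lt_waitingTime h3]
      simp [indicator, A, h3]
    · simp [indicator, A, h3]
  -- With `W` the first detection time, both sides are the time in `B` over `[0, W + t)`. On the
  -- left it is cut at `t`, on the right at `W`, where the process restarts with the shifted clocks.
  have hcycle : ∀ᵐ e ∂clockLaw, (∫⁻ s in Ici 0, A.indicator 1 (e, s) * b e (t + s)) +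
      ∫⁻ s in Ico 0 t, b e s = (∫⁻ s in Ici 0, A.indicator 1 (e, s) * b e s) +
      ∫⁻ s in Ico 0 t, b (shiftClock e) s := by
    filter_upwards [hWae, ae_exists_lt_detectionTime hκ hy hadm,
      (measurePreserving_shiftClock.quasiMeasurePreserving.ae
        (ae_exists_lt_detectionTime hκ hy hadm))] with e he _ hfe
    have hcut : ∀ f : ℝ → ℝ≥0∞, ∫⁻ s in Ici 0, A.indicator 1 (e, s) * f s =
        ∫⁻ s in Ico 0 (W e).toReal, f s := fun f => by
      rw [← setOf_ofReal_lt he, inter_comm, ← Measure.restrict_restrict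
        (measurableSet_lt (by fun_prop) measurable_const), ← lintegral_indicator
        (measurableSet_lt (by fun_prop) measurable_const)]
      refine lintegral_congr fun s => ?_
      by_cases h3 : ENNReal.ofReal s < W e <;> simp [indicator, A, h3]
    have hw : 0 ≤ (W e).toReal := ENNReal.toReal_nonneg
    rw [hcut, hcut, setLIntegral_Ico_add t _ (b e), add_comm,
      ← lintegral_union measurableSet_Ico (Ico_disjoint_Ico_same),
      Ico_union_Ico_eq_Ico ht (by linarith)]
    have hre : ∫⁻ s in Ico 0 t, b (shiftClock e) s =
        ∫⁻ s in Ico (W e).toReal ((W e).toReal + t), b e s := by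
      rw [← setLIntegral_Ico_add]
      refine setLIntegral_congr_fun measurableSet_Ico fun s hs => ?_
      simp only [hb, max_eq_left hs.1, max_eq_left (add_nonneg hw hs.1)]
      rw [belief_restart he hs.1 (hfe 1 s)]
    rw [hre, ← lintegral_union measurableSet_Ico (Ico_disjoint_Ico_same),
      Ico_union_Ico_eq_Ico hw (by linarith), add_comm]
  have hGm : Measurable fun e => ∫⁻ s in Ico 0 t, b e s := hbm.lintegral_prod_right'
  have hG : ∫⁻ e, (∫⁻ s in Ico 0 t, b e s) ∂clockLaw ≠ ∞ := by
    refine ne_top_of_le_ne_top (b := ENNReal.ofReal t) ENNReal.ofReal_ne_top ?_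
    calc ∫⁻ e, (∫⁻ s in Ico 0 t, b e s) ∂clockLaw
        ≤ ∫⁻ e, (∫⁻ s in Ico 0 t, 1) ∂clockLaw :=
          lintegral_mono fun e => lintegral_mono fun s => hb1 e s
      _ = ENNReal.ofReal t := by simp
  -- After integration the two pieces of length `t` are equal, since `shiftClock` preserves the law;
  -- being finite, they cancel.
  have hsum := lintegral_congr_ae hcycle
  rw [lintegral_add_right _ hGm, lintegral_add_right _ (g := fun e => ∫⁻ s in Ico 0 t, b (shiftClock e) s)
      (hGm.comp measurable_shiftClock),
    lintegral_shiftClock hGm, ENNReal.add_left_inj hG, hright] at hsum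
  rw [hleft, hsum, ← cycleLaw_apply hκ hy hadm hm hB]

/-- Up to a bounded amount, the process spends no more time in a set from a given initial
distribution than from one. -/
theorem IsStationary.mul_le (hκ : 0 < κ) (hy : IsPolicy y) (hadm : C.Admissible κ y)
    (hm : C.MeasurablePath κ y) {K : ℝ≥0∞}
    (hK : ∀ q ∈ Icc (0 : ℝ) 1, ∫⁻ t in Ici 0, C.survival κ y q t ≤ K) {Φ : Measure ℝ}
    (hΦ : C.IsStationary κ y Φ) {B : Set ℝ} (hB : MeasurableSet B) (T : ℝ) :
    ENNReal.ofReal T * Φ B ≤ K +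
      ∫⁻ e, (∫⁻ s in Ico 0 T, B.indicator 1 (C.belief κ y 1 e (max s 0))) ∂clockLaw := by
  have := hΦ.1
  have h1 := one_mem_unit
  have hae : ∀ᵐ q ∂Φ, q ∈ Icc (0 : ℝ) 1 := by
    rw [ae_iff]; exact hΦ.2.1
  set b : ℝ → (ℕ → ℝ) → ℝ → ℝ≥0∞ :=
    fun q e s => B.indicator 1 (C.belief κ y (clamp q) e (max s 0)) with hb
  have hbm : Measurable fun p : ℝ × (ℕ → ℝ) × ℝ => b p.1 p.2.1 p.2.2 :=
    (measurable_one.indicator hB).comp (measurable_belief hκ hy hadm hm)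
  have hb1 : ∀ q e s, b q e s ≤ 1 := fun q e s => indicator_le_self' (by simp) _
  have hclamp : clamp 1 = 1 := clamp_of_mem h1
  have hsub : ∀ q ∈ Icc (0 : ℝ) 1, ∫⁻ e, (∫⁻ s in Ico 0 T, b q e s) ∂clockLaw ≤
      K + ∫⁻ e, (∫⁻ s in Ico 0 T, b 1 e s) ∂clockLaw := fun q hq => by
    have hWm : Measurable fun e : ℕ → ℝ => C.waitingTime κ y q (e 0) :=
      (measurable_waitingTime_apply hκ hy hadm hm hq).comp (measurable_pi_apply 0)
    have hGm : Measurable fun e => ∫⁻ s in Ico 0 T, b 1 e s := by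
      have : Measurable fun p : (ℕ → ℝ) × ℝ => b 1 p.1 p.2 :=
        hbm.comp (f := fun p : (ℕ → ℝ) × ℝ => ((1 : ℝ), p.1, p.2)) (by fun_prop)
      exact this.lintegral_prod_right'
    have hle : ∀ᵐ e ∂clockLaw, ∫⁻ s in Ico 0 T, b q e s ≤
        C.waitingTime κ y q (e 0) + ∫⁻ s in Ico 0 T, b 1 (shiftClock e) s := by
      filter_upwards [measurePreserving_shiftClock.quasiMeasurePreserving.ae
        (ae_exists_lt_detectionTime hκ hy hadm)] with e hfe
      by_cases hW : C.waitingTime κ y q (e 0) = ∞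
      · rw [hW]; simp
      set w := (C.waitingTime κ y q (e 0)).toReal with hw
      have hw0 : 0 ≤ w := ENNReal.toReal_nonneg
      have hcov : Ico 0 T ⊆ Ico 0 w ∪ Ico w (w + T) := fun s hs => by
        rcases lt_or_ge s w with h | h
        · exact .inl ⟨hs.1, h⟩
        · exact .inr ⟨h, by linarith [hs.2]⟩
      refine (lintegral_mono_set hcov).trans ((lintegral_union_le _ _ _).trans (add_le_add ?_ ?_))
      · refine (lintegral_mono fun s => hb1 q e s).trans ?_
        simp [hw, ENNReal.ofReal_toReal hW]
      · rw [← setLIntegral_Ico_add]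
        refine le_of_eq (setLIntegral_congr_fun measurableSet_Ico fun s hs => ?_)
        simp only [hb, max_eq_left hs.1, max_eq_left (add_nonneg hw0 hs.1), clamp_of_mem hq,
          hclamp]
        rw [belief_restart hW hs.1 (hfe 1 s)]
    refine (lintegral_mono_ae hle).trans ?_
    rw [lintegral_add_left hWm, lintegral_shiftClock hGm,
      lintegral_clock_zero (measurable_waitingTime_apply hκ hy hadm hm hq),
      lintegral_waitingTime hκ hy hadm hm hq]
    exact add_le_add_left (hK q hq) _
  calc ENNReal.ofReal T * Φ B = ∫⁻ s in Ico 0 T, ∫⁻ q, ∫⁻ e, b q e s ∂clockLaw ∂Φ := by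
        rw [setLIntegral_congr_fun (g := fun _ => Φ B) measurableSet_Ico]
        · simp [mul_comm]
        · intro s hs
          beta_reduce
          rw [← hΦ.2.2 s hs.1 B hB]
          refine lintegral_congr_ae ?_
          filter_upwards [hae] with q hq
          simp only [hb, clamp_of_mem hq, max_eq_left hs.1]
          exact lintegral_indicator_one (μ := clockLaw)
            (s := (fun e => C.belief κ y q e s) ⁻¹' B)
            (measurable_belief_time hκ hy hadm hm hq hs.1 hB)
    _ = ∫⁻ q, (∫⁻ s in Ico 0 T, ∫⁻ e, b q e s ∂clockLaw) ∂Φ := by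
        rw [lintegral_lintegral_swap]
        have h3 : Measurable fun p : (ℝ × ℝ) × (ℕ → ℝ) => b p.1.2 p.2 p.1.1 :=
          hbm.comp (f := fun p : (ℝ × ℝ) × (ℕ → ℝ) => (p.1.2, p.2, p.1.1)) (by fun_prop)
        have h4 := h3.lintegral_prod_right' (ν := clockLaw)
        exact h4.aemeasurable
    _ = ∫⁻ q, ∫⁻ e, (∫⁻ s in Ico 0 T, b q e s) ∂clockLaw ∂Φ := by
        refine lintegral_congr fun q => ?_
        rw [lintegral_lintegral_swap]
        have h3 : Measurable fun p : ℝ × (ℕ → ℝ) => b q p.2 p.1 :=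
          hbm.comp (f := fun p : ℝ × (ℕ → ℝ) => (q, p.2, p.1)) (by fun_prop)
        exact h3.aemeasurable
    _ ≤ ∫⁻ q, (K + ∫⁻ e, (∫⁻ s in Ico 0 T, b 1 e s) ∂clockLaw) ∂Φ := by
        refine lintegral_mono_ae ?_
        filter_upwards [hae] with q hq using hsub q hq
    _ = K + ∫⁻ e, (∫⁻ s in Ico 0 T, B.indicator 1 (C.belief κ y 1 e (max s 0))) ∂clockLaw := by
        rw [lintegral_const, measure_univ, mul_one]
        simp only [hb, hclamp]

/-- The occupation bound is applied to `Φ` on `B` and to `Φ'` on the complement. The occupation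
times of the two sets from belief one add up to `T`, so the laws differ on `B` by at most `2 * K /
T`. -/
theorem IsStationary.le (hκ : 0 < κ) (hy : IsPolicy y) (hadm : C.Admissible κ y)
    (hm : C.MeasurablePath κ y) {K : ℝ≥0∞} (hKtop : K ≠ ∞)
    (hK : ∀ q ∈ Icc (0 : ℝ) 1, ∫⁻ t in Ici 0, C.survival κ y q t ≤ K) {Φ Φ' : Measure ℝ}
    (hΦ : C.IsStationary κ y Φ) (hΦ' : C.IsStationary κ y Φ') {B : Set ℝ}
    (hB : MeasurableSet B) : Φ B ≤ Φ' B := by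
  have := hΦ.1
  have := hΦ'.1
  have key : ∀ T : ℝ, 0 ≤ T → T * Φ.real B ≤ 2 * K.toReal + T * Φ'.real B := fun T hT => by
    set G := ∫⁻ e, (∫⁻ s in Ico 0 T, B.indicator 1 (C.belief κ y 1 e (max s 0))) ∂clockLaw with hG
    set G' := ∫⁻ e, (∫⁻ s in Ico 0 T, Bᶜ.indicator 1 (C.belief κ y 1 e (max s 0))) ∂clockLaw
      with hG'
    have hbm : ∀ B' : Set ℝ, MeasurableSet B' → Measurable fun p : (ℕ → ℝ) × ℝ =>
        B'.indicator (1 : ℝ → ℝ≥0∞) (C.belief κ y 1 p.1 (max p.2 0)) := fun B' hB' =>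
      (measurable_one.indicator hB').comp (measurable_belief_apply hκ hy hadm hm one_mem_unit)
    have hsum : G + G' = ENNReal.ofReal T := by
      rw [hG, hG', ← lintegral_add_left
        ((hbm B hB).lintegral_prod_right' (ν := volume.restrict (Ico 0 T)))]
      calc _ = ∫⁻ e, ENNReal.ofReal T ∂clockLaw := by
            refine lintegral_congr fun e => ?_
            have h4 : Measurable fun s : ℝ =>
                B.indicator (1 : ℝ → ℝ≥0∞) (C.belief κ y 1 e (max s 0)) :=
              (hbm B hB).comp (f := fun s : ℝ => (e, s)) (by fun_prop)
            rw [← lintegral_add_left h4]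
            simp only [← Pi.add_apply]
            simp
        _ = _ := by simp
    have hGt : G ≠ ∞ := ne_top_of_le_ne_top ENNReal.ofReal_ne_top (hsum ▸ le_self_add)
    have hGt' : G' ≠ ∞ := ne_top_of_le_ne_top ENNReal.ofReal_ne_top (hsum ▸ le_add_self)
    have h1 := ENNReal.toReal_mono (ENNReal.add_ne_top.2 ⟨hKtop, hGt⟩)
      (hΦ.mul_le hκ hy hadm hm hK hB T)
    have h2 := ENNReal.toReal_mono (ENNReal.add_ne_top.2 ⟨hKtop, hGt'⟩)
      (hΦ'.mul_le hκ hy hadm hm hK hB.compl T)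
    have h3 := congrArg ENNReal.toReal hsum
    rw [ENNReal.toReal_add hKtop hGt, ENNReal.toReal_mul, ENNReal.toReal_ofReal hT] at h1
    rw [ENNReal.toReal_add hKtop hGt', ENNReal.toReal_mul, ENNReal.toReal_ofReal hT,
      ← measureReal_def, probReal_compl_eq_one_sub hB] at h2
    rw [ENNReal.toReal_add hGt hGt', ENNReal.toReal_ofReal hT] at h3
    rw [← measureReal_def] at h1
    linarith
  rw [← ENNReal.toReal_le_toReal (measure_ne_top _ _) (measure_ne_top _ _)]
  change Φ.real B ≤ Φ'.real B
  by_contra! hlt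
  have hd : 0 < Φ.real B - Φ'.real B := sub_pos.2 hlt
  -- This horizon makes `T` times the supposed excess equal to `2 * K + 1`, too much by one.
  have h := key ((2 * K.toReal + 1) / (Φ.real B - Φ'.real B)) (by positivity)
  have h2 : (2 * K.toReal + 1) / (Φ.real B - Φ'.real B) * (Φ.real B - Φ'.real B) =
      2 * K.toReal + 1 := div_mul_cancel₀ _ hd.ne'
  linarith

theorem isLongRunLaw_cycleLaw (hκ : 0 < κ) (hy : IsPolicy y) (hadm : C.Admissible κ y)
    (hm : C.MeasurablePath κ y) {K : ℝ≥0∞} (hKtop : K ≠ ∞)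
    (hK : ∀ q ∈ Icc (0 : ℝ) 1, ∫⁻ t in Ici 0, C.survival κ y q t ≤ K) :
    C.IsLongRunLaw κ y (C.cycleLaw κ y) := by
  have hfin : C.meanCycle κ y ≠ ∞ := ne_top_of_le_ne_top hKtop (hK 1 one_mem_unit)
  have hst := isStationary_cycleLaw hκ hy hadm hm hfin
  exact ⟨hst, fun Φ' hΦ' => Measure.ext fun B hB => le_antisymm
    (hΦ'.le hκ hy hadm hm hKtop hK hst hB) (hst.le hκ hy hadm hm hKtop hK hΦ' hB)⟩

theorem π₀_pos (C : Chain) : 0 < C.π₀ := div_pos C.ρL_pos (add_pos C.ρH_pos C.ρL_pos)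

theorem enforcementGivenHigh_cycleLaw (hκ : 0 < κ) (hy : IsPolicy y) (hadm : C.Admissible κ y)
    (hm : C.MeasurablePath κ y) (hfin : C.meanCycle κ y ≠ ∞) :
    C.enforcementGivenHigh y (C.cycleLaw κ y) = ((C.meanCycle κ y)⁻¹ *
      ∫⁻ t in Ici 0, C.survival κ y 1 t *
        ENNReal.ofReal (C.path κ y 1 t / C.π₀ * y (C.path κ y 1 t))).toReal := by
  have hst := isStationary_cycleLaw hκ hy hadm hm hfin
  have hae : ∀ᵐ q ∂C.cycleLaw κ y, q ∈ Icc (0 : ℝ) 1 := by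
    rw [ae_iff]; exact hst.2.1
  have hae' : ∀ᵐ q ∂C.lawGivenHigh (C.cycleLaw κ y), q ∈ Icc (0 : ℝ) 1 :=
    withDensity_absolutelyContinuous _ _ hae
  have hd : Measurable fun p => ENNReal.ofReal (p / C.π₀) := by fun_prop
  rw [enforcementGivenHigh, integral_eq_lintegral_of_nonneg_ae
    (by filter_upwards [hae'] with q hq using (hy.2 q hq).1) hy.1.aestronglyMeasurable,
    lawGivenHigh, lintegral_withDensity_eq_lintegral_mul _ hd hy.1.ennreal_ofReal,
    lintegral_cycleLaw hκ hy hadm hm (hd.mul hy.1.ennreal_ofReal)]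
  congr 2
  refine setLIntegral_congr_fun measurableSet_Ici fun t ht => ?_
  have hp := path_mem hadm one_mem_unit (show (0 : ℝ) ≤ t from ht)
  simp only [Pi.mul_apply]
  rw [← ENNReal.ofReal_mul (div_nonneg hp.1 C.π₀_pos.le)]

end LongRun

end Chain

namespace Chain

/-! ### Evolutions under monotone policies -/

section Monotone

variable {C : Chain} {κ : ℝ} {y : ℝ → ℝ}

/-- Under a monotone policy the drift is one-sided Lipschitz. -/
theorem drift_sub_le (hκ : 0 ≤ κ) (hy : IsPolicy y) (hmono : MonotoneOn y (Icc 0 1)) {a b : ℝ}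
    (ha : a ∈ Icc (0 : ℝ) 1) (hb : b ∈ Icc (0 : ℝ) 1) (hab : b ≤ a) :
    C.drift κ a (y a) - C.drift κ b (y b) ≤ κ * (a - b) := by
  have h1 := C.ρL_pos
  have h2 := C.ρH_pos
  have h3 := hmono hb ha hab
  -- Monotonicity of the policy enters only here: stronger enforcement at the higher belief lowers
  -- its drift.
  have h4 : 0 ≤ κ * (a * (1 - a)) * (y a - y b) :=
    mul_nonneg (mul_nonneg hκ (mul_nonneg ha.1 (by linarith [ha.2]))) (by linarith)
  have h5 : 0 ≤ κ * (a - b) * (1 + (1 - a - b) * y b) := by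
    refine mul_nonneg (mul_nonneg hκ (by linarith)) ?_
    nlinarith [(hy.2 b hb).1, (hy.2 b hb).2, ha.2, hb.2]
  have h6 : 0 ≤ (C.ρL + C.ρH) * (a - b) := mul_nonneg (by linarith) (by linarith)
  have h7 : κ * (a - b) - (C.drift κ a (y a) - C.drift κ b (y b)) =
      (C.ρL + C.ρH) * (a - b) + κ * (a * (1 - a)) * (y a - y b) +
        κ * (a - b) * (1 + (1 - a - b) * y b) := by
    rw [drift, drift]; ring
  linarith

theorem IsPath.sub_eq (hκ : 0 ≤ κ) (hy : IsPolicy y) {q : ℝ} {φ : ℝ → ℝ}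
    (hφ : C.IsPath κ y q φ) {s t : ℝ} (hs : 0 ≤ s) (ht : 0 ≤ t) :
    φ t - φ s = ∫ u in s..t, C.drift κ (φ u) (y (φ u)) := by
  rw [hφ.2.2 t ht, hφ.2.2 s hs, add_sub_add_left_eq_sub,
    intervalIntegral.integral_interval_sub_left
      (hφ.intervalIntegrable_drift hκ hy le_rfl ht)
      (hφ.intervalIntegrable_drift hκ hy le_rfl hs)]

/-- Evolutions under a monotone policy are ordered as their initial beliefs. -/
theorem IsPath.le_of_le (hκ : 0 < κ) (hy : IsPolicy y) (hmono : MonotoneOn y (Icc 0 1))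
    {q q' : ℝ} (hqq : q ≤ q') {φ ψ : ℝ → ℝ} (hφ : C.IsPath κ y q φ) (hψ : C.IsPath κ y q' ψ)
    {t : ℝ} (ht : 0 ≤ t) : φ t ≤ ψ t := by
  by_contra! hcon
  set D : ℝ → ℝ := fun s => φ s - ψ s with hD
  have hDc : ContinuousOn D (Ici 0) := hφ.1.sub hψ.1
  have hcomp : IsCompact (Icc 0 t ∩ D ⁻¹' Iic 0) :=
    isCompact_Icc.of_isClosed_subset
      ((hDc.mono Icc_subset_Ici_self).preimage_isClosed_of_isClosed isClosed_Icc isClosed_Iic)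
      inter_subset_left
  have hne : (Icc 0 t ∩ D ⁻¹' Iic 0).Nonempty :=
    ⟨0, ⟨le_rfl, ht⟩, by
      simp only [hD, mem_preimage, mem_Iic, hφ.apply_zero, hψ.apply_zero]; linarith⟩
  -- The last time at which the order still holds; afterwards the difference is positive and the
  -- one-sided Lipschitz bound applies.
  obtain ⟨t₀, ⟨ht₀, hD₀⟩, hmax⟩ := hcomp.exists_isGreatest hne
  have hpos : ∀ s, t₀ < s → s ≤ t → 0 < D s := fun s h1 h2 => by
    by_contra! h
    exact absurd (hmax ⟨⟨ht₀.1.trans h1.le, h2⟩, h⟩) (not_le.2 h1)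
  have ht₀t : t₀ < t := lt_of_le_of_ne ht₀.2 fun h => by
    rw [h] at hD₀
    exact absurd hD₀ (not_le.2 (sub_pos.2 hcon))
  -- On a window this short, growth at rate `κ` yields at most half of the maximum of `D`, so that
  -- positive maximum bounds itself by its half.
  set t₂ := min t (t₀ + 1 / (2 * κ)) with ht₂
  have ht₂pos : t₀ < t₂ := lt_min ht₀t (lt_add_of_pos_right _ (by positivity))
  obtain ⟨u, hu, humax⟩ := (isCompact_Icc (a := t₀) (b := t₂)).exists_isMaxOn
    (nonempty_Icc.2 ht₂pos.le) (hDc.mono fun s hs => ht₀.1.trans hs.1)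
  have hDu : 0 < D u := (hpos t₂ ht₂pos (min_le_left _ _)).trans_le
    (humax (right_mem_Icc.2 ht₂pos.le))
  have hu0 : 0 ≤ u := ht₀.1.trans hu.1
  have hint := intervalIntegral.integral_sub
    (hφ.intervalIntegrable_drift hκ.le hy ht₀.1 hu0)
    (hψ.intervalIntegrable_drift hκ.le hy ht₀.1 hu0)
  rw [← hφ.sub_eq hκ.le hy ht₀.1 hu0, ← hψ.sub_eq hκ.le hy ht₀.1 hu0] at hint
  have hle : ∫ s in t₀..u, (C.drift κ (φ s) (y (φ s)) - C.drift κ (ψ s) (y (ψ s))) ≤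
      ∫ s in t₀..u, κ * D u := by
    refine intervalIntegral.integral_mono_on_of_le_Ioo hu.1
      ((hφ.intervalIntegrable_drift hκ.le hy ht₀.1 hu0).sub
        (hψ.intervalIntegrable_drift hκ.le hy ht₀.1 hu0))
      intervalIntegrable_const fun s hs => ?_
    have hs0 : 0 ≤ s := ht₀.1.trans hs.1.le
    have hsu : s ≤ t₂ := hs.2.le.trans hu.2
    have h1 := hpos s hs.1 (hsu.trans (min_le_left _ _))
    refine (drift_sub_le hκ.le hy hmono (hφ.2.1 s hs0) (hψ.2.1 s hs0)
      (sub_nonneg.1 h1.le)).trans ?_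
    exact mul_le_mul_of_nonneg_left (humax ⟨hs.1.le, hsu⟩) hκ.le
  rw [intervalIntegral.integral_const, smul_eq_mul, hint] at hle
  have h2 : u - t₀ ≤ 1 / (2 * κ) := by
    have := hu.2.trans (min_le_right _ _)
    linarith
  have h3 : (u - t₀) * (κ * D u) ≤ D u / 2 := by
    refine (mul_le_mul_of_nonneg_right h2 (by positivity)).trans_eq ?_
    field_simp
  have h4 : D t₀ ≤ 0 := hD₀
  have h5 : D u - D t₀ = φ u - φ t₀ - (ψ u - ψ t₀) := by simp only [hD]; ring
  linarith

/-- A monotone policy is admissible as soon as evolutions exist. -/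
theorem admissible_of_exists (hκ : 0 < κ) (hy : IsPolicy y) (hmono : MonotoneOn y (Icc 0 1))
    (h : ∀ q ∈ Icc (0 : ℝ) 1, ∃ φ, C.IsPath κ y q φ) : C.Admissible κ y :=
  fun q hq => ⟨h q hq, fun _ _ hφ hψ _ ht => le_antisymm
    (hφ.le_of_le hκ hy hmono le_rfl hψ ht) (hψ.le_of_le hκ hy hmono le_rfl hφ ht)⟩

theorem path_le_path (hκ : 0 < κ) (hy : IsPolicy y) (hmono : MonotoneOn y (Icc 0 1))
    (hadm : C.Admissible κ y) {q q' : ℝ} (hq : q ∈ Icc (0 : ℝ) 1) (hq' : q' ∈ Icc (0 : ℝ) 1)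
    (hqq : q ≤ q') {t : ℝ} (ht : 0 ≤ t) : C.path κ y q t ≤ C.path κ y q' t :=
  (isPath_path hadm hq).le_of_le hκ hy hmono hqq (isPath_path hadm hq') ht

/-- A Carathéodory argument: paths are continuous in time and, by comparison, monotone in the
initial belief. -/
theorem measurablePath_of_monotone (hκ : 0 < κ) (hy : IsPolicy y)
    (hmono : MonotoneOn y (Icc 0 1)) (hadm : C.Admissible κ y) : C.MeasurablePath κ y := by
  have h : Measurable (Function.uncurry fun t q => C.path κ y (clamp q) (max t 0)) := by
    refine measurable_uncurry_of_continuous_of_measurable (fun q => ?_) (fun t => ?_)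
    · exact (isPath_path hadm (clamp_mem q)).1.comp_continuous (by fun_prop)
        fun t => mem_Ici.2 (le_max_right t 0)
    · refine Monotone.measurable fun q q' hqq => ?_
      exact path_le_path hκ hy hmono hadm (clamp_mem q) (clamp_mem q')
        (max_le_max_left _ (min_le_min_right _ hqq)) (le_max_right _ _)
  exact h.comp measurable_swap

/-- Right derivatives suffice, which accommodates the kink of an evolution on arrival at the cutoff.
-/
theorem isPath_of_hasDerivWithinAt (hκ : 0 ≤ κ) (hy : IsPolicy y) {q : ℝ} {φ : ℝ → ℝ}
    (hc : ContinuousOn φ (Ici 0)) (h0 : φ 0 = q) (hm : ∀ t, 0 ≤ t → φ t ∈ Icc (0 : ℝ) 1)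
    (hd : ∀ t, 0 ≤ t → HasDerivWithinAt φ (C.drift κ (φ t) (y (φ t))) (Ioi t) t) :
    C.IsPath κ y q φ := by
  refine ⟨hc, hm, fun t ht => ?_⟩
  rw [intervalIntegral.integral_eq_sub_of_hasDeriv_right (f := φ), h0]
  · ring
  · exact hc.mono fun s hs => by rw [uIcc_of_le ht] at hs; exact hs.1
  · intro s hs
    rw [min_eq_left ht] at hs
    exact hd s hs.1.le
  · exact intervalIntegrable_comp (G := fun p => C.drift κ p (y p)) (measurable_drift_policy hy.1)
      (fun p hp => abs_drift_le hκ hp (hy.2 p hp)) hc hm le_rfl ht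

end Monotone

end Chain

namespace Chain

/-! ### Evolution at constant enforcement -/

section Flow

variable {C : Chain} {κ : ℝ}

theorem π₀_lt_one (C : Chain) : C.π₀ < 1 := by
  have h1 := C.ρL_pos
  have h2 := C.ρH_pos
  rw [π₀, div_lt_one (by linarith)]
  linarith

theorem π₀_mul (C : Chain) : (C.ρL + C.ρH) * C.π₀ = C.ρL := by
  have h1 := C.ρL_pos
  have h2 := C.ρH_pos
  rw [π₀, add_comm]
  field_simp

theorem π₀_mem (C : Chain) : C.π₀ ∈ Icc (0 : ℝ) 1 := ⟨C.π₀_pos.le, C.π₀_lt_one.le⟩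

theorem drift_zero_eq (C : Chain) (κ p : ℝ) :
    C.drift κ p 0 = (C.ρL + C.ρH) * (C.π₀ - p) := by
  rw [mul_sub, π₀_mul, drift]
  ring

/-- The root above one of the drift under full enforcement. -/
noncomputable def π₂ (C : Chain) (κ : ℝ) : ℝ := (C.ρL + C.ρH + κ) / κ - C.π₁ κ

theorem π₁_add_π₂ (hκ : 0 < κ) : κ * (C.π₁ κ + C.π₂ κ) = C.ρL + C.ρH + κ := by
  rw [π₂]
  field_simp
  ring

theorem π₁_mul_π₂ (hκ : 0 < κ) : κ * (C.π₁ κ * C.π₂ κ) = C.ρL := by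
  have h1 := C.drift_π₁ hκ
  have h2 := C.π₁_add_π₂ hκ
  rw [drift] at h1
  linear_combination C.π₁ κ * h2 - h1

theorem drift_one_eq (hκ : 0 < κ) (p : ℝ) :
    C.drift κ p 1 = κ * ((p - C.π₁ κ) * (p - C.π₂ κ)) := by
  have h1 := C.π₁_mul_π₂ hκ
  have h2 := C.π₁_add_π₂ hκ
  rw [drift]
  linear_combination p * h2 - h1

/-- The factored drift evaluated at belief one, where it equals `-ρH`. -/
theorem π₂_sub_one (hκ : 0 < κ) : κ * ((C.π₂ κ - 1) * (1 - C.π₁ κ)) = C.ρH := by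
  have h1 := C.π₁_mul_π₂ hκ
  have h2 := C.π₁_add_π₂ hκ
  linear_combination h2 - h1

theorem one_lt_π₂ (hκ : 0 < κ) : 1 < C.π₂ κ := by
  have h1 := C.π₂_sub_one hκ
  have h2 := C.mem_Ioo_π₁ hκ
  by_contra! h
  have h3 : κ * ((C.π₂ κ - 1) * (1 - C.π₁ κ)) ≤ 0 :=
    mul_nonpos_of_nonneg_of_nonpos hκ.le
      (mul_nonpos_of_nonpos_of_nonneg (by linarith) (by linarith [h2.2]))
  linarith [C.ρH_pos]

theorem π₁_lt_π₀ (hκ : 0 < κ) : C.π₁ κ < C.π₀ := by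
  rw [← C.drift_one_neg_iff hκ ⟨C.π₀_pos, C.π₀_lt_one⟩]
  have h := C.drift_zero_eq κ C.π₀
  have h1 : C.drift κ C.π₀ 1 = C.drift κ C.π₀ 0 - C.π₀ * (1 - C.π₀) * κ := by
    rw [drift, drift]; ring
  have h2 : 0 < C.π₀ * (1 - C.π₀) * κ :=
    mul_pos (mul_pos C.π₀_pos (sub_pos.2 C.π₀_lt_one)) hκ
  rw [h1, h]
  linarith

/-- The evolution without enforcement. -/
noncomputable def freeFlow (C : Chain) (q t : ℝ) : ℝ :=
  C.π₀ + (q - C.π₀) * Real.exp (-((C.ρL + C.ρH) * t))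

theorem freeFlow_zero (q : ℝ) : C.freeFlow q 0 = q := by simp [freeFlow]

theorem hasDerivAt_freeFlow (κ q t : ℝ) :
    HasDerivAt (C.freeFlow q) (C.drift κ (C.freeFlow q t) 0) t := by
  have h : HasDerivAt (C.freeFlow q)
      ((q - C.π₀) * (Real.exp (-((C.ρL + C.ρH) * t)) * (-((C.ρL + C.ρH) * 1)))) t :=
    ((((hasDerivAt_id t).const_mul (C.ρL + C.ρH)).neg.exp).const_mul (q - C.π₀)).const_add C.π₀
  convert h using 1
  rw [drift_zero_eq, freeFlow]
  ring

theorem continuous_freeFlow (q : ℝ) : Continuous (C.freeFlow q) := by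
  unfold freeFlow; fun_prop

theorem exp_freeFlow_le_one {t : ℝ} (ht : 0 ≤ t) :
    Real.exp (-((C.ρL + C.ρH) * t)) ≤ 1 := by
  rw [Real.exp_le_one_iff, neg_nonpos]
  exact mul_nonneg (by linarith [C.ρL_pos, C.ρH_pos]) ht

/-- The evolution is at every time a convex combination of its start and `π₀`. -/
theorem freeFlow_mem_of_mem {I : Set ℝ} (hI : Convex ℝ I) {q : ℝ} (hq : q ∈ I) (h0 : C.π₀ ∈ I)
    {t : ℝ} (ht : 0 ≤ t) : C.freeFlow q t ∈ I := by
  have h1 := Real.exp_pos (-((C.ρL + C.ρH) * t))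
  have h2 := C.exp_freeFlow_le_one ht
  have h := hI h0 hq (sub_nonneg.2 h2) h1.le (by ring)
  convert h using 1
  rw [freeFlow, smul_eq_mul, smul_eq_mul]
  ring

theorem freeFlow_mono {q s t : ℝ} (hq : q ≤ C.π₀) (hst : s ≤ t) :
    C.freeFlow q s ≤ C.freeFlow q t := by
  have h : Real.exp (-((C.ρL + C.ρH) * t)) ≤ Real.exp (-((C.ρL + C.ρH) * s)) :=
    Real.exp_le_exp.2 (neg_le_neg (mul_le_mul_of_nonneg_left hst
      (by linarith [C.ρL_pos, C.ρH_pos])))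
  rw [freeFlow, freeFlow]
  nlinarith

theorem tendsto_freeFlow (q : ℝ) :
    Filter.Tendsto (C.freeFlow q) Filter.atTop (nhds C.π₀) := by
  have hs : 0 < C.ρL + C.ρH := by linarith [C.ρL_pos, C.ρH_pos]
  have h1 : Filter.Tendsto (fun t => Real.exp (-((C.ρL + C.ρH) * t))) Filter.atTop (nhds 0) :=
    Real.tendsto_exp_neg_atTop_nhds_zero.comp (Filter.tendsto_id.const_mul_atTop hs)
  have h2 := (h1.const_mul (q - C.π₀)).const_add C.π₀
  rw [mul_zero, add_zero] at h2
  exact h2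

/-- The normalized denominator of the evolution under full enforcement. -/
noncomputable def fullDen (C : Chain) (κ q t : ℝ) : ℝ :=
  (C.π₂ κ - q) + (q - C.π₁ κ) * Real.exp (-(κ * (C.π₂ κ - C.π₁ κ) * t))

/-- The evolution under full enforcement. -/
noncomputable def fullFlow (C : Chain) (κ q t : ℝ) : ℝ :=
  C.π₂ κ - (C.π₂ κ - C.π₁ κ) * (C.π₂ κ - q) / C.fullDen κ q t

theorem fullDen_pos (hκ : 0 < κ) {q : ℝ} (hq : q ∈ Icc (C.π₁ κ) 1) (t : ℝ) :
    0 < C.fullDen κ q t := by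
  have h1 := C.one_lt_π₂ hκ
  have h2 := Real.exp_pos (-(κ * (C.π₂ κ - C.π₁ κ) * t))
  exact add_pos_of_pos_of_nonneg (by linarith [hq.2]) (mul_nonneg (sub_nonneg.2 hq.1) h2.le)

theorem fullDen_zero (q : ℝ) : C.fullDen κ q 0 = C.π₂ κ - C.π₁ κ := by
  simp [fullDen]

theorem π₁_lt_π₂ (hκ : 0 < κ) : C.π₁ κ < C.π₂ κ :=
  (C.mem_Ioo_π₁ hκ).2.trans (C.one_lt_π₂ hκ)

theorem fullFlow_zero (hκ : 0 < κ) (q : ℝ) : C.fullFlow κ q 0 = q := by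
  have h := sub_pos.2 (C.π₁_lt_π₂ hκ)
  rw [fullFlow, fullDen_zero, mul_div_cancel_left₀ _ h.ne']
  ring

theorem fullFlow_sub_π₁ (hκ : 0 < κ) {q : ℝ} (hq : q ∈ Icc (C.π₁ κ) 1) (t : ℝ) :
    C.fullFlow κ q t - C.π₁ κ = (C.π₂ κ - C.π₁ κ) * ((q - C.π₁ κ) *
      Real.exp (-(κ * (C.π₂ κ - C.π₁ κ) * t))) / C.fullDen κ q t := by
  have h := C.fullDen_pos hκ hq t
  rw [fullFlow, eq_div_iff h.ne', sub_mul, sub_mul, div_mul_cancel₀ _ h.ne', fullDen]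
  ring

theorem hasDerivAt_fullDen (q t : ℝ) :
    HasDerivAt (C.fullDen κ q) (-(κ * (C.π₂ κ - C.π₁ κ)) * ((q - C.π₁ κ) *
      Real.exp (-(κ * (C.π₂ κ - C.π₁ κ) * t)))) t := by
  have h : HasDerivAt (C.fullDen κ q) ((q - C.π₁ κ) *
      (Real.exp (-(κ * (C.π₂ κ - C.π₁ κ) * t)) * (-(κ * (C.π₂ κ - C.π₁ κ) * 1)))) t :=
    ((((hasDerivAt_id t).const_mul (κ * (C.π₂ κ - C.π₁ κ))).neg.exp).const_mul _).const_add _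
  convert h using 1
  ring

/-- The equation is of Riccati type with roots `π₁` and `π₂`: the ratio of the distances to the two
roots decays at rate `κ * (π₂ - π₁)`. Starting points in `[π₁, 1]` keep the denominator positive. -/
theorem hasDerivAt_fullFlow (hκ : 0 < κ) {q : ℝ} (hq : q ∈ Icc (C.π₁ κ) 1) (t : ℝ) :
    HasDerivAt (C.fullFlow κ q) (C.drift κ (C.fullFlow κ q t) 1) t := by
  have hpos := C.fullDen_pos hκ hq t
  have h1 := ((hasDerivAt_const t ((C.π₂ κ - C.π₁ κ) * (C.π₂ κ - q))).div
    (C.hasDerivAt_fullDen (κ := κ) q t) hpos.ne').const_sub (C.π₂ κ)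
  convert! h1 using 1
  have h2 : C.fullFlow κ q t - C.π₂ κ =
      -((C.π₂ κ - C.π₁ κ) * (C.π₂ κ - q) / C.fullDen κ q t) := by rw [fullFlow]; ring
  rw [drift_one_eq hκ, fullFlow_sub_π₁ hκ hq, h2]
  field_simp
  ring

theorem fullFlow_anti (hκ : 0 < κ) {q : ℝ} (hq : q ∈ Icc (C.π₁ κ) 1) {s t : ℝ}
    (hst : s ≤ t) : C.fullFlow κ q t ≤ C.fullFlow κ q s := by
  have hd := sub_pos.2 (C.π₁_lt_π₂ hκ)
  have h1 := C.one_lt_π₂ hκ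
  have h2 : C.fullDen κ q t ≤ C.fullDen κ q s := by
    have h : Real.exp (-(κ * (C.π₂ κ - C.π₁ κ) * t)) ≤
        Real.exp (-(κ * (C.π₂ κ - C.π₁ κ) * s)) :=
      Real.exp_le_exp.2 (neg_le_neg (mul_le_mul_of_nonneg_left hst (by positivity)))
    exact add_le_add_right (mul_le_mul_of_nonneg_left h (sub_nonneg.2 hq.1)) _
  have h3 := div_le_div_of_nonneg_left
    (mul_nonneg hd.le (by linarith [hq.2] : 0 ≤ C.π₂ κ - q)) (C.fullDen_pos hκ hq t) h2
  rw [fullFlow, fullFlow]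
  linarith

theorem π₁_le_fullFlow (hκ : 0 < κ) {q : ℝ} (hq : q ∈ Icc (C.π₁ κ) 1) (t : ℝ) :
    C.π₁ κ ≤ C.fullFlow κ q t := by
  have hd := sub_pos.2 (C.π₁_lt_π₂ hκ)
  rw [← sub_nonneg, fullFlow_sub_π₁ hκ hq]
  exact div_nonneg (mul_nonneg hd.le (mul_nonneg (sub_nonneg.2 hq.1) (Real.exp_pos _).le))
    (C.fullDen_pos hκ hq t).le

theorem fullFlow_mem (hκ : 0 < κ) {q : ℝ} (hq : q ∈ Icc (C.π₁ κ) 1) {t : ℝ} (ht : 0 ≤ t) :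
    C.fullFlow κ q t ∈ Icc (0 : ℝ) 1 :=
  ⟨(C.mem_Ioo_π₁ hκ).1.le.trans (C.π₁_le_fullFlow hκ hq t),
    (C.fullFlow_anti hκ hq ht).trans (by rw [fullFlow_zero hκ]; exact hq.2)⟩

theorem continuous_fullFlow (hκ : 0 < κ) {q : ℝ} (hq : q ∈ Icc (C.π₁ κ) 1) :
    Continuous (C.fullFlow κ q) :=
  continuous_iff_continuousAt.2 fun t => (C.hasDerivAt_fullFlow hκ hq t).continuousAt

/-- The odds, relative to the two roots of the drift, of `p` against those of `q`. -/
noncomputable def oddsRatio (C : Chain) (κ q p : ℝ) : ℝ :=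
  (p - C.π₁ κ) * (C.π₂ κ - q) / ((C.π₂ κ - p) * (q - C.π₁ κ))

/-- The time at which the evolution under full enforcement from `q` reaches `p`. -/
noncomputable def hitTime (C : Chain) (κ q p : ℝ) : ℝ :=
  -Real.log (C.oddsRatio κ q p) / (κ * (C.π₂ κ - C.π₁ κ))

theorem oddsRatio_pos (hκ : 0 < κ) {p q : ℝ} (hp : C.π₁ κ < p) (hpq : p ≤ q) (hq : q ≤ 1) :
    0 < C.oddsRatio κ q p := by
  have h := C.one_lt_π₂ hκ
  exact div_pos (mul_pos (by linarith) (by linarith)) (mul_pos (by linarith) (by linarith))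

theorem exp_hitTime (hκ : 0 < κ) {p q : ℝ} (hp : C.π₁ κ < p) (hpq : p ≤ q) (hq : q ≤ 1) :
    Real.exp (-(κ * (C.π₂ κ - C.π₁ κ) * C.hitTime κ q p)) = C.oddsRatio κ q p := by
  have hd := sub_pos.2 (C.π₁_lt_π₂ hκ)
  rw [hitTime, mul_div_cancel₀ _ (by positivity), neg_neg,
    Real.exp_log (C.oddsRatio_pos hκ hp hpq hq)]

theorem hitTime_nonneg (hκ : 0 < κ) {p q : ℝ} (hp : C.π₁ κ < p) (hpq : p ≤ q) (hq : q ≤ 1) :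
    0 ≤ C.hitTime κ q p := by
  have hd := sub_pos.2 (C.π₁_lt_π₂ hκ)
  have h := C.one_lt_π₂ hκ
  refine div_nonneg (neg_nonneg.2 (Real.log_nonpos (C.oddsRatio_pos hκ hp hpq hq).le ?_))
    (by positivity)
  rw [oddsRatio, div_le_one (mul_pos (by linarith) (by linarith))]
  nlinarith

theorem fullDen_hitTime (hκ : 0 < κ) {p q : ℝ} (hp : C.π₁ κ < p) (hpq : p ≤ q) (hq : q ≤ 1) :
    C.fullDen κ q (C.hitTime κ q p) =
      (C.π₂ κ - C.π₁ κ) * (C.π₂ κ - q) / (C.π₂ κ - p) := by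
  have h := C.one_lt_π₂ hκ
  have h1 : C.π₂ κ - p ≠ 0 := by linarith
  have h2 : q - C.π₁ κ ≠ 0 := by linarith
  rw [fullDen, exp_hitTime hκ hp hpq hq, oddsRatio]
  field_simp
  ring

theorem fullFlow_hitTime (hκ : 0 < κ) {p q : ℝ} (hp : C.π₁ κ < p) (hpq : p ≤ q) (hq : q ≤ 1) :
    C.fullFlow κ q (C.hitTime κ q p) = p := by
  have hd := sub_pos.2 (C.π₁_lt_π₂ hκ)
  have h := C.one_lt_π₂ hκ
  have h1 : C.π₂ κ - p ≠ 0 := by linarith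
  have h2 : C.π₂ κ - q ≠ 0 := by linarith
  rw [fullFlow, fullDen_hitTime hκ hp hpq hq]
  field_simp
  ring

theorem lt_fullFlow (hκ : 0 < κ) {p q : ℝ} (hp : C.π₁ κ < p) (hpq : p ≤ q) (hq : q ≤ 1) {t : ℝ}
    (ht : t < C.hitTime κ q p) : p < C.fullFlow κ q t := by
  have hd := sub_pos.2 (C.π₁_lt_π₂ hκ)
  have h1 := C.one_lt_π₂ hκ
  have hqm : q ∈ Icc (C.π₁ κ) 1 := ⟨(hp.trans_le hpq).le, hq⟩
  have h2 : C.fullDen κ q (C.hitTime κ q p) < C.fullDen κ q t := by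
    have h : Real.exp (-(κ * (C.π₂ κ - C.π₁ κ) * C.hitTime κ q p)) <
        Real.exp (-(κ * (C.π₂ κ - C.π₁ κ) * t)) :=
      Real.exp_lt_exp.2 (neg_lt_neg (mul_lt_mul_of_pos_left ht (by positivity)))
    exact add_lt_add_right (mul_lt_mul_of_pos_left h (by linarith)) _
  have h3 := div_lt_div_of_pos_left
    (mul_pos hd (by linarith : 0 < C.π₂ κ - q)) (C.fullDen_pos hκ hqm _) h2
  have h4 := C.fullFlow_hitTime hκ hp hpq hq
  rw [fullFlow] at h4 ⊢
  linarith

end Flow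

end Chain

namespace Chain

/-! ### Evolutions under cutoff policies -/

section Cutoff

variable {C : Chain} {κ phat : ℝ} {y : ℝ → ℝ}

theorem IsCutoffPolicy.monotoneOn (hy : IsPolicy y) (hcut : C.IsCutoffPolicy κ phat y) :
    MonotoneOn y (Icc 0 1) := by
  intro a ha b hb hab
  rcases lt_or_ge phat b with h | h
  · rw [(hcut.1 b hb).1 h]; exact (hy.2 a ha).2
  · rcases hab.eq_or_lt with rfl | h1
    · exact le_rfl
    · rw [(hcut.1 a ha).2 (h1.trans_le h)]; exact (hy.2 b hb).1

/-- Full enforcement above the cutoff and none at or below it. -/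
noncomputable def stepPolicy (phat : ℝ) : ℝ → ℝ := fun p => if phat < p then 1 else 0

theorem stepPolicy_of_lt {p : ℝ} (h : phat < p) : stepPolicy phat p = 1 := if_pos h

theorem stepPolicy_of_le {p : ℝ} (h : p ≤ phat) : stepPolicy phat p = 0 := if_neg (not_lt.2 h)

theorem isPolicy_stepPolicy (phat : ℝ) : IsPolicy (stepPolicy phat) := by
  refine ⟨Measurable.ite measurableSet_Ioi measurable_const measurable_const, fun p _ => ?_⟩
  rcases lt_or_ge phat p with h | h
  · rw [stepPolicy_of_lt h]; exact one_mem_unit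
  · rw [stepPolicy_of_le h]; exact ⟨le_rfl, zero_le_one⟩

/-- The clause fixing the level at the cutoff is void here. Choosing the level zero there keeps `π₀`
at rest when the cutoff is exactly `π₀`. -/
theorem isCutoffPolicy_stepPolicy (h : C.π₀ ≤ phat) :
    C.IsCutoffPolicy κ phat (stepPolicy phat) :=
  ⟨fun _ _ => ⟨stepPolicy_of_lt, fun h => stepPolicy_of_le h.le⟩,
    fun h' => absurd h'.2 (not_lt.2 h)⟩

theorem isPath_freeFlow (hκ : 0 < κ) (h : C.π₀ ≤ phat) {q : ℝ} (hq : q ∈ Icc (0 : ℝ) 1)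
    (hqp : q ≤ phat) : C.IsPath κ (stepPolicy phat) q (C.freeFlow q) := by
  refine isPath_of_hasDerivWithinAt hκ.le (isPolicy_stepPolicy phat)
    (continuous_freeFlow q).continuousOn (freeFlow_zero q)
    (fun t ht => freeFlow_mem_of_mem (convex_Icc 0 1) hq C.π₀_mem ht) fun t ht => ?_
  rw [stepPolicy_of_le (freeFlow_mem_of_mem (convex_Iic phat) hqp h ht)]
  exact (hasDerivAt_freeFlow κ q t).hasDerivWithinAt

/-- From above, the belief follows `fullFlow` until it hits the cutoff and then `freeFlow`, which
stays below the cutoff because its limit `π₀` does. The recorded time `T` later bounds the period in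
which detections can occur. -/
theorem exists_isPath_stepPolicy (hκ : 0 < κ) (h : C.π₀ ≤ phat) {q : ℝ}
    (hq : q ∈ Icc (0 : ℝ) 1) :
    ∃ φ, C.IsPath κ (stepPolicy phat) q φ ∧ ∃ T, 0 ≤ T ∧ φ T ≤ phat := by
  rcases le_or_gt q phat with hqp | hqp
  · exact ⟨_, isPath_freeFlow hκ h hq hqp, 0, le_rfl, by rwa [freeFlow_zero]⟩
  have hp : C.π₁ κ < phat := (C.π₁_lt_π₀ hκ).trans_le h
  have hqm : q ∈ Icc (C.π₁ κ) 1 := ⟨(hp.trans hqp).le, hq.2⟩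
  have hpm : phat ∈ Icc (0 : ℝ) 1 := ⟨C.π₀_pos.le.trans h, hqp.le.trans hq.2⟩
  set T := C.hitTime κ q phat with hT
  have hT0 : 0 ≤ T := hitTime_nonneg hκ hp hqp.le hq.2
  have hfT : C.fullFlow κ q T = phat := fullFlow_hitTime hκ hp hqp.le hq.2
  set φ : ℝ → ℝ := fun t => if t ≤ T then C.fullFlow κ q t else C.freeFlow phat (t - T) with hφ
  have hφ1 : ∀ t, t ≤ T → φ t = C.fullFlow κ q t := fun t ht => if_pos ht
  have hφ2 : ∀ t, T ≤ t → φ t = C.freeFlow phat (t - T) := fun t ht => by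
    rcases ht.eq_or_lt with rfl | h1
    · rw [hφ1 _ le_rfl, hfT, sub_self, freeFlow_zero]
    · exact if_neg (not_le.2 h1)
  have hc : Continuous φ :=
    (continuous_fullFlow hκ hqm).if_le ((continuous_freeFlow phat).comp (by fun_prop))
      continuous_id continuous_const
      fun t ht => by rw [ht, hfT, sub_self, freeFlow_zero]
  refine ⟨φ, isPath_of_hasDerivWithinAt hκ.le (isPolicy_stepPolicy phat) hc.continuousOn
    ?_ (fun t ht => ?_) fun t ht => ?_, T, hT0, by rw [hφ1 _ le_rfl, hfT]⟩
  · rw [hφ1 _ hT0, fullFlow_zero hκ]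
  · rcases le_total t T with h1 | h1
    · rw [hφ1 t h1]; exact fullFlow_mem hκ hqm ht
    · rw [hφ2 t h1]
      exact freeFlow_mem_of_mem (convex_Icc 0 1) hpm C.π₀_mem (sub_nonneg.2 h1)
  · rcases lt_or_ge t T with h1 | h1
    · rw [hφ1 t h1.le, stepPolicy_of_lt (lt_fullFlow hκ hp hqp.le hq.2 h1)]
      refine ((hasDerivAt_fullFlow hκ hqm t).congr_of_eventuallyEq ?_).hasDerivWithinAt
      filter_upwards [Iio_mem_nhds h1] with s hs using hφ1 s (le_of_lt hs)
    · rw [hφ2 t h1, stepPolicy_of_le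
        (freeFlow_mem_of_mem (convex_Iic phat) (mem_Iic.2 le_rfl) h (sub_nonneg.2 h1))]
      exact ((hasDerivAt_freeFlow κ phat (t - T)).comp_sub_const t T).hasDerivWithinAt.congr
        (fun s hs => hφ2 s (h1.trans (le_of_lt hs))) (hφ2 t h1)

theorem admissible_stepPolicy (hκ : 0 < κ) (h : C.π₀ ≤ phat) :
    C.Admissible κ (stepPolicy phat) :=
  admissible_of_exists hκ (isPolicy_stepPolicy phat)
    ((isCutoffPolicy_stepPolicy (κ := κ) h).monotoneOn (isPolicy_stepPolicy phat))
    fun _ hq => (exists_isPath_stepPolicy hκ h hq).imp fun _ h => h.1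

/-- The decreasing flow is stopped at the cutoff, where `stayLevel` makes the drift vanish; hence
the maximum. -/
theorem isPath_max_fullFlow (hκ : 0 < κ) (hp : phat ∈ Ioo (C.π₁ κ) C.π₀) (hy : IsPolicy y)
    (hcut : C.IsCutoffPolicy κ phat y) {q : ℝ} (hq : q ∈ Icc phat 1) :
    C.IsPath κ y q fun t => max phat (C.fullFlow κ q t) := by
  have hp01 : phat ∈ Ioo (0 : ℝ) 1 :=
    ⟨(C.mem_Ioo_π₁ hκ).1.trans hp.1, hp.2.trans C.π₀_lt_one⟩
  have hqm : q ∈ Icc (C.π₁ κ) 1 := ⟨hp.1.le.trans hq.1, hq.2⟩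
  have hc := continuous_fullFlow hκ hqm
  have hmem : ∀ t, 0 ≤ t → max phat (C.fullFlow κ q t) ∈ Icc (0 : ℝ) 1 := fun t ht =>
    ⟨hp01.1.le.trans (le_max_left _ _), max_le hp01.2.le (fullFlow_mem hκ hqm ht).2⟩
  refine isPath_of_hasDerivWithinAt hκ.le hy (by fun_prop)
    (by rw [fullFlow_zero hκ, max_eq_right hq.1]) hmem fun t ht => ?_
  rcases lt_or_ge phat (C.fullFlow κ q t) with h | h
  · rw [max_eq_right h.le, (hcut.1 _ (fullFlow_mem hκ hqm ht)).1 h]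
    refine ((hasDerivAt_fullFlow hκ hqm t).congr_of_eventuallyEq ?_).hasDerivWithinAt
    filter_upwards [hc.continuousAt.eventually_const_lt h] with s hs using max_eq_right hs.le
  · rw [max_eq_left h, hcut.2 hp, drift_stayLevel C hκ hp01]
    refine (hasDerivWithinAt_const t (Ioi t) phat).congr (fun s hs => ?_) (max_eq_left h)
    exact max_eq_left ((fullFlow_anti hκ hqm (le_of_lt hs)).trans h)

theorem isPath_min_freeFlow (hκ : 0 < κ) (hp : phat ∈ Ioo (C.π₁ κ) C.π₀) (hy : IsPolicy y)
    (hcut : C.IsCutoffPolicy κ phat y) {q : ℝ} (hq : q ∈ Icc 0 phat) :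
    C.IsPath κ y q fun t => min phat (C.freeFlow q t) := by
  have hp01 : phat ∈ Ioo (0 : ℝ) 1 :=
    ⟨(C.mem_Ioo_π₁ hκ).1.trans hp.1, hp.2.trans C.π₀_lt_one⟩
  have hq0 : q ≤ C.π₀ := hq.2.trans hp.2.le
  have hq01 : q ∈ Icc (0 : ℝ) 1 := ⟨hq.1, hq.2.trans hp01.2.le⟩
  have hc := C.continuous_freeFlow q
  have hfm : ∀ t, 0 ≤ t → C.freeFlow q t ∈ Icc (0 : ℝ) 1 := fun t ht =>
    freeFlow_mem_of_mem (convex_Icc 0 1) hq01 C.π₀_mem ht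
  have hmem : ∀ t, 0 ≤ t → min phat (C.freeFlow q t) ∈ Icc (0 : ℝ) 1 := fun t ht =>
    ⟨le_min hp01.1.le (hfm t ht).1, (min_le_left _ _).trans hp01.2.le⟩
  refine isPath_of_hasDerivWithinAt hκ.le hy (by fun_prop)
    (by rw [freeFlow_zero, min_eq_right hq.2]) hmem fun t ht => ?_
  rcases lt_or_ge (C.freeFlow q t) phat with h | h
  · rw [min_eq_right h.le, (hcut.1 _ (hfm t ht)).2 h]
    refine ((hasDerivAt_freeFlow κ q t).congr_of_eventuallyEq ?_).hasDerivWithinAt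
    filter_upwards [hc.continuousAt.eventually_lt_const h] with s hs using min_eq_right hs.le
  · rw [min_eq_left h, hcut.2 hp, drift_stayLevel C hκ hp01]
    refine (hasDerivWithinAt_const t (Ioi t) phat).congr (fun s hs => ?_) (min_eq_left h)
    exact min_eq_left (h.trans (freeFlow_mono hq0 (le_of_lt hs)))

theorem IsCutoffPolicy.admissible (hκ : 0 < κ) (hp : phat ∈ Ioo (C.π₁ κ) C.π₀)
    (hy : IsPolicy y) (hcut : C.IsCutoffPolicy κ phat y) : C.Admissible κ y := by
  refine admissible_of_exists hκ hy (hcut.monotoneOn hy) fun q hq => ?_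
  rcases le_total phat q with h | h
  · exact ⟨_, isPath_max_fullFlow hκ hp hy hcut ⟨h, hq.2⟩⟩
  · exact ⟨_, isPath_min_freeFlow hκ hp hy hcut ⟨hq.1, h⟩⟩

end Cutoff

end Chain

namespace Chain

/-! ### Long-run enforcement under a cutoff that attracts the belief -/

section Attracting

variable {C : Chain} {κ phat : ℝ} {y : ℝ → ℝ}

theorem setLIntegral_Ici_add (w : ℝ) (f : ℝ → ℝ≥0∞) :
    ∫⁻ u in Ici 0, f (w + u) = ∫⁻ t in Ici w, f t := by
  rw [← (measurePreserving_add_left volume w).setLIntegral_comp_preimage_emb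
    (measurableEmbedding_addLeft w) f]
  simp

theorem setLIntegral_Ici_zero_eq {w : ℝ} (hw : 0 ≤ w) (f : ℝ → ℝ≥0∞) :
    ∫⁻ t in Ici 0, f t = (∫⁻ t in Ico 0 w, f t) + ∫⁻ u in Ici 0, f (w + u) := by
  rw [setLIntegral_Ici_add, ← lintegral_union measurableSet_Ici, Ico_union_Ici_eq_Ici hw]
  exact disjoint_left.2 fun x hx hx' => absurd hx.2 (not_lt.2 hx')

theorem lintegral_Ico_ofReal_deriv {G g : ℝ → ℝ} {T : ℝ} (hT : 0 ≤ T)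
    (hd : ∀ t, HasDerivAt G (g t) t) (hg : Continuous g) (hpos : ∀ t, 0 ≤ t → 0 ≤ g t) :
    ∫⁻ t in Ico 0 T, ENNReal.ofReal (g t) = ENNReal.ofReal (G T - G 0) := by
  rw [← intervalIntegral.integral_eq_sub_of_hasDerivAt (fun t _ => hd t)
    (hg.intervalIntegrable _ _), intervalIntegral.integral_of_le hT,
    ofReal_integral_eq_lintegral_ofReal, setLIntegral_congr Ico_ae_eq_Ioc]
  · exact (hg.intervalIntegrable 0 T).1
  · filter_upwards [ae_restrict_mem measurableSet_Ioc] with t ht using hpos t ht.1.le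

theorem lintegral_Ici_exp {θ : ℝ} (hθ : 0 < θ) :
    ∫⁻ u in Ici 0, ENNReal.ofReal (Real.exp (-(θ * u))) = ENNReal.ofReal (1 / θ) := by
  have h := integral_exp_mul_Ioi (neg_lt_zero.2 hθ) 0
  simp only [neg_mul, mul_zero, Real.exp_zero] at h
  have hint : IntegrableOn (fun u : ℝ => Real.exp (-(θ * u))) (Ioi 0) := by
    simpa only [neg_mul] using integrableOn_exp_mul_Ioi (neg_lt_zero.2 hθ) 0
  rw [setLIntegral_congr Ioi_ae_eq_Ici.symm, ← ofReal_integral_eq_lintegral_ofReal hint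
    (Filter.Eventually.of_forall fun _ => (Real.exp_pos _).le), h]
  congr 1
  field_simp

/-- The probability, under the attracting cutoff `p`, that the belief drifts from one to the
cutoff without a detection. -/
noncomputable def reachProb (C : Chain) (κ p : ℝ) : ℝ :=
  C.oddsRatio κ 1 p ^ (C.π₁ κ / (C.π₂ κ - C.π₁ κ)) * ((C.π₂ κ - 1) / (C.π₂ κ - p))

/-- The probability of no detection by time `t` under full enforcement, from belief one. -/
noncomputable def fullSurvival (C : Chain) (κ t : ℝ) : ℝ :=
  Real.exp (-(κ * C.π₁ κ * t)) * (C.fullDen κ 1 t / (C.π₂ κ - C.π₁ κ))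

theorem one_mem_π₁ (hκ : 0 < κ) : (1 : ℝ) ∈ Icc (C.π₁ κ) 1 := ⟨(C.mem_Ioo_π₁ hκ).2.le, le_rfl⟩

theorem fullSurvival_pos (hκ : 0 < κ) (t : ℝ) : 0 < C.fullSurvival κ t :=
  mul_pos (Real.exp_pos _) (div_pos (fullDen_pos hκ (one_mem_π₁ hκ) t)
    (sub_pos.2 (C.π₁_lt_π₂ hκ)))

theorem fullSurvival_zero (hκ : 0 < κ) : C.fullSurvival κ 0 = 1 := by
  rw [fullSurvival, fullDen_zero, div_self (sub_pos.2 (C.π₁_lt_π₂ hκ)).ne']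
  simp

/-- The closed form solves `S' = -(p * κ) * S` along `fullFlow`, the equation for surviving
detection at rate `p * κ`. -/
theorem hasDerivAt_fullSurvival (hκ : 0 < κ) (t : ℝ) :
    HasDerivAt (C.fullSurvival κ) (-(C.fullFlow κ 1 t * κ) * C.fullSurvival κ t) t := by
  have hD := C.fullDen_pos hκ (one_mem_π₁ hκ) t
  have hd := sub_pos.2 (C.π₁_lt_π₂ hκ)
  have h1 : HasDerivAt (fun t => Real.exp (-(κ * C.π₁ κ * t)))
      (Real.exp (-(κ * C.π₁ κ * t)) * (-(κ * C.π₁ κ * 1))) t :=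
    ((hasDerivAt_id t).const_mul (κ * C.π₁ κ)).neg.exp
  have h2 := h1.mul ((C.hasDerivAt_fullDen (κ := κ) 1 t).div_const (C.π₂ κ - C.π₁ κ))
  have h3 := C.fullFlow_sub_π₁ hκ (one_mem_π₁ hκ) t
  rw [eq_div_iff hD.ne'] at h3
  convert! h2 using 1
  rw [fullSurvival]
  generalize Real.exp (-(κ * C.π₁ κ * t)) = a at *
  generalize Real.exp (-(κ * (C.π₂ κ - C.π₁ κ) * t)) = b at *
  field_simp
  linear_combination -a * h3

theorem exp_neg_fullHazard (hκ : 0 < κ) (t : ℝ) :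
    Real.exp (-∫ s in (0 : ℝ)..t, C.fullFlow κ 1 s * κ) = C.fullSurvival κ t := by
  have h : ∀ s, HasDerivAt (fun s => -Real.log (C.fullSurvival κ s))
      (C.fullFlow κ 1 s * κ) s := fun s => by
    have h1 := ((C.hasDerivAt_fullSurvival hκ s).log (C.fullSurvival_pos hκ s).ne').neg
    convert! h1 using 1
    have := (C.fullSurvival_pos hκ s).ne'
    field_simp
  rw [intervalIntegral.integral_eq_sub_of_hasDerivAt (fun s _ => h s)
    (((continuous_fullFlow hκ (one_mem_π₁ hκ)).mul continuous_const).intervalIntegrable _ _),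
    fullSurvival_zero hκ]
  simp [Real.exp_log (fullSurvival_pos hκ t)]

theorem fullSurvival_hitTime (hκ : 0 < κ) (hp : C.π₁ κ < phat) (hp1 : phat ≤ 1) :
    C.fullSurvival κ (C.hitTime κ 1 phat) = C.reachProb κ phat := by
  have hd := sub_pos.2 (C.π₁_lt_π₂ hκ)
  have h2 : C.π₂ κ - phat ≠ 0 := by linarith [C.one_lt_π₂ hκ]
  rw [fullSurvival, reachProb, fullDen_hitTime hκ hp hp1 le_rfl,
    Real.rpow_def_of_pos (oddsRatio_pos hκ hp hp1 le_rfl), hitTime]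
  congr 1
  · congr 1
    field_simp
  · field_simp

theorem stayLevel_pos (hκ : 0 < κ) (hp : phat ∈ Ioo 0 C.π₀) : 0 < C.stayLevel κ phat := by
  have h1 := C.π₀_mul
  have h2 : 0 < C.ρL + C.ρH := by linarith [C.ρL_pos, C.ρH_pos]
  have h3 := mul_lt_mul_of_pos_left hp.2 h2
  exact div_pos (by nlinarith) (mul_pos (mul_pos hp.1 (by linarith [hp.2, C.π₀_lt_one])) hκ)

theorem stayLevel_lt_one (hκ : 0 < κ) (hp : phat ∈ Ioo (C.π₁ κ) 1) : C.stayLevel κ phat < 1 := by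
  have hp0 : phat ∈ Ioo (0 : ℝ) 1 := ⟨(C.mem_Ioo_π₁ hκ).1.trans hp.1, hp.2⟩
  have h := (C.drift_one_neg_iff hκ hp0).2 hp.1
  rw [drift] at h
  rw [stayLevel, div_lt_one (mul_pos (mul_pos hp0.1 (sub_pos.2 hp.2)) hκ)]
  linarith

theorem cutoff_mem (hκ : 0 < κ) (hp : phat ∈ Ioo (C.π₁ κ) C.π₀) : phat ∈ Ioo (0 : ℝ) 1 :=
  ⟨(C.mem_Ioo_π₁ hκ).1.trans hp.1, hp.2.trans C.π₀_lt_one⟩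

theorem path_eq_max (hκ : 0 < κ) (hp : phat ∈ Ioo (C.π₁ κ) C.π₀) (hy : IsPolicy y)
    (hcut : C.IsCutoffPolicy κ phat y) {q : ℝ} (hq : q ∈ Icc phat 1) {t : ℝ} (ht : 0 ≤ t) :
    C.path κ y q t = max phat (C.fullFlow κ q t) :=
  path_eq (hcut.admissible hκ hp hy) ⟨(cutoff_mem hκ hp).1.le.trans hq.1, hq.2⟩
    (isPath_max_fullFlow hκ hp hy hcut hq) ht

theorem path_mem_of_cutoff (hκ : 0 < κ) (hp : phat ∈ Ioo (C.π₁ κ) C.π₀) (hy : IsPolicy y)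
    (hcut : C.IsCutoffPolicy κ phat y) {q : ℝ} (hq : q ∈ Icc phat 1) {t : ℝ} (ht : 0 ≤ t) :
    C.path κ y q t ∈ Icc phat 1 := by
  have hp01 := cutoff_mem hκ hp
  refine ⟨?_, (path_mem (hcut.admissible hκ hp hy) ⟨hp01.1.le.trans hq.1, hq.2⟩ ht).2⟩
  rw [path_eq_max hκ hp hy hcut hq ht]
  exact le_max_left _ _

theorem path_one_of_le_hitTime (hκ : 0 < κ) (hp : phat ∈ Ioo (C.π₁ κ) C.π₀) (hy : IsPolicy y)
    (hcut : C.IsCutoffPolicy κ phat y) {t : ℝ} (ht : 0 ≤ t) (htT : t ≤ C.hitTime κ 1 phat) :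
    C.path κ y 1 t = C.fullFlow κ 1 t := by
  have hp1 := (cutoff_mem hκ hp).2.le
  rw [path_eq_max hκ hp hy hcut ⟨hp1, le_rfl⟩ ht, max_eq_right]
  rw [← C.fullFlow_hitTime hκ hp.1 hp1 le_rfl]
  exact fullFlow_anti hκ (one_mem_π₁ hκ) htT

theorem policy_path_one (hκ : 0 < κ) (hp : phat ∈ Ioo (C.π₁ κ) C.π₀) (hy : IsPolicy y)
    (hcut : C.IsCutoffPolicy κ phat y) {t : ℝ} (ht : 0 ≤ t) (htT : t < C.hitTime κ 1 phat) :
    y (C.path κ y 1 t) = 1 := by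
  have hp1 := (cutoff_mem hκ hp).2.le
  refine (hcut.1 _ (path_mem (hcut.admissible hκ hp hy) one_mem_unit ht)).1 ?_
  rw [path_one_of_le_hitTime hκ hp hy hcut ht htT.le]
  exact lt_fullFlow hκ hp.1 hp1 le_rfl htT

theorem path_cutoff (hκ : 0 < κ) (hp : phat ∈ Ioo (C.π₁ κ) C.π₀) (hy : IsPolicy y)
    (hcut : C.IsCutoffPolicy κ phat y) {t : ℝ} (ht : 0 ≤ t) : C.path κ y phat t = phat := by
  have hp1 := (cutoff_mem hκ hp).2.le
  rw [path_eq_max hκ hp hy hcut ⟨le_rfl, hp1⟩ ht, max_eq_left]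
  exact (fullFlow_anti hκ ⟨hp.1.le, hp1⟩ ht).trans_eq (fullFlow_zero hκ _)

theorem path_one_hitTime (hκ : 0 < κ) (hp : phat ∈ Ioo (C.π₁ κ) C.π₀) (hy : IsPolicy y)
    (hcut : C.IsCutoffPolicy κ phat y) : C.path κ y 1 (C.hitTime κ 1 phat) = phat := by
  have hp1 := (cutoff_mem hκ hp).2.le
  rw [path_one_of_le_hitTime hκ hp hy hcut (hitTime_nonneg hκ hp.1 hp1 le_rfl) le_rfl,
    fullFlow_hitTime hκ hp.1 hp1 le_rfl]

theorem hazard_cutoff (hκ : 0 < κ) (hp : phat ∈ Ioo (C.π₁ κ) C.π₀) (hy : IsPolicy y)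
    (hcut : C.IsCutoffPolicy κ phat y) {t : ℝ} (ht : 0 ≤ t) :
    C.hazard κ y phat t = phat * κ * C.stayLevel κ phat * t := by
  have h : C.hazard κ y phat t = ∫ _ in (0 : ℝ)..t, phat * κ * C.stayLevel κ phat := by
    refine intervalIntegral.integral_congr fun s hs => ?_
    rw [uIcc_of_le ht] at hs
    simp only [path_cutoff hκ hp hy hcut hs.1, hcut.2 hp]
  rw [h, intervalIntegral.integral_const, smul_eq_mul]
  ring

theorem survival_one_of_le_hitTime (hκ : 0 < κ) (hp : phat ∈ Ioo (C.π₁ κ) C.π₀)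
    (hy : IsPolicy y) (hcut : C.IsCutoffPolicy κ phat y) {t : ℝ} (ht : 0 ≤ t)
    (htT : t ≤ C.hitTime κ 1 phat) :
    C.survival κ y 1 t = ENNReal.ofReal (C.fullSurvival κ t) := by
  rw [survival, ← exp_neg_fullHazard hκ, hazard, intervalIntegral.integral_of_le ht,
    intervalIntegral.integral_of_le ht, integral_Ioc_eq_integral_Ioo,
    integral_Ioc_eq_integral_Ioo]
  congr 3
  refine setIntegral_congr_fun measurableSet_Ioo fun s hs => ?_
  rw [policy_path_one hκ hp hy hcut hs.1.le (hs.2.trans_le htT), mul_one,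
    path_one_of_le_hitTime hκ hp hy hcut hs.1.le (hs.2.le.trans htT)]

theorem survival_one_hitTime_add (hκ : 0 < κ) (hp : phat ∈ Ioo (C.π₁ κ) C.π₀)
    (hy : IsPolicy y) (hcut : C.IsCutoffPolicy κ phat y) {u : ℝ} (hu : 0 ≤ u) :
    C.survival κ y 1 (C.hitTime κ 1 phat + u) = ENNReal.ofReal (C.reachProb κ phat) *
      ENNReal.ofReal (Real.exp (-(phat * κ * C.stayLevel κ phat * u))) := by
  have hp1 := (cutoff_mem hκ hp).2.le
  have hT := C.hitTime_nonneg hκ hp.1 hp1 le_rfl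
  rw [← fullSurvival_hitTime hκ hp.1 hp1, ← survival_one_of_le_hitTime hκ hp hy hcut hT le_rfl,
    survival, survival, hazard_add hκ.le hy (hcut.admissible hκ hp hy) one_mem_unit hT hu,
    path_one_hitTime hκ hp hy hcut, hazard_cutoff hκ hp hy hcut hu, neg_add, Real.exp_add,
    ENNReal.ofReal_mul (Real.exp_pos _).le]

/-- From every belief the cutoff is reached within a common time, so the waiting time until a
detection has bounded mean. -/
theorem exists_bound_survival (hκ : 0 < κ) (hp : phat ∈ Ioo (C.π₁ κ) C.π₀) (hy : IsPolicy y)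
    (hcut : C.IsCutoffPolicy κ phat y) :
    ∃ K : ℝ≥0∞, K ≠ ∞ ∧ ∀ q ∈ Icc (0 : ℝ) 1, ∫⁻ t in Ici 0, C.survival κ y q t ≤ K := by
  have hp01 := cutoff_mem hκ hp
  have hadm := hcut.admissible hκ hp hy
  have hmono := hcut.monotoneOn hy
  have h0 : (0 : ℝ) ∈ Icc (0 : ℝ) 1 := ⟨le_rfl, zero_le_one⟩
  have hθ : 0 < phat * κ * C.stayLevel κ phat :=
    mul_pos (mul_pos hp01.1 hκ) (stayLevel_pos hκ ⟨hp01.1, hp.2⟩)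
  have hT := C.hitTime_nonneg hκ hp.1 hp01.2.le le_rfl
  -- At such a `T` the highest and the lowest evolution both sit at the cutoff, so by comparison all
  -- do; from then on the detection rate is a positive constant.
  obtain ⟨T, hT1, hT2⟩ : ∃ T, C.hitTime κ 1 phat ≤ T ∧ phat ≤ C.freeFlow 0 T :=
    ((Filter.eventually_ge_atTop _).and
      ((C.tendsto_freeFlow 0).eventually_const_le hp.2)).exists
  have hT0 : 0 ≤ T := hT.trans hT1
  have hq : ∀ q ∈ Icc (0 : ℝ) 1, C.path κ y q T = phat := fun q hq => by
    apply le_antisymm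
    · refine (path_le_path hκ hy hmono hadm hq one_mem_unit hq.2 hT0).trans_eq ?_
      have h := path_add hκ.le hy hadm one_mem_unit hT (sub_nonneg.2 hT1)
      rwa [add_sub_cancel, path_one_hitTime hκ hp hy hcut,
        path_cutoff hκ hp hy hcut (sub_nonneg.2 hT1)] at h
    · refine le_trans (le_of_eq ?_) (path_le_path hκ hy hmono hadm h0 hq hq.1 hT0)
      rw [path_eq hadm h0 (isPath_min_freeFlow hκ hp hy hcut ⟨le_rfl, hp01.1.le⟩) hT0,
        min_eq_left hT2]
  refine ⟨ENNReal.ofReal T + ENNReal.ofReal (1 / (phat * κ * C.stayLevel κ phat)),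
    by finiteness, fun q hq' => ?_⟩
  have hle1 : ∀ t, 0 ≤ t → C.survival κ y q t ≤ 1 := fun t ht => by
    rw [survival, ENNReal.ofReal_le_one, Real.exp_le_one_iff, neg_nonpos]
    exact hazard_nonneg hκ.le hy hadm hq' ht
  rw [setLIntegral_Ici_zero_eq hT0, ← lintegral_Ici_exp hθ]
  refine add_le_add ?_ ?_
  · refine (setLIntegral_mono' measurableSet_Ico fun t ht => hle1 t ht.1).trans ?_
    simp
  · refine setLIntegral_mono' measurableSet_Ici fun u hu => ?_
    rw [survival, hazard_add hκ.le hy hadm hq' hT0 hu, hq q hq',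
      hazard_cutoff hκ hp hy hcut hu]
    refine ENNReal.ofReal_le_ofReal (Real.exp_le_exp.2 ?_)
    linarith [hazard_nonneg hκ.le hy hadm hq' hT0]

theorem IsCutoffPolicy.isLongRunLaw (hκ : 0 < κ) (hp : phat ∈ Ioo (C.π₁ κ) C.π₀)
    (hy : IsPolicy y) (hcut : C.IsCutoffPolicy κ phat y) :
    C.IsLongRunLaw κ y (C.cycleLaw κ y) := by
  obtain ⟨K, hK, h⟩ := exists_bound_survival hκ hp hy hcut
  have hadm := hcut.admissible hκ hp hy
  exact isLongRunLaw_cycleLaw hκ hy hadm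
    (measurablePath_of_monotone hκ hy (hcut.monotoneOn hy) hadm) hK h

theorem reachProb_pos (hκ : 0 < κ) (hp : phat ∈ Ioo (C.π₁ κ) 1) : 0 < C.reachProb κ phat := by
  have h := C.one_lt_π₂ hκ
  exact mul_pos (Real.rpow_pos_of_pos (oddsRatio_pos hκ hp.1 hp.2.le le_rfl) _)
    (div_pos (by linarith) (by linarith [hp.2]))

/-- The first term is the mean time spent sliding to the cutoff before a detection, the second the
exponential wait at the cutoff weighted by the chance of getting there. -/
theorem IsCutoffPolicy.meanCycle_eq (hκ : 0 < κ) (hp : phat ∈ Ioo (C.π₁ κ) C.π₀)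
    (hy : IsPolicy y) (hcut : C.IsCutoffPolicy κ phat y) :
    C.meanCycle κ y = ENNReal.ofReal ((C.reachProb κ phat *
        (phat - (C.ρL + C.ρH + κ) / κ) - (1 - (C.ρL + C.ρH + κ) / κ)) / C.ρL) +
      ENNReal.ofReal (C.reachProb κ phat * (1 / (phat * κ * C.stayLevel κ phat))) := by
  have hp01 := cutoff_mem hκ hp
  have hθ : 0 < phat * κ * C.stayLevel κ phat :=
    mul_pos (mul_pos hp01.1 hκ) (stayLevel_pos hκ ⟨hp01.1, hp.2⟩)
  have hT := C.hitTime_nonneg hκ hp.1 hp01.2.le le_rfl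
  have hL := C.ρL_pos
  have hσ := C.reachProb_pos hκ ⟨hp.1, hp01.2⟩
  rw [meanCycle, setLIntegral_Ici_zero_eq hT]
  congr 1
  · rw [setLIntegral_congr_fun (g := fun t => ENNReal.ofReal (C.fullSurvival κ t))
      measurableSet_Ico fun t ht => survival_one_of_le_hitTime hκ hp hy hcut ht.1 ht.2.le]
    -- With `S` for survival and `p` for the flow, the constant `(ρL + ρH + κ) / κ` cancels every
    -- power of `p` in the derivative of `S * (p - const)`, leaving `ρL * S`.
    have hd : ∀ t, HasDerivAt (fun t => C.fullSurvival κ t *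
        (C.fullFlow κ 1 t - (C.ρL + C.ρH + κ) / κ) / C.ρL) (C.fullSurvival κ t) t := fun t => by
      have h := ((C.hasDerivAt_fullSurvival hκ t).mul ((C.hasDerivAt_fullFlow hκ
        (one_mem_π₁ hκ) t).sub_const ((C.ρL + C.ρH + κ) / κ))).div_const C.ρL
      convert! h using 1
      rw [drift]
      field_simp
      ring
    have hc : Continuous (C.fullSurvival κ) :=
      continuous_iff_continuousAt.2 fun t => (C.hasDerivAt_fullSurvival hκ t).continuousAt
    rw [lintegral_Ico_ofReal_deriv hT hd hc fun t _ => (C.fullSurvival_pos hκ t).le]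
    rw [fullSurvival_hitTime hκ hp.1 hp01.2.le, fullFlow_hitTime hκ hp.1 hp01.2.le le_rfl,
      fullSurvival_zero hκ, fullFlow_zero hκ, one_mul, ← sub_div]
  · rw [setLIntegral_congr_fun measurableSet_Ici
      fun u hu => survival_one_hitTime_add hκ hp hy hcut hu,
      lintegral_const_mul _ (by fun_prop), lintegral_Ici_exp hθ, ENNReal.ofReal_mul hσ.le]

/-- Up to the factor `κ * π₀` the integrand is the density of the first detection time, and
detection is certain. -/
theorem IsCutoffPolicy.lintegral_detection (hκ : 0 < κ) (hp : phat ∈ Ioo (C.π₁ κ) C.π₀)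
    (hy : IsPolicy y) (hcut : C.IsCutoffPolicy κ phat y) (hσ1 : C.reachProb κ phat ≤ 1) :
    ∫⁻ t in Ici 0, C.survival κ y 1 t *
        ENNReal.ofReal (C.path κ y 1 t / C.π₀ * y (C.path κ y 1 t)) =
      ENNReal.ofReal (1 / (κ * C.π₀)) := by
  have hp01 := cutoff_mem hκ hp
  have hz := C.stayLevel_pos hκ ⟨hp01.1, hp.2⟩
  have hθ : 0 < phat * κ * C.stayLevel κ phat := mul_pos (mul_pos hp01.1 hκ) hz
  have hT := C.hitTime_nonneg hκ hp.1 hp01.2.le le_rfl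
  have h0 := C.π₀_pos
  have hσ := C.reachProb_pos hκ ⟨hp.1, hp01.2⟩
  have hadm := hcut.admissible hκ hp hy
  -- Total probability one splits into detection before the cutoff, `1 - reachProb`, and after it,
  -- `reachProb`.
  have hsplit : 1 / (κ * C.π₀) = (1 - C.reachProb κ phat) / (κ * C.π₀) +
      C.reachProb κ phat * (1 / (phat * κ * C.stayLevel κ phat)) *
        (phat / C.π₀ * C.stayLevel κ phat) := by
    have := hp01.1.ne'
    field_simp
    ring
  rw [hsplit, ENNReal.ofReal_add (div_nonneg (sub_nonneg.2 hσ1) (by positivity))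
    (mul_nonneg (by positivity) (mul_nonneg (div_nonneg hp01.1.le h0.le) hz.le)),
    setLIntegral_Ici_zero_eq hT]
  congr 1
  · have hd : ∀ t, HasDerivAt (fun t => -C.fullSurvival κ t / (κ * C.π₀))
        (C.fullSurvival κ t * (C.fullFlow κ 1 t / C.π₀)) t := fun t => by
      have h := (C.hasDerivAt_fullSurvival hκ t).neg.div_const (κ * C.π₀)
      convert! h using 1
      field_simp
    have hc : Continuous fun t => C.fullSurvival κ t * (C.fullFlow κ 1 t / C.π₀) :=
      (continuous_iff_continuousAt.2 fun t =>
        (C.hasDerivAt_fullSurvival hκ t).continuousAt).mul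
        ((continuous_fullFlow hκ (one_mem_π₁ hκ)).div_const _)
    have h := lintegral_Ico_ofReal_deriv hT hd hc fun t ht =>
      mul_nonneg (C.fullSurvival_pos hκ t).le
        (div_nonneg (fullFlow_mem hκ (one_mem_π₁ hκ) ht).1 h0.le)
    rw [fullSurvival_hitTime hκ hp.1 hp01.2.le, fullSurvival_zero hκ] at h
    rw [show (1 - C.reachProb κ phat) / (κ * C.π₀) =
      -C.reachProb κ phat / (κ * C.π₀) - -1 / (κ * C.π₀) by ring, ← h]
    refine setLIntegral_congr_fun measurableSet_Ico fun t ht => ?_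
    rw [policy_path_one hκ hp hy hcut ht.1 ht.2, mul_one,
      survival_one_of_le_hitTime hκ hp hy hcut ht.1 ht.2.le,
      path_one_of_le_hitTime hκ hp hy hcut ht.1 ht.2.le,
      ENNReal.ofReal_mul (C.fullSurvival_pos hκ t).le]
  · have hφ : ∀ u ∈ Ici (0 : ℝ), C.survival κ y 1 (C.hitTime κ 1 phat + u) * ENNReal.ofReal
        (C.path κ y 1 (C.hitTime κ 1 phat + u) / C.π₀ *
          y (C.path κ y 1 (C.hitTime κ 1 phat + u))) =
        ENNReal.ofReal (C.reachProb κ phat) *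
          ENNReal.ofReal (Real.exp (-(phat * κ * C.stayLevel κ phat * u))) *
          ENNReal.ofReal (phat / C.π₀ * C.stayLevel κ phat) := fun u hu => by
      rw [survival_one_hitTime_add hκ hp hy hcut hu,
        path_add hκ.le hy hadm one_mem_unit hT hu, path_one_hitTime hκ hp hy hcut,
        path_cutoff hκ hp hy hcut hu, hcut.2 hp]
    rw [setLIntegral_congr_fun measurableSet_Ici hφ, lintegral_mul_const _ (by fun_prop),
      lintegral_const_mul _ (by fun_prop), lintegral_Ici_exp hθ,
      ← ENNReal.ofReal_mul hσ.le, ← ENNReal.ofReal_mul (by positivity)]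

/-- In `κ * (π₂ - 1) * (1 - π₁) = ρH` one replaces `π₁` by the larger `π₀`, for which `1 - π₀ = ρH /
(ρL + ρH)`. -/
theorem π₂_sub_one_le (hκ : 0 < κ) : κ * (C.π₂ κ - 1) ≤ C.ρL + C.ρH := by
  have h1 := C.π₂_sub_one hκ
  have h2 := C.π₁_lt_π₀ hκ
  have h3 := C.π₀_mul
  have h4 := C.one_lt_π₂ hκ
  have hL := C.ρL_pos
  have hH := C.ρH_pos
  have h5 : κ * (C.π₂ κ - 1) * (1 - C.π₀) ≤ C.ρH := by
    rw [← h1, ← mul_assoc]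
    exact mul_le_mul_of_nonneg_left (by linarith) (mul_nonneg hκ.le (by linarith))
  have h6 : (C.ρL + C.ρH) * (1 - C.π₀) = C.ρH := by linarith
  rw [← h6] at h5
  exact le_of_mul_le_mul_right h5 (sub_pos.2 C.π₀_lt_one)

/-- The expected enforcement, conditional on the high state, under a cutoff that attracts the
belief. -/
noncomputable def cutoffEnforcement (C : Chain) (κ p : ℝ) : ℝ :=
  C.stayLevel κ p / (C.stayLevel κ p + (1 - C.stayLevel κ p) * C.reachProb κ p)

/-- The power factor is at most one and is dropped; what remains is rational and easy to estimate.
-/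
theorem reachProb_le (hκ : 0 < κ) (hp : phat ∈ Ioo (C.π₁ κ) 1) :
    C.reachProb κ phat ≤ (C.π₂ κ - 1) / (C.π₂ κ - phat) := by
  have h := C.one_lt_π₂ hκ
  have hd := C.π₁_lt_π₂ hκ
  have hodd := C.oddsRatio_pos hκ hp.1 hp.2.le le_rfl
  refine mul_le_of_le_one_left (div_nonneg (by linarith) (by linarith [hp.2])) ?_
  refine Real.rpow_le_one hodd.le ?_
    (div_nonneg (C.mem_Ioo_π₁ hκ).1.le (sub_pos.2 hd).le)
  rw [oddsRatio, div_le_one (mul_pos (by linarith [hp.2]) (by linarith [hp.1, hp.2]))]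
  nlinarith [hp.1, hp.2]

theorem reachProb_le_one (hκ : 0 < κ) (hp : phat ∈ Ioo (C.π₁ κ) 1) :
    C.reachProb κ phat ≤ 1 := by
  have h := C.one_lt_π₂ hκ
  refine (reachProb_le hκ hp).trans ((div_le_one (by linarith [hp.2])).2 (by linarith [hp.2]))

theorem IsCutoffPolicy.enforcementGivenHigh_eq (hκ : 0 < κ) (hp : phat ∈ Ioo (C.π₁ κ) C.π₀)
    (hy : IsPolicy y) (hcut : C.IsCutoffPolicy κ phat y) :
    C.enforcementGivenHigh y (C.cycleLaw κ y) = C.cutoffEnforcement κ phat := by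
  have hp01 := cutoff_mem hκ hp
  have hz := C.stayLevel_pos hκ ⟨hp01.1, hp.2⟩
  have hz1 := C.stayLevel_lt_one hκ ⟨hp.1, hp01.2⟩
  have hσ := C.reachProb_pos hκ ⟨hp.1, hp01.2⟩
  have hσ1 := C.reachProb_le_one hκ ⟨hp.1, hp01.2⟩
  have hL := C.ρL_pos
  have hH := C.ρH_pos
  have h0 := C.π₀_pos
  have hp0 := hp01.1
  have hadm := hcut.admissible hκ hp hy
  have hm := measurablePath_of_monotone hκ hy (hcut.monotoneOn hy) hadm
  obtain ⟨K, hK, hKle⟩ := exists_bound_survival hκ hp hy hcut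
  have hfin : C.meanCycle κ y ≠ ∞ := ne_top_of_le_ne_top hK (hKle 1 one_mem_unit)
  -- Nonnegativity must be known before the terms of the mean cycle can be merged, since
  -- `ENNReal.ofReal` truncates.
  have hM1 : 0 ≤ (C.reachProb κ phat * (phat - (C.ρL + C.ρH + κ) / κ) -
      (1 - (C.ρL + C.ρH + κ) / κ)) / C.ρL := by
    have h1 := C.π₂_sub_one_le hκ
    have h2 := C.reachProb_le hκ ⟨hp.1, hp01.2⟩
    rw [le_div_iff₀ (by linarith [C.one_lt_π₂ hκ, hp01.2])] at h2
    have h3 : (C.reachProb κ phat * (phat - (C.ρL + C.ρH + κ) / κ) -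
        (1 - (C.ρL + C.ρH + κ) / κ)) / C.ρL = ((C.ρL + C.ρH) * (1 - C.reachProb κ phat) -
          κ * (C.reachProb κ phat * (1 - phat))) / (κ * C.ρL) := by
      field_simp
      ring
    rw [h3]
    refine div_nonneg ?_ (by positivity)
    nlinarith [mul_le_mul_of_nonneg_right h1 (sub_nonneg.2 hσ1),
      mul_le_mul_of_nonneg_left h2 hκ.le]
  rw [enforcementGivenHigh_cycleLaw hκ hy hadm hm hfin,
    hcut.lintegral_detection hκ hp hy hσ1, hcut.meanCycle_eq hκ hp hy,
    ← ENNReal.ofReal_add hM1 (by positivity), ENNReal.toReal_mul, ENNReal.toReal_inv,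
    ENNReal.toReal_ofReal (add_nonneg hM1 (by positivity)),
    ENNReal.toReal_ofReal (by positivity), cutoffEnforcement]
  have hrel : C.ρL - (C.ρL + C.ρH) * phat = phat * (1 - phat) * κ * C.stayLevel κ phat := by
    have h := C.drift_stayLevel hκ hp01
    rw [drift] at h
    linarith
  have hM : ((C.reachProb κ phat * (phat - (C.ρL + C.ρH + κ) / κ) -
      (1 - (C.ρL + C.ρH + κ) / κ)) / C.ρL + C.reachProb κ phat *
        (1 / (phat * κ * C.stayLevel κ phat))) * (κ * C.π₀) =
      (C.stayLevel κ phat + (1 - C.stayLevel κ phat) * C.reachProb κ phat) /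
        C.stayLevel κ phat := by
    rw [π₀]
    field_simp
    linear_combination C.reachProb κ phat * hrel
  rw [one_div (κ * C.π₀), ← mul_inv, hM, inv_div]

end Attracting

end Chain

namespace Chain

/-! ### Long-run beliefs under a cutoff above the stationary belief -/

section Inactive

variable {C : Chain} {κ phat : ℝ}

theorem path_stepPolicy (hκ : 0 < κ) (h : C.π₀ ≤ phat) {q : ℝ} (hq : q ∈ Icc (0 : ℝ) 1)
    (hqp : q ≤ phat) {t : ℝ} (ht : 0 ≤ t) :
    C.path κ (stepPolicy phat) q t = C.freeFlow q t :=
  path_eq (admissible_stepPolicy hκ h) hq (isPath_freeFlow hκ h hq hqp) ht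

theorem hazard_stepPolicy (hκ : 0 < κ) (h : C.π₀ ≤ phat) {q : ℝ} (hq : q ∈ Icc (0 : ℝ) 1)
    (hqp : q ≤ phat) {t : ℝ} (ht : 0 ≤ t) : C.hazard κ (stepPolicy phat) q t = 0 := by
  have h1 : C.hazard κ (stepPolicy phat) q t = ∫ _ in (0 : ℝ)..t, (0 : ℝ) := by
    refine intervalIntegral.integral_congr fun s hs => ?_
    rw [uIcc_of_le ht] at hs
    have h2 : C.path κ (stepPolicy phat) q s ≤ phat := by
      rw [path_stepPolicy hκ h hq hqp hs.1]
      exact freeFlow_mem_of_mem (convex_Iic phat) hqp h hs.1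
    simp only [stepPolicy_of_le h2, mul_zero]
  simpa using h1

/-- From every belief, detections are possible only for a common bounded time. -/
theorem exists_path_le_cutoff (hκ : 0 < κ) (h : C.π₀ ≤ phat) :
    ∃ T, 0 ≤ T ∧ ∀ q ∈ Icc (0 : ℝ) 1, C.path κ (stepPolicy phat) q T ≤ phat := by
  have hadm := admissible_stepPolicy hκ h
  have hy := isPolicy_stepPolicy phat
  have hmono := (isCutoffPolicy_stepPolicy (κ := κ) h).monotoneOn hy
  obtain ⟨φ, hφ, T, hT, hTp⟩ := exists_isPath_stepPolicy hκ h one_mem_unit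
  refine ⟨T, hT, fun q hq => (path_le_path hκ hy hmono hadm hq one_mem_unit hq.2 hT).trans ?_⟩
  rwa [path_eq hadm one_mem_unit hφ hT]

/-- All evolutions are squeezed between those from zero and from one, and both converge to `π₀`;
this makes the time uniform in the start. -/
theorem exists_abs_path_sub_le (hκ : 0 < κ) (h : C.π₀ ≤ phat) {ε : ℝ} (hε : 0 < ε) :
    ∃ t₁, 0 ≤ t₁ ∧ ∀ q ∈ Icc (0 : ℝ) 1, ∀ t, t₁ ≤ t →
      |C.path κ (stepPolicy phat) q t - C.π₀| ≤ ε := by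
  have hadm := admissible_stepPolicy hκ h
  have hy := isPolicy_stepPolicy phat
  have hmono := (isCutoffPolicy_stepPolicy (κ := κ) h).monotoneOn hy
  have h0 : (0 : ℝ) ∈ Icc (0 : ℝ) 1 := ⟨le_rfl, zero_le_one⟩
  obtain ⟨T, hT, hTp⟩ := exists_path_le_cutoff hκ h
  have h1 := (C.tendsto_freeFlow 0).eventually_const_le (show C.π₀ - ε < C.π₀ by linarith)
  have h2 := (C.tendsto_freeFlow (C.path κ (stepPolicy phat) 1 T)).eventually_le_const
    (show C.π₀ < C.π₀ + ε by linarith)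
  obtain ⟨a, ha⟩ := Filter.eventually_atTop.1 (h1.and h2)
  refine ⟨T + max a 0, by positivity, fun q hq t ht => ?_⟩
  have ha0 := le_max_right a 0
  have ha1 := le_max_left a 0
  have ht0 : 0 ≤ t := by linarith
  have htT : 0 ≤ t - T := by linarith
  rw [abs_le]
  constructor
  · have h3 := path_le_path hκ hy hmono hadm h0 hq hq.1 ht0
    rw [path_stepPolicy hκ h h0 (C.π₀_pos.le.trans h) ht0] at h3
    linarith [(ha t (by linarith)).1]
  · have h3 := path_le_path hκ hy hmono hadm hq one_mem_unit hq.2 ht0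
    have h4 := path_add hκ.le hy hadm one_mem_unit hT htT
    rw [add_sub_cancel, path_stepPolicy hκ h (path_mem hadm one_mem_unit hT)
      (hTp 1 one_mem_unit) htT] at h4
    linarith [(ha (t - T) (by linarith)).2]

/-- Once at or below the cutoff the belief stays there unenforced, so a clock that has not rung by
`T` never rings. -/
theorem waitingTime_eq_top (hκ : 0 < κ) (h : C.π₀ ≤ phat) {T : ℝ} (hT : 0 ≤ T)
    (hTp : ∀ q ∈ Icc (0 : ℝ) 1, C.path κ (stepPolicy phat) q T ≤ phat) {q : ℝ}
    (hq : q ∈ Icc (0 : ℝ) 1) {x : ℝ} (hx : C.hazard κ (stepPolicy phat) q T < x) :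
    C.waitingTime κ (stepPolicy phat) q x = ∞ := by
  have hadm := admissible_stepPolicy hκ h
  have hy := isPolicy_stepPolicy phat
  refine eq_of_forall_ofReal_lt_iff fun s hs => iff_of_true ?_ ENNReal.ofReal_lt_top
  rw [lt_waitingTime_iff hκ hy hadm hq hs]
  refine lt_of_le_of_lt (hazard_mono hκ.le hy hadm hq hs (le_add_of_nonneg_left hT)) ?_
  rw [hazard_add hκ.le hy hadm hq hT hs,
    hazard_stepPolicy hκ h (path_mem hadm hq hT) (hTp q hq) hs, add_zero]
  exact hx

theorem ae_belief_eq_π₀ (hκ : 0 < κ) (h : C.π₀ ≤ phat) :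
    ∀ᵐ e ∂clockLaw, ∀ t, 0 ≤ t → C.belief κ (stepPolicy phat) C.π₀ e t = C.π₀ := by
  filter_upwards [ae_clock_pos] with e he t ht
  rw [belief_of_lt_waitingTime, path_stepPolicy hκ h C.π₀_mem h ht]
  · simp [freeFlow]
  · rw [lt_waitingTime_iff hκ (isPolicy_stepPolicy phat) (admissible_stepPolicy hκ h)
      C.π₀_mem ht, hazard_stepPolicy hκ h C.π₀_mem h ht]
    exact he

theorem isStationary_dirac (hκ : 0 < κ) (h : C.π₀ ≤ phat) :
    C.IsStationary κ (stepPolicy phat) (Measure.dirac C.π₀) := by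
  refine ⟨inferInstance, ?_, fun t ht B hB => ?_⟩
  · rw [Measure.dirac_apply' _ measurableSet_Icc.compl, indicator_of_notMem]
    exact fun h => h C.π₀_mem
  · rw [lintegral_dirac, Measure.dirac_apply' _ hB]
    by_cases hB0 : C.π₀ ∈ B
    · rw [indicator_of_mem hB0, Pi.one_apply, ← measure_univ (μ := clockLaw)]
      refine measure_congr ?_
      filter_upwards [ae_belief_eq_π₀ hκ h] with e he
      exact propext ⟨fun _ => trivial, fun _ => by
        change C.belief κ (stepPolicy phat) C.π₀ e t ∈ B
        rwa [he t ht]⟩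
    · rw [indicator_of_notMem hB0]
      have h1 : ∀ᵐ e ∂clockLaw, C.belief κ (stepPolicy phat) C.π₀ e t ∉ B := by
        filter_upwards [ae_belief_eq_π₀ hκ h] with e he
        rwa [he t ht]
      simpa [ae_iff] using h1

/-- If one of the first clocks is large, the belief settles near the stationary belief. -/
theorem abs_belief_sub_le (hκ : 0 < κ) (h : C.π₀ ≤ phat) {T t₁ ε : ℝ} (hT : 0 ≤ T)
    (hTp : ∀ q ∈ Icc (0 : ℝ) 1, C.path κ (stepPolicy phat) q T ≤ phat) (ht₁ : 0 ≤ t₁)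
    (hε : ∀ q ∈ Icc (0 : ℝ) 1, ∀ t, t₁ ≤ t → |C.path κ (stepPolicy phat) q t - C.π₀| ≤ ε)
    {q : ℝ} (hq : q ∈ Icc (0 : ℝ) 1) {e : ℕ → ℝ} {N k : ℕ} (hk : k < N) (he : κ * T < e k) :
    |C.belief κ (stepPolicy phat) q e (N * T + t₁) - C.π₀| ≤ ε := by
  have hadm := admissible_stepPolicy hκ h
  have hy := isPolicy_stepPolicy phat
  have hNT : (0 : ℝ) ≤ N * T := by positivity
  have hW : ∀ q ∈ Icc (0 : ℝ) 1, ∀ x, C.waitingTime κ (stepPolicy phat) q x ≠ ∞ →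
      C.waitingTime κ (stepPolicy phat) q x ≤ ENNReal.ofReal T := fun q hq x hx => by
    rw [waitingTime_le_iff hκ hy hadm hq hT]
    by_contra! hcon
    exact hx (waitingTime_eq_top hκ h hT hTp hq hcon)
  have hbig : ∀ q ∈ Icc (0 : ℝ) 1, C.waitingTime κ (stepPolicy phat) q (e k) = ∞ :=
    fun q hq => waitingTime_eq_top hκ h hT hTp hq ((hazard_le hκ.le hy hadm hq hT).trans_lt he)
  have hDk : C.detectionTime κ (stepPolicy phat) q e k = ∞ := by
    cases k with
    | zero => exact hbig q hq
    | succ k => rw [detectionTime, hbig 1 one_mem_unit, add_top]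
  have hD : ∀ n, C.detectionTime κ (stepPolicy phat) q e n ≠ ∞ →
      C.detectionTime κ (stepPolicy phat) q e n ≤ ENNReal.ofReal ((n + 1) * T) := fun n => by
    induction n with
    | zero => intro hn; simpa [detectionTime] using hW q hq _ hn
    | succ n ih =>
      intro hn
      rw [detectionTime] at hn ⊢
      rw [ENNReal.add_ne_top] at hn
      refine (add_le_add (ih hn.1) (hW 1 one_mem_unit _ hn.2)).trans_eq ?_
      rw [← ENNReal.ofReal_add (by positivity) hT]
      congr 1
      push_cast
      ring
  rcases belief_cases (C := C) (κ := κ) (y := stepPolicy phat) (q := q) e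
    (add_nonneg hNT ht₁) with hb | ⟨n, hn, -, hb⟩
  · rw [hb]; exact hε q hq _ (by linarith)
  · rw [hb]
    refine hε 1 one_mem_unit _ ?_
    have hne := ne_top_of_le_ne_top ENNReal.ofReal_ne_top hn
    have hnk : n < k := by
      by_contra! hcon
      have := detectionTime_mono (C := C) (κ := κ) (y := stepPolicy phat) (q := q) e hcon
      rw [hDk] at this
      exact hne (top_le_iff.1 this)
    have h1 := ENNReal.toReal_le_of_le_ofReal (by positivity) (hD n hne)
    have h2 : ((n : ℝ) + 1) * T ≤ N * T :=
      mul_le_mul_of_nonneg_right (by exact_mod_cast (by omega : n + 1 ≤ N)) hT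
    linarith

/-- Outside the event that the first `N` clocks are all at most `κ * T`, the belief at time `N * T +
t₁` is within `ε` of `π₀`. That event becomes negligible as `N` grows, so stationarity leaves no
mass away from `π₀`. -/
theorem isLongRunLaw_dirac (hκ : 0 < κ) (h : C.π₀ ≤ phat) :
    C.IsLongRunLaw κ (stepPolicy phat) (Measure.dirac C.π₀) := by
  refine ⟨isStationary_dirac hκ h, fun Φ hΦ => ?_⟩
  have := hΦ.1
  have hae : ∀ᵐ q ∂Φ, q ∈ Icc (0 : ℝ) 1 := by
    rw [ae_iff]; exact hΦ.2.1
  obtain ⟨T, hT, hTp⟩ := exists_path_le_cutoff hκ h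
  have hfar : ∀ ε, 0 < ε → Φ {p | ε < |p - C.π₀|} = 0 := fun ε hε => by
    obtain ⟨t₁, ht₁, hclose⟩ := exists_abs_path_sub_le hκ h hε
    have hM : 0 ≤ κ * T := mul_nonneg hκ.le hT
    have hmeas : MeasurableSet {p : ℝ | ε < |p - C.π₀|} :=
      measurableSet_lt measurable_const (by fun_prop)
    refine le_antisymm (ge_of_tendsto' (tendsto_clockLaw_forall_le (κ * T)) fun N => ?_) bot_le
    rw [← hΦ.2.2 (N * T + t₁) (by positivity) _ hmeas, ← clockLaw_forall_le hM 0 N]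
    calc _ ≤ ∫⁻ _, clockLaw {e | ∀ k, k < N → e (0 + k) ≤ κ * T} ∂Φ := by
          refine lintegral_mono_ae ?_
          filter_upwards [hae] with q hq
          refine measure_mono fun e he k hk => ?_
          by_contra! hcon
          rw [zero_add] at hcon
          exact absurd (abs_belief_sub_le hκ h hT hTp ht₁ hclose hq hk hcon) (not_le.2 he)
      _ = _ := by rw [lintegral_const, measure_univ, mul_one]
  have hne : Φ {C.π₀}ᶜ = 0 := by
    have hcov : ({C.π₀}ᶜ : Set ℝ) ⊆ ⋃ n : ℕ, {p | 1 / ((n : ℝ) + 1) < |p - C.π₀|} :=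
      fun p hp => by
        obtain ⟨n, hn⟩ := exists_nat_one_div_lt (abs_pos.2 (sub_ne_zero.2 hp))
        exact mem_iUnion.2 ⟨n, hn⟩
    exact measure_mono_null hcov (measure_iUnion_null fun n => hfar _ (by positivity))
  refine Measure.ext fun B hB => ?_
  rw [Measure.dirac_apply' _ hB]
  by_cases hB0 : C.π₀ ∈ B
  · rw [indicator_of_mem hB0, Pi.one_apply, ← prob_compl_eq_zero_iff hB]
    exact measure_mono_null (show Bᶜ ⊆ {C.π₀}ᶜ from
      fun p hp hp0 => hp (by rwa [mem_singleton_iff.1 hp0])) hne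
  · rw [indicator_of_notMem hB0]
    exact measure_mono_null (show B ⊆ {C.π₀}ᶜ from
      fun p hp hp0 => hB0 (by rwa [← mem_singleton_iff.1 hp0])) hne

theorem enforcementGivenHigh_dirac (h : C.π₀ ≤ phat) :
    C.enforcementGivenHigh (stepPolicy phat) (Measure.dirac C.π₀) = 0 := by
  have h1 : ∀ᵐ p ∂Measure.dirac C.π₀, stepPolicy phat p = 0 :=
    (ae_dirac_iff ((isPolicy_stepPolicy phat).1 (measurableSet_singleton 0))).2
      (stepPolicy_of_le h)
  exact integral_eq_zero_of_ae (withDensity_absolutelyContinuous _ _ h1)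

end Inactive

/-! ### Losses -/

section Loss

variable {C : Chain} {c κ : ℝ} {y : ℝ → ℝ}

theorem expectedLoss_eq {r a : ℝ} (hr : 0 < r) (ha : 0 ≤ a) {q : ℝ}
    (h : ∀ᵐ e ∂clockLaw, ∀ t, 0 < t →
      flowLoss c κ (C.belief κ y q e t) (y (C.belief κ y q e t)) = a) :
    expectedLoss C c r κ y q = ENNReal.ofReal (a / r) := by
  have h1 : ∫⁻ t in Ioi (0 : ℝ), ENNReal.ofReal (a * Real.exp (-r * t)) =
      ENNReal.ofReal (a / r) := by
    simp only [ENNReal.ofReal_mul ha, neg_mul]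
    rw [lintegral_const_mul _ (by fun_prop), setLIntegral_congr Ioi_ae_eq_Ici,
      lintegral_Ici_exp hr, ← ENNReal.ofReal_mul ha, mul_one_div]
  have h2 : expectedLoss C c r κ y q = ∫⁻ _, ENNReal.ofReal (a / r) ∂clockLaw := by
    refine lintegral_congr_ae ?_
    filter_upwards [h] with e he
    rw [← h1]
    exact setLIntegral_congr_fun measurableSet_Ioi fun t ht => by rw [he t ht]
  rw [h2, lintegral_const, measure_univ, mul_one]

/-- The belief never leaves `[c / κ, 1]`. Above the cutoff full enforcement costs `c`; at the cutoff
`p * κ = c`, so every level costs `c`. -/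
theorem expectedLoss_cutoff (hc : 0 < c) (hκ : 0 < κ)
    (hp : c / κ ∈ Ioo (C.π₁ κ) C.π₀) (hy : IsPolicy y) (hcut : C.IsCutoffPolicy κ (c / κ) y)
    {r : ℝ} (hr : 0 < r) {q : ℝ} (hq : q ∈ Icc (c / κ) 1) :
    expectedLoss C c r κ y q = ENNReal.ofReal (c / r) := by
  have hp01 := cutoff_mem hκ hp
  refine expectedLoss_eq hr hc.le (Filter.Eventually.of_forall fun e t ht => ?_)
  have hb : C.belief κ y q e t ∈ Icc (c / κ) 1 :=
    belief_mem_of_forall_path_mem (fun _ ht => path_mem_of_cutoff hκ hp hy hcut hq ht)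
      (fun _ ht => path_mem_of_cutoff hκ hp hy hcut ⟨hp01.2.le, le_rfl⟩ ht) e ht.le
  rcases hb.1.eq_or_lt with h | h
  · rw [← h, flowLoss, div_mul_cancel₀ _ hκ.ne']
    ring
  · rw [(hcut.1 _ ⟨hp01.1.le.trans hb.1, hb.2⟩).1 h, flowLoss]
    ring

theorem expectedLoss_stepPolicy (hκ : 0 < κ) {phat : ℝ} (h : C.π₀ ≤ phat) {r : ℝ}
    (hr : 0 < r) :
    expectedLoss C c r κ (stepPolicy phat) C.π₀ = ENNReal.ofReal (C.π₀ * κ / r) := by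
  refine expectedLoss_eq hr (mul_nonneg C.π₀_pos.le hκ.le) ?_
  filter_upwards [ae_belief_eq_π₀ hκ h] with e he t ht
  rw [he t ht.le, stepPolicy_of_le h, flowLoss]
  ring

/-- The slope `c - p * κ` of the flow loss in enforcement changes sign at the cutoff. -/
theorem IsCutoffPolicy.isGreedy (hκ : 0 < κ) (hcut : C.IsCutoffPolicy κ (c / κ) y) :
    IsGreedy c κ y := by
  intro p hp v hv
  have key : ∀ w, flowLoss c κ p w = p * κ + (c - p * κ) * w := fun w => by
    rw [flowLoss]; ring
  rw [key, key]
  rcases lt_trichotomy p (c / κ) with h | h | h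
  · rw [(hcut.1 p hp).2 h]
    rw [lt_div_iff₀ hκ] at h
    nlinarith [hv.1]
  · rw [h, div_mul_cancel₀ _ hκ.ne']
    simp
  · rw [(hcut.1 p hp).1 h]
    rw [div_lt_iff₀ hκ] at h
    nlinarith [hv.2]

end Loss

end Chain

namespace Chain

/-! ### The deterring crime rate -/

section Deterring

variable {C : Chain} {c ℓ ybar : ℝ}

/-- The policy with cutoff `phat` and enforcement `z` at the cutoff. -/
noncomputable def cutoffPolicy (phat z : ℝ) : ℝ → ℝ :=
  fun p => if phat < p then 1 else if p < phat then 0 else z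

theorem isCutoffPolicy_cutoffPolicy (C : Chain) (κ phat : ℝ) :
    C.IsCutoffPolicy κ phat (cutoffPolicy phat (C.stayLevel κ phat)) :=
  ⟨fun _ _ => ⟨fun h => if_pos h, fun h => by
    rw [cutoffPolicy, if_neg (not_lt.2 h.le), if_pos h]⟩, fun _ => by simp [cutoffPolicy]⟩

theorem isPolicy_cutoffPolicy {phat z : ℝ} (hz : z ∈ Icc (0 : ℝ) 1) :
    IsPolicy (cutoffPolicy phat z) := by
  refine ⟨Measurable.ite measurableSet_Ioi measurable_const
    (Measurable.ite measurableSet_Iio measurable_const measurable_const), fun p _ => ?_⟩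
  rw [cutoffPolicy]
  split_ifs
  · exact one_mem_unit
  · exact ⟨le_rfl, zero_le_one⟩
  · exact hz

theorem exists_cutoffPolicy {κ phat : ℝ} (hκ : 0 < κ) (hp : phat ∈ Ioo (C.π₁ κ) C.π₀) :
    ∃ y, IsPolicy y ∧ C.IsCutoffPolicy κ phat y := by
  have hp01 := cutoff_mem hκ hp
  exact ⟨_, isPolicy_cutoffPolicy ⟨(C.stayLevel_pos hκ ⟨hp01.1, hp.2⟩).le,
    (C.stayLevel_lt_one hκ ⟨hp.1, hp01.2⟩).le⟩, C.isCutoffPolicy_cutoffPolicy κ phat⟩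

/-- Uniqueness of the stationary law, and the independence of its enforcement from the chosen
policy, reduce deterrence to one scalar equation. -/
theorem isDeterringCutoff_iff {κ phat : ℝ} (hκ : 0 < κ) :
    C.IsDeterringCutoff ybar κ phat ↔
      phat ∈ Ioo (C.π₁ κ) C.π₀ ∧ C.cutoffEnforcement κ phat = ybar := by
  constructor
  · rintro ⟨hp, y, Φ, hy, hcut, -, hΦ, hE⟩
    have h := (hcut.isLongRunLaw hκ hp hy).2 Φ hΦ.1
    rw [h, hcut.enforcementGivenHigh_eq hκ hp hy] at hE
    exact ⟨hp, hE⟩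
  · rintro ⟨hp, hE⟩
    obtain ⟨y, hy, hcut⟩ := exists_cutoffPolicy hκ hp
    exact ⟨hp, y, _, hy, hcut, hcut.admissible hκ hp hy, hcut.isLongRunLaw hκ hp hy,
      (hcut.enforcementGivenHigh_eq hκ hp hy).trans hE⟩

/-- The sign of the difference between expected and target enforcement, at crime rate `ℓ` and
cutoff `c / ℓ`. -/
noncomputable def deterrenceGap (C : Chain) (c ybar ℓ : ℝ) : ℝ :=
  C.stayLevel ℓ (c / ℓ) * (1 - ybar) -
    ybar * (1 - C.stayLevel ℓ (c / ℓ)) * C.reachProb ℓ (c / ℓ)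

/-- The gap is the difference cleared of its positive denominator. -/
theorem cutoffEnforcement_sub (hℓ : 0 < ℓ) (hp : c / ℓ ∈ Ioo (C.π₁ ℓ) C.π₀) :
    ∃ d, 0 < d ∧ (C.cutoffEnforcement ℓ (c / ℓ) - ybar) * d = C.deterrenceGap c ybar ℓ := by
  have hp01 := cutoff_mem hℓ hp
  have hz := C.stayLevel_pos hℓ ⟨hp01.1, hp.2⟩
  have hz1 := C.stayLevel_lt_one hℓ ⟨hp.1, hp01.2⟩
  have hσ := C.reachProb_pos hℓ ⟨hp.1, hp01.2⟩
  have hd : 0 < C.stayLevel ℓ (c / ℓ) + (1 - C.stayLevel ℓ (c / ℓ)) * C.reachProb ℓ (c / ℓ) :=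
    add_pos hz (mul_pos (sub_pos.2 hz1) hσ)
  refine ⟨_, hd, ?_⟩
  rw [cutoffEnforcement, sub_mul, div_mul_cancel₀ _ hd.ne', deterrenceGap]
  ring

/-- The crime rates at which the belief `c / ℓ` is above `π₁`. -/
theorem π₁_lt_div_iff (hc : 0 < c) (hℓ : c < ℓ) :
    C.π₁ ℓ < c / ℓ ↔ (C.ρL - c) * ℓ < (C.ρL + C.ρH - c) * c := by
  have hℓ0 : 0 < ℓ := hc.trans hℓ
  rw [← C.drift_one_neg_iff hℓ0 ⟨div_pos hc hℓ0, (div_lt_one hℓ0).2 hℓ⟩]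
  have h : C.drift ℓ (c / ℓ) 1 = ((C.ρL - c) * ℓ - (C.ρL + C.ρH - c) * c) / ℓ := by
    rw [drift]
    field_simp
    ring
  rw [h, div_lt_iff₀ hℓ0, zero_mul, sub_neg]

theorem stayLevel_div (hc : 0 < c) (hℓ : c < ℓ) :
    C.stayLevel ℓ (c / ℓ) = (C.ρL * ℓ - (C.ρL + C.ρH) * c) / (c * (ℓ - c)) := by
  have hℓ0 : 0 < ℓ := hc.trans hℓ
  have h1 : ℓ - c ≠ 0 := (sub_pos.2 hℓ).ne'
  rw [stayLevel]
  field_simp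
  ring

theorem continuousOn_deterrenceGap (hc : 0 < c) (ybar : ℝ) :
    ContinuousOn (C.deterrenceGap c ybar) {ℓ | c < ℓ ∧ C.π₁ ℓ < c / ℓ} := by
  have hpos : ∀ ℓ ∈ {ℓ | c < ℓ ∧ C.π₁ ℓ < c / ℓ}, 0 < ℓ := fun ℓ hℓ => hc.trans hℓ.1
  have h1 : ∀ ℓ ∈ {ℓ | c < ℓ ∧ C.π₁ ℓ < c / ℓ}, c / ℓ < 1 := fun ℓ hℓ =>
    (div_lt_one (hpos ℓ hℓ)).2 hℓ.1
  have hπ1 : ContinuousOn C.π₁ {ℓ | c < ℓ ∧ C.π₁ ℓ < c / ℓ} := by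
    refine ContinuousOn.div (by fun_prop) (by fun_prop) fun ℓ hℓ => ?_
    have := hpos ℓ hℓ
    positivity
  have hπ2 : ContinuousOn C.π₂ {ℓ | c < ℓ ∧ C.π₁ ℓ < c / ℓ} :=
    (ContinuousOn.div (by fun_prop) (by fun_prop) fun ℓ hℓ => (hpos ℓ hℓ).ne').sub hπ1
  have hp : ContinuousOn (fun ℓ => c / ℓ) {ℓ | c < ℓ ∧ C.π₁ ℓ < c / ℓ} :=
    continuousOn_const.div continuousOn_id fun ℓ hℓ => (hpos ℓ hℓ).ne'
  have hz : ContinuousOn (fun ℓ => C.stayLevel ℓ (c / ℓ)) {ℓ | c < ℓ ∧ C.π₁ ℓ < c / ℓ} := by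
    refine ContinuousOn.div (by fun_prop) (by fun_prop) fun ℓ hℓ => ?_
    have h2 := hpos ℓ hℓ
    exact (mul_pos (mul_pos (div_pos hc h2) (sub_pos.2 (h1 ℓ hℓ))) h2).ne'
  have hodds : ContinuousOn (fun ℓ => C.oddsRatio ℓ 1 (c / ℓ))
      {ℓ | c < ℓ ∧ C.π₁ ℓ < c / ℓ} := by
    refine ContinuousOn.div (by fun_prop) (by fun_prop) fun ℓ hℓ => ?_
    have h2 := C.one_lt_π₂ (hpos ℓ hℓ)
    exact (mul_pos (by linarith [h1 ℓ hℓ]) (sub_pos.2 (C.mem_Ioo_π₁ (hpos ℓ hℓ)).2)).ne'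
  have hσ : ContinuousOn (fun ℓ => C.reachProb ℓ (c / ℓ)) {ℓ | c < ℓ ∧ C.π₁ ℓ < c / ℓ} := by
    refine ContinuousOn.mul (ContinuousOn.rpow hodds
      (hπ1.div (hπ2.sub hπ1) fun ℓ hℓ => (sub_pos.2 (C.π₁_lt_π₂ (hpos ℓ hℓ))).ne')
      fun ℓ hℓ => .inl (C.oddsRatio_pos (hpos ℓ hℓ) hℓ.2 (h1 ℓ hℓ).le le_rfl).ne')
      ((hπ2.sub continuousOn_const).div (hπ2.sub hp) fun ℓ hℓ => ?_)
    exact (sub_pos.2 ((h1 ℓ hℓ).trans (C.one_lt_π₂ (hpos ℓ hℓ)))).ne'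
  unfold deterrenceGap
  fun_prop

theorem lt_div_π₀ (C : Chain) (hc : 0 < c) : c < c / C.π₀ := by
  rw [lt_div_iff₀ C.π₀_pos]
  nlinarith [C.π₀_lt_one]

theorem deterrenceGap_neg (hc : 0 < c) (hybar : 0 < ybar) :
    C.deterrenceGap c ybar (c / C.π₀) < 0 := by
  have h0 := C.π₀_pos
  have hℓ : 0 < c / C.π₀ := div_pos hc h0
  have hz : C.stayLevel (c / C.π₀) C.π₀ = 0 := by
    have h := C.π₀_mul
    rw [stayLevel, show C.ρL * (1 - C.π₀) - C.ρH * C.π₀ = 0 by linarith, zero_div]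
  have hσ := C.reachProb_pos hℓ ⟨C.π₁_lt_π₀ hℓ, C.π₀_lt_one⟩
  rw [deterrenceGap, div_div_cancel₀ hc.ne', hz]
  have := mul_pos hybar hσ
  linarith

/-- If `c < ρL`, the cutoff `c / ℓ` meets `π₁` at a finite rate, and just before that `z` alone
exceeds `ybar`. If `c ≥ ρL`, the cutoff stays above `π₁` at the rates in question, but `reachProb`
is at most of order `1 / ℓ`. -/
theorem exists_deterrenceGap_nonneg (C : Chain) (hc : 0 < c) (hybar : ybar ∈ Ioo (0 : ℝ) 1) :
    ∃ ℓ, c / C.π₀ < ℓ ∧ C.π₁ ℓ < c / ℓ ∧ 0 ≤ C.deterrenceGap c ybar ℓ := by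
  have hL := C.ρL_pos
  have hH := C.ρH_pos
  have h0 := C.π₀_pos
  have hcπ := C.lt_div_π₀ hc
  have hπ : c / C.π₀ * C.ρL = c * (C.ρL + C.ρH) := by
    have h := C.π₀_mul
    rw [div_mul_eq_mul_div, div_eq_iff h0.ne']
    linear_combination -c * h
  rcases lt_or_ge c C.ρL with hcL | hcL
  · -- enforcement at the cutoff is nearly full when the cutoff is near `π₁`
    have hd : 0 < C.ρL - c := sub_pos.2 hcL
    -- The rate at which `c / ℓ` equals `π₁`, so that the level holding the belief there is one.
    set ℓ₁ := (C.ρL + C.ρH - c) * c / (C.ρL - c) with hℓ₁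
    have hℓ₁m : (C.ρL - c) * ℓ₁ = (C.ρL + C.ρH - c) * c := mul_div_cancel₀ _ hd.ne'
    have hlt : c / C.π₀ < ℓ₁ := by
      rw [hℓ₁, lt_div_iff₀ hd, mul_sub, hπ]
      nlinarith
    have hz1 : (C.ρL * ℓ₁ - (C.ρL + C.ρH) * c) / (c * (ℓ₁ - c)) = 1 := by
      have : 0 < ℓ₁ - c := by linarith
      rw [div_eq_one_iff_eq (by positivity)]
      linear_combination hℓ₁m
    have hcont : ContinuousAt
        (fun ℓ => (C.ρL * ℓ - (C.ρL + C.ρH) * c) / (c * (ℓ - c))) ℓ₁ := by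
      have : 0 < ℓ₁ - c := by linarith
      exact ContinuousAt.div (by fun_prop) (by fun_prop) (by positivity)
    have hev := hcont.eventually_const_lt (u := ybar) (by beta_reduce; rw [hz1]; exact hybar.2)
    obtain ⟨ℓ, hℓz, hℓ⟩ := ((hev.filter_mono nhdsWithin_le_nhds).and
      (Ioo_mem_nhdsLT hlt)).exists
    have hcℓ : c < ℓ := hcπ.trans hℓ.1
    have hℓ0 : 0 < ℓ := hc.trans hcℓ
    have hπ1 : C.π₁ ℓ < c / ℓ := by
      rw [π₁_lt_div_iff hc hcℓ, ← hℓ₁m]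
      exact mul_lt_mul_of_pos_left hℓ.2 hd
    refine ⟨ℓ, hℓ.1, hπ1, ?_⟩
    have hp : c / ℓ ∈ Ioo (C.π₁ ℓ) 1 := ⟨hπ1, (div_lt_one hℓ0).2 hcℓ⟩
    rw [← stayLevel_div hc hcℓ] at hℓz
    have hz := C.stayLevel_lt_one hℓ0 hp
    have hσ := C.reachProb_le_one hℓ0 hp
    rw [deterrenceGap]
    have := mul_le_mul_of_nonneg_left hσ
      (mul_nonneg hybar.1.le (sub_nonneg.2 hz.le))
    linarith
  · -- high crime rates make undetected drift to the cutoff unlikely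
    have hy1 : 0 < 1 - ybar := sub_pos.2 hybar.2
    -- Chosen so that `z * (1 - ybar)` equals `(ρL + ρH) / (ℓ - c)`, which is also the upper bound
    -- for `reachProb`.
    set ℓ := ((C.ρL + C.ρH) * c + c * (C.ρL + C.ρH) / (1 - ybar)) / C.ρL with hℓdef
    have hℓm : C.ρL * ℓ = (C.ρL + C.ρH) * c + c * (C.ρL + C.ρH) / (1 - ybar) :=
      mul_div_cancel₀ _ hL.ne'
    have hpos : 0 < c * (C.ρL + C.ρH) / (1 - ybar) := by positivity
    have hlt : c / C.π₀ < ℓ := by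
      refine lt_of_mul_lt_mul_right ?_ hL.le
      rw [hπ, mul_comm ℓ, hℓm]
      linarith
    have hcℓ : c < ℓ := hcπ.trans hlt
    have hℓ0 : 0 < ℓ := hc.trans hcℓ
    have hπ1 : C.π₁ ℓ < c / ℓ := by
      rw [π₁_lt_div_iff hc hcℓ]
      nlinarith
    refine ⟨ℓ, hlt, hπ1, ?_⟩
    have hp : c / ℓ ∈ Ioo (C.π₁ ℓ) 1 := ⟨hπ1, (div_lt_one hℓ0).2 hcℓ⟩
    have hd : 0 < ℓ - c := sub_pos.2 hcℓ
    have hz0 : C.stayLevel ℓ (c / ℓ) * (1 - ybar) = (C.ρL + C.ρH) / (ℓ - c) := by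
      rw [stayLevel_div hc hcℓ, hℓm]
      field_simp
      ring
    have hσ : C.reachProb ℓ (c / ℓ) ≤ (C.ρL + C.ρH) / (ℓ - c) := by
      refine (C.reachProb_le hℓ0 hp).trans ?_
      have h1 := C.π₂_sub_one_le hℓ0
      have h2 := C.one_lt_π₂ hℓ0
      have h3 : ℓ * (c / ℓ) = c := mul_div_cancel₀ _ hℓ0.ne'
      rw [div_le_div_iff₀ (by linarith [hp.2]) hd]
      have h4 : ℓ - c = ℓ * (1 - c / ℓ) := by rw [mul_sub, h3, mul_one]
      have h5 : 0 < 1 - c / ℓ := sub_pos.2 hp.2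
      rw [h4]
      nlinarith [mul_le_mul_of_nonneg_right h1 h5.le]
    have hz := C.stayLevel_lt_one hℓ0 hp
    have hzpos : 0 ≤ C.stayLevel ℓ (c / ℓ) := by
      have : 0 ≤ (C.ρL + C.ρH) / (ℓ - c) := by positivity
      rw [← hz0] at this
      exact nonneg_of_mul_nonneg_left this hy1
    have hσ0 := C.reachProb_pos hℓ0 hp
    have h6 : ybar * (1 - C.stayLevel ℓ (c / ℓ)) ≤ 1 := by
      nlinarith [hybar.1, hybar.2]
    rw [deterrenceGap, hz0]
    have := mul_le_of_le_one_left hσ0.le h6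
    linarith

/-- The deterring crime rate: up to it, cutoffs that attract the belief deter too little. -/
theorem exists_deterringRate (C : Chain) (hc : 0 < c) (hybar : ybar ∈ Ioo (0 : ℝ) 1) :
    ∃ ℓM, 0 < ℓM ∧ c / ℓM ∈ Ioo (C.π₁ ℓM) C.π₀ ∧ C.cutoffEnforcement ℓM (c / ℓM) = ybar ∧
      (∀ ℓ, 0 < ℓ → c / ℓ < C.π₀ → ℓ ≤ ℓM →
        c / ℓ ∈ Ioo (C.π₁ ℓ) C.π₀ ∧ C.cutoffEnforcement ℓ (c / ℓ) ≤ ybar) ∧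
      ∀ ℓ, 0 < ℓ → c / ℓ ∈ Ioo (C.π₁ ℓ) C.π₀ → C.cutoffEnforcement ℓ (c / ℓ) = ybar →
        ℓM ≤ ℓ := by
  have h0 := C.π₀_pos
  have hcπ := C.lt_div_π₀ hc
  have hℓ₀ : 0 < c / C.π₀ := div_pos hc h0
  have hlt : ∀ ℓ, 0 < ℓ → (c / ℓ < C.π₀ ↔ c / C.π₀ < ℓ) := fun ℓ hℓ => by
    rw [div_lt_iff₀ hℓ, div_lt_iff₀ h0, mul_comm]
  obtain ⟨b, hb, hbπ, hgap⟩ := C.exists_deterrenceGap_nonneg hc hybar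
  -- By `π₁_lt_div_iff` the condition is a linear inequality in `ℓ`, so it passes from the endpoints
  -- to the interval.
  have hdom : ∀ ℓ ∈ Icc (c / C.π₀) b, c < ℓ ∧ C.π₁ ℓ < c / ℓ := fun ℓ hℓ => by
    have hcℓ := hcπ.trans_le hℓ.1
    refine ⟨hcℓ, (π₁_lt_div_iff hc hcℓ).2 ?_⟩
    have e1 := (π₁_lt_div_iff hc (hcπ.trans hb)).1 hbπ
    have e2 := (π₁_lt_div_iff hc hcπ).1 (by
      rw [div_div_cancel₀ hc.ne']; exact C.π₁_lt_π₀ hℓ₀)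
    rcases le_total C.ρL c with h | h
    · exact (mul_le_mul_of_nonpos_left hℓ.1 (sub_nonpos.2 h)).trans_lt e2
    · exact (mul_le_mul_of_nonneg_left hℓ.2 (sub_nonneg.2 h)).trans_lt e1
  have hcont : ContinuousOn (C.deterrenceGap c ybar) (Icc (c / C.π₀) b) :=
    (continuousOn_deterrenceGap hc ybar).mono hdom
  have hneg := C.deterrenceGap_neg hc hybar.1
  have hcomp : IsCompact (Icc (c / C.π₀) b ∩ C.deterrenceGap c ybar ⁻¹' {0}) :=
    isCompact_Icc.of_isClosed_subset
      (hcont.preimage_isClosed_of_isClosed isClosed_Icc isClosed_singleton) inter_subset_left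
  have hzero : ∀ a ∈ Icc (c / C.π₀) b, 0 ≤ C.deterrenceGap c ybar a →
      ∃ ℓ ∈ Icc (c / C.π₀) b ∩ C.deterrenceGap c ybar ⁻¹' {0}, ℓ ≤ a := fun a ha hga => by
    obtain ⟨ℓ, hℓ, hℓ0⟩ := intermediate_value_Icc ha.1
      (hcont.mono (Icc_subset_Icc_right ha.2)) ⟨hneg.le, hga⟩
    exact ⟨ℓ, ⟨⟨hℓ.1, hℓ.2.trans ha.2⟩, hℓ0⟩, hℓ.2⟩
  obtain ⟨ℓM, ⟨hM, hM0⟩, hleast⟩ := hcomp.exists_isLeast (by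
    obtain ⟨ℓ, hℓ, -⟩ := hzero b ⟨hb.le, le_rfl⟩ hgap
    exact ⟨ℓ, hℓ⟩)
  rw [mem_preimage, mem_singleton_iff] at hM0
  have hMlt : c / C.π₀ < ℓM := lt_of_le_of_ne hM.1 fun h => by
    rw [← h] at hM0
    exact hneg.ne hM0
  have hMpos : 0 < ℓM := hℓ₀.trans hMlt
  have hMmem : c / ℓM ∈ Ioo (C.π₁ ℓM) C.π₀ := ⟨(hdom ℓM hM).2, (hlt ℓM hMpos).2 hMlt⟩
  refine ⟨ℓM, hMpos, hMmem, ?_, fun ℓ hℓ hℓπ hℓM => ?_, fun ℓ hℓ hp hE => ?_⟩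
  · obtain ⟨d, hd, h⟩ := cutoffEnforcement_sub (ybar := ybar) hMpos hMmem
    rw [hM0] at h
    linarith [(mul_eq_zero.1 h).resolve_right hd.ne']
  · have hℓm : ℓ ∈ Icc (c / C.π₀) b := ⟨((hlt ℓ hℓ).1 hℓπ).le, hℓM.trans hM.2⟩
    have hp : c / ℓ ∈ Ioo (C.π₁ ℓ) C.π₀ := ⟨(hdom ℓ hℓm).2, hℓπ⟩
    refine ⟨hp, ?_⟩
    obtain ⟨d, hd, h⟩ := cutoffEnforcement_sub (ybar := ybar) hℓ hp
    -- A positive gap at `ℓ` would force a zero no later than `ℓ`; minimality gives `ℓ = ℓM`, where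
    -- the gap is zero.
    have hle : C.deterrenceGap c ybar ℓ ≤ 0 := by
      by_contra! hcon
      obtain ⟨u, hu, huℓ⟩ := hzero ℓ hℓm hcon.le
      have h1 : ℓ = ℓM := le_antisymm hℓM ((hleast hu).trans huℓ)
      rw [h1, hM0] at hcon
      exact lt_irrefl _ hcon
    rw [← h] at hle
    linarith [nonpos_of_mul_nonpos_left hle hd]
  -- Zeros were minimized only over rates up to `b`; any rate beyond `b` exceeds `ℓM` anyway.
  · rcases le_total ℓ b with h | h
    · refine hleast ⟨⟨((hlt ℓ hℓ).1 hp.2).le, h⟩, ?_⟩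
      obtain ⟨d, -, hd⟩ := cutoffEnforcement_sub (ybar := ybar) hℓ hp
      rw [hE, sub_self, zero_mul] at hd
      exact hd.symm
    · exact hM.2.trans h

end Deterring

end Chain

/-! ### Non-predictive enforcement -/

section NonPredictive

variable {C : Chain} {c ybar lam : ℝ}

/-- When enforcement is too costly even against full crime, nobody enforces; otherwise both sides
are made indifferent, by `π₀ * lam * x = c` and `v = ybar`. -/
theorem exists_isNPEquilibrium (hc : 0 < c) (hlam : 0 < lam) (hybar : ybar ∈ Ioo (0 : ℝ) 1) :
    ∃ x v, IsNPEquilibrium C c ybar lam x v := by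
  have h0 := C.π₀_pos
  rcases lt_or_ge (C.π₀ * lam) c with h | h
  · refine ⟨1, 0, ⟨le_rfl, zero_le_one⟩, fun w hw => ?_, Chain.one_mem_unit,
      fun h => absurd h (not_lt.2 hybar.1.le), fun _ => rfl⟩
    rw [flowLoss, flowLoss]
    nlinarith [hw.1]
  · have hx : C.π₀ * (lam * (c / (C.π₀ * lam))) = c := by field_simp
    refine ⟨c / (C.π₀ * lam), ybar, ⟨hybar.1.le, hybar.2.le⟩, fun w _ => ?_,
      ⟨by positivity, div_le_one_of_le₀ h (by positivity)⟩,
      fun h => absurd h (lt_irrefl _), fun h => absurd h (lt_irrefl _)⟩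
    rw [flowLoss, flowLoss, hx]
    linarith

/-- If `π₀ * lam * x < c`, enforcement is zero and crime is full; if it exceeds `c`, enforcement is
full and crime is zero, a contradiction. Equality fixes `x`. -/
theorem IsNPEquilibrium.eq_min (hc : 0 < c) (hlam : 0 < lam) (hybar : ybar ∈ Ioo (0 : ℝ) 1) {x v : ℝ}
    (h : IsNPEquilibrium C c ybar lam x v) : x = min 1 (c / (C.π₀ * lam)) := by
  obtain ⟨hv, hopt, hx, hx0, hx1⟩ := h
  have h0 := mul_pos C.π₀_pos hlam
  have e0 := hopt 0 ⟨le_rfl, zero_le_one⟩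
  have e1 := hopt 1 ⟨zero_le_one, le_rfl⟩
  rw [flowLoss, flowLoss] at e0 e1
  rcases lt_trichotomy (C.π₀ * lam * x) c with h | h | h
  · have hv0 : v ≤ 0 := by
      by_contra! hcon
      nlinarith
    have hx : x = 1 := hx1 (hv0.trans_lt hybar.1)
    rw [hx, mul_one] at h
    rw [hx, min_eq_left ((one_le_div h0).2 h.le)]
  · have hxe : x = c / (C.π₀ * lam) := by rw [eq_div_iff h0.ne', mul_comm]; exact h
    rw [← hxe, min_eq_right hx.2]
  · have hv1 : 1 ≤ v := by
      by_contra! hcon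
      nlinarith
    have hx : x = 0 := hx0 (hybar.2.trans_le hv1)
    have : c < 0 := by rw [hx] at h; simpa using h
    linarith

end NonPredictive

end Enforcement

/-! ### The equilibria below and above the deterring rate. -/

theorem proposition5 (C : Enforcement.Chain) (c ybar : ℝ) (hc : 0 < c)
    (hybar : ybar ∈ Set.Ioo (0 : ℝ) 1) :
    ∃ lamM : ℝ,
      IsLeast {ℓ : ℝ | 0 < ℓ ∧ C.IsDeterringCutoff ybar ℓ (c / ℓ)} lamM ∧
      ∀ lam : ℝ, 0 < lam →
        (lam ≤ lamM →
          (∃ y : ℝ → ℝ,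
            Enforcement.IsGPEquilibrium C c ybar lam 1 y ∧
            C.IsCutoffPolicy lam (c / lam) y ∧
            ∀ r : ℝ, 0 < r → ∀ q ∈ C.longRunPriors lam (c / lam),
              Enforcement.expectedLoss C c r lam y q =
                ENNReal.ofReal (min (C.π₀ * lam) c / r)) ∧
          min 1 (c / (C.π₀ * lam)) ≤ 1 ∧
          (∃ x v : ℝ, Enforcement.IsNPEquilibrium C c ybar lam x v) ∧
          (∀ x v : ℝ, Enforcement.IsNPEquilibrium C c ybar lam x v →
            x = min 1 (c / (C.π₀ * lam)))) ∧
        (lamM < lam →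
          lamM / lam ∈ Set.Ioo (0 : ℝ) 1 ∧
          ∃ y : ℝ → ℝ,
            Enforcement.IsGPEquilibrium C c ybar lam (lamM / lam) y ∧
            C.IsCutoffPolicy (lam * (lamM / lam)) (c / lamM) y ∧
            ∀ r : ℝ, 0 < r → ∀ q ∈ C.longRunPriors (lam * (lamM / lam)) (c / lamM),
              Enforcement.expectedLoss C c r (lam * (lamM / lam)) y q =
                ENNReal.ofReal (min (C.π₀ * lam) c / r)) := by
  obtain ⟨ℓM, hM, hMp, hME, hbelow, hleast⟩ := C.exists_deterringRate hc hybar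
  refine ⟨ℓM, ⟨⟨hM, (Enforcement.Chain.isDeterringCutoff_iff hM).2 ⟨hMp, hME⟩⟩, fun ℓ hℓ => ?_⟩,
    fun lam hlam => ⟨fun hle => ⟨?_, min_le_left _ _,
      Enforcement.exists_isNPEquilibrium hc hlam hybar,
      fun x v h => h.eq_min hc hlam hybar⟩, fun hlt => ?_⟩⟩
  · have h := (Enforcement.Chain.isDeterringCutoff_iff hℓ.1).1 hℓ.2
    exact hleast ℓ hℓ.1 h.1 h.2
  · rcases le_or_gt C.π₀ (c / lam) with h | h
    · have hmin : min (C.π₀ * lam) c = C.π₀ * lam := min_eq_left ((le_div_iff₀ hlam).1 h)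
      have hcut := Enforcement.Chain.isCutoffPolicy_stepPolicy (C := C) (κ := lam) h
      refine ⟨_, ?_, hcut, fun r hr q hq => ?_⟩
      · rw [Enforcement.IsGPEquilibrium, mul_one]
        refine ⟨Enforcement.Chain.isPolicy_stepPolicy _,
          Enforcement.Chain.admissible_stepPolicy hlam h, hcut.isGreedy hlam, _,
          Enforcement.Chain.isLongRunLaw_dirac hlam h, ?_⟩
        rw [Enforcement.Chain.enforcementGivenHigh_dirac h]
        exact ⟨Enforcement.Chain.one_mem_unit,
          fun h => absurd h (not_lt.2 hybar.1.le), fun _ => rfl⟩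
      · rw [Enforcement.Chain.longRunPriors, if_pos h, Set.mem_singleton_iff] at hq
        rw [hq, hmin, Enforcement.Chain.expectedLoss_stepPolicy hlam h hr]
    · obtain ⟨hp, hE⟩ := hbelow lam hlam h hle
      have hmin : min (C.π₀ * lam) c = c := min_eq_right ((div_lt_iff₀ hlam).1 h).le
      obtain ⟨y, hy, hcut⟩ := Enforcement.Chain.exists_cutoffPolicy hlam hp
      refine ⟨y, ?_, hcut, fun r hr q hq => ?_⟩
      · rw [Enforcement.IsGPEquilibrium, mul_one]
        refine ⟨hy, hcut.admissible hlam hp hy, hcut.isGreedy hlam, _,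
          hcut.isLongRunLaw hlam hp hy, ?_⟩
        rw [hcut.enforcementGivenHigh_eq hlam hp hy]
        exact ⟨Enforcement.Chain.one_mem_unit, fun h => absurd h (not_lt.2 hE), fun _ => rfl⟩
      · rw [Enforcement.Chain.longRunPriors, if_neg (not_le.2 h), if_pos hp.1] at hq
        rw [hmin, Enforcement.Chain.expectedLoss_cutoff hc hlam hp hy hcut hr hq]
  · have hx : ℓM / lam ∈ Set.Ioo (0 : ℝ) 1 := ⟨div_pos hM hlam, (div_lt_one hlam).2 hlt⟩
    -- The effective crime rate stays at `ℓM` whatever `lam`, so policy, long-run law and loss are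
    -- those at the deterring rate.
    have hκ : lam * (ℓM / lam) = ℓM := mul_div_cancel₀ _ hlam.ne'
    have hmin : min (C.π₀ * lam) c = c := by
      refine min_eq_right (((div_lt_iff₀ hM).1 hMp.2).le.trans ?_)
      exact mul_le_mul_of_nonneg_left hlt.le C.π₀_pos.le
    obtain ⟨y, hy, hcut⟩ := Enforcement.Chain.exists_cutoffPolicy hM hMp
    refine ⟨hx, y, ?_, by rwa [hκ], fun r hr q hq => ?_⟩
    · rw [Enforcement.IsGPEquilibrium, hκ]
      refine ⟨hy, hcut.admissible hM hMp hy, hcut.isGreedy hM, _,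
        hcut.isLongRunLaw hM hMp hy, ?_⟩
      rw [hcut.enforcementGivenHigh_eq hM hMp hy, hME]
      exact ⟨⟨hx.1.le, hx.2.le⟩, fun h => absurd h (lt_irrefl _),
        fun h => absurd h (lt_irrefl _)⟩
    · rw [hκ, Enforcement.Chain.longRunPriors, if_neg (not_le.2 hMp.2), if_pos hMp.1] at hq
      rw [hκ, hmin, Enforcement.Chain.expectedLoss_cutoff hc hM hMp hy hcut hr hq]
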